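/- Let $\mathcal M=C^\infty(\mathbb R/2\pi\mathbb Z;\mathbb R^4)$ with elements $U=(u,v,w,z)$, let $D_t=\partial_t+u\,\partial_x$, $\partial=\partial_x$, and $K[U]=(v-uu_x,\;w-uv_x,\;z-uw_x,\;-uz_x)^\top$. Expressions containing $1/z_x$ are considered on the open set $\{x: z_x(x)\neq0\}$; for such operators skew-symmetry, closedness and the Jacobi identity are tested on smooth periodic fields supported in that set (and, for $\eta_\varphi$ below, in $\{z\in D\}$). Gradients are taken with respect to $(a,b)=\int_0^{2\pi}\langle a,b\rangle dx$. (1) Equivalence. For smooth functions that are $2\pi$-periodic in $x$, on an open set of times, $D_t^4u=0$ is equivalent to $U_t=K[U]$: if $D_t^4u=0$, then $(u,D_tu,D_t^2u,D_t^3u)$ solves $U_t=K[U]$, and every solution of $U_t=K[U]$ has this form with $D_t^4u=0$. (2) Hamiltonian form. Let $H=\int_0^{2\pi}(uz_x-vw_x)\,dx$, $A=(v_x^2-2u_xw_x)z_x^{-2}$ and $$\vartheta^{-1}=\begin{pmatrix}0&0&-\partial&\partial\frac{w_x}{z_x}\\0&\partial&0&-\partial\frac{v_x}{z_x}\\-\partial&0&0&\partial\frac{u_x}{z_x}\\\frac{w_x}{z_x}\partial&-\frac{v_x}{z_x}\partial&\frac{u_x}{z_x}\partial&\frac12(A\partial+\partial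 A)\end{pmatrix}.$$ Then $\vartheta^{-1}K=-\operatorname{grad}H$ where $z_x\ne0$. The operator $\vartheta^{-1}$ is co-implectic (skew, with closed two-form) and degenerate: $\vartheta^{-1}(fU_x)=0$ for every smooth $f$, and $\langle U_x,\vartheta^{-1}Y\rangle=0$ for all $Y$. The nonlocal operator $$\vartheta=-\begin{pmatrix}0&0&\partial^{-1}&u_x\partial^{-1}\\0&-\partial^{-1}&0&v_x\partial^{-1}\\\partial^{-1}&0&0&w_x\partial^{-1}\\\partial^{-1}u_x&\partial^{-1}v_x&\partial^{-1}w_x&z_x\partial^{-1}+\partial^{-1}z_x\end{pmatrix}$$ ($\partial^{-1}$ being any periodic antiderivative) is skew, satisfies $K=-\vartheta\operatorname{grad}H$ on all of $\mathcal M$, and $\vartheta^{-1}\vartheta g=g$ for covectors $g$ in its domain with $\langle U_x,g\rangle=0$, for a suitable choice of the integration constant (up to adding a constant to the fourth component of $\vartheta g$). (3) Bi-Hamiltonian structures. For every open $D\subset\mathbb R$ and $\varphi\in C^\infty(D)$ the operator $$\eta_\varphi=\frac{\varphi(z)}{z_x}\begin{pmatrix}0&1&u_x&0\\-1&0&v_x&0\\-u_x&-v_x&0&-z_x\\0&0&z_x&0\end{pmatrix}$$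 is implectic (skew, with the Jacobi identity), so that any two operators $\eta_\varphi,\eta_\psi$ are compatible; $\eta_\varphi$ is compatible with $\vartheta^{-1}$ in the sense that $\vartheta^{-1}\eta_\varphi\vartheta^{-1}$ is again co-implectic; and $\eta_1$ is nondegenerate. With $A_n=\int_0^{2\pi}\big[z^nz_x(uw-\tfrac12v^2)+\tfrac{z^{n+2}}{n+2}\big]dx$ one has $K=-\eta_{z^{-n}}\operatorname{grad}A_n$ for all $n\ge0$ (where $z_x\neq0$ and $z^n\ne0$); in particular $K=-\eta_1\operatorname{grad}A_0=-\eta_{1/z}\operatorname{grad}A_1$. (4) Lax representation. For $\lambda\in\mathbb C$ let $$\ell=\begin{pmatrix}-\lambda^3u_x&\lambda^2v_x&-\lambda w_x&z_x\\-4\lambda^4&3\lambda^3u_x&-2\lambda^2v_x&\lambda w_x\\-10\lambda^5r_1&6\lambda^4&-3\lambda^3u_x&\lambda^2v_x\\-20\lambda^6r_2&10\lambda^5r_1&-4\lambda^4&\lambda^3u_x\end{pmatrix},\quad q=\begin{pmatrix}0&0&0&0\\\lambda&0&0&0\\0&\lambda&0&0\\0&0&\lambda&0\end{pmatrix},\quad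 p=-u\ell+q .$$ Let $u,v,w,z,r_1,r_2$ be smooth on an open set of the $(t,x)$-plane. If $U_t=K[U]$ and $$D_tr_1+r_1u_x=1,\qquad D_tr_2+r_2u_x=r_1,\qquad(\ast)$$ then $f_x=\ell f$, $f_t=pf$ are compatible: $\ell_t-p_x+[\ell,p]=0$ for all $\lambda$. Conversely, if this holds for all $\lambda$, then $(\ast)$ and $\partial_x(U_t-K[U])=0$ hold. Where $z_x\ne0$, smooth solutions of $(\ast)$ along solutions of $U_t=K[U]$ are $$r_1=\tfrac{w_x}{z_x}-\tfrac{u_xw_x^2}{2z_x^2}+\tfrac{v_xw_x^3}{6z_x^3}-\tfrac{w_x^5}{30z_x^4},\qquad r_2=\tfrac{w_x^2}{2z_x^2}-\tfrac{u_xw_x^3}{3z_x^3}+\tfrac{v_xw_x^4}{8z_x^4}-\tfrac{19w_x^6}{720z_x^5}.$$ (5) Polynomial conservation laws. The following functionals are constant along every smooth $2\pi$-periodic solution of $U_t=K[U]$ on an open time interval: $A_n$ and $B_n=\int_0^{2\pi}z^nz_x(w^2-2vz)\,dx$ for all $n\ge0$, and, for arbitrary real $k_1,k_2$, the integrals over $[0,2\pi]$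 of $vw_x-uz_x$; $\;z_x(w^2-2vz)$; $\;3u_xz^2+4w_xvz+2z_xvw$; $\;z_xw-zw_x$; $3u_xz(3uz+2vw)-6v_xz(uw+v^2)+6w_x(uvz+2uw^2-v^2w)+6z(w^2-2vz)$; $k_1(z_x(2uw-v^2)+z^2)+k_2(2w_x(uz-vw)+2z_x(v^2-uw))$. The functionals $A_n,B_n$ $(n\ge0)$ on $\mathcal M$ are linearly independent, have gradients, and are pairwise in involution with respect to $\eta_1$. (6) Non-polynomial conservation laws. For arbitrary real $k_1,\dots,k_5$ let $P_1,\dots,P_{10}$ and $(d_1,\dots,d_{10})=(2,3,3,2,4,3,2,5,4,3)$ be $P_1=w_x^2-2v_xz_x$; $P_2=u_{xx}z_x-u_xz_{xx}+v_xw_{xx}-v_{xx}w_x$; $P_3=9u_x^2z_x-6u_xv_xw_x+2v_x^3-12v_xz_x+6w_x^2$; $P_4=u(2v_xz_x-w_x^2)+v(v_xw_x-3u_xz_x)+w(u_xw_x-v_x^2+2z_x)+z(u_xv_x-2w_x)$; $P_5=u_{xx}(2v_xz_x-w_x^2)+v_{xx}(v_xw_x-3u_xz_x)+w_{xx}(u_xw_x-v_x^2+2z_x)+z_{xx}(u_xv_x-2w_x)$;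 $P_6=z_xw_{xx}-z_{xx}w_x$; $P_7=k_1\big(v(2v_xz_x-w_x^2)+z(4z_x-u_xw_x)+w(v_xw_x-3u_xz_x)\big)+k_2z(2z_x+v_x^2-2u_xw_x)$; $P_8=u_{xxx}(2v_xz_x-w_x^2)+v_{xxx}(v_xw_x-3u_xz_x)+z_{xxx}(u_xv_x-2w_x)+w_{xxx}(u_xw_x-v_x^2+2z_x)+3u_{xx}(v_{xx}z_x-3v_xz_{xx}+w_{xx}w_x)+3v_{xx}(2u_xz_{xx}-v_{xx}w_x+v_xw_{xx})-3w_{xx}^2u_x$; $P_9=4u_x^2w_x^2-4u_xv_x^2w_x-8u_xz_xw_x+v_x^4+4v_x^2z_x+4z_x^2$; $P_{10}=k_3\big(u(z_xw_{xx}-z_{xx}w_x)+v(v_xz_{xx}-v_{xx}z_x)+zz_{xx}+w(u_{xx}z_x-u_xz_{xx})\big)+k_4\big(z(u_{xx}w_x-u_xw_{xx}+2z_{xx})+w(u_{xx}z_x-u_xz_{xx}-v_{xx}w_x+v_xw_{xx})\big)+k_5z_x(v_x^2-2u_xw_x+2z_x)$. Then for all $n\ge0$ and all $m\in\mathbb Z_{\ge0}^{10}\setminus\{0\}$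 the functional $\int_0^{2\pi}z^n\big(\prod_jP_j^{m_j}\big)^{1/\sum_jm_jd_j}dx$ (principal complex power) is constant along every smooth $2\pi$-periodic solution on an open time interval; in particular each $\int_0^{2\pi}P_j^{1/d_j}dx$ is. The functionals $\int_0^{2\pi}z^n(z_xw_{xx}-z_{xx}w_x)^{1/3}dx$, $n\ge0$, are linearly independent. -/

import Mathlib

open Set MeasureTheory
open scoped ContDiff

noncomputable section

namespace Riemann4

/-! ### The periodic phase space, evolutions, functionals -/

/-- Four scalar fields of `x`; the components `0, 1, 2, 3` are `u, v, w, z`.  The same type is used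
for vector fields (variations) and for covectors. -/
abbrev Fld := Fin 4 → ℝ → ℝ

/-- The phase space: smooth `2π`-periodic fields. -/
structure IsM (U : Fld) : Prop where
  smooth : ∀ i, ContDiff ℝ ∞ (U i)
  periodic : ∀ i, Function.Periodic (U i) (2 * Real.pi)

/-- The vector field of the system
`u_t = v - u u_x, v_t = w - u v_x, w_t = z - u w_x, z_t = - u z_x`. -/
def K (U : Fld) : Fld :=
  ![fun x => U 1 x - U 0 x * deriv (U 0) x,
    fun x => U 2 x - U 0 x * deriv (U 1) x,
    fun x => U 3 x - U 0 x * deriv (U 2) x,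
    fun x => - (U 0 x * deriv (U 3) x)]

/-- The convective derivative `D_t f = f_t + u f_x` of a function `f` of `(t, x)`. -/
def Dt (u f : ℝ → ℝ → ℝ) : ℝ → ℝ → ℝ :=
  fun t x => deriv (fun s => f s x) t + u t x * deriv (f t) x

/-- Joint smoothness in `(t, x)` on a set. -/
def SmoothOn (W : Set (ℝ × ℝ)) (f : ℝ → ℝ → ℝ) : Prop :=
  ContDiffOn ℝ ∞ (fun p : ℝ × ℝ => f p.1 p.2) W

/-- The system holds at every point of the set `W` of the `(t, x)`-plane. -/
def SolvesOn (W : Set (ℝ × ℝ)) (U : ℝ → Fld) : Prop :=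
  ∀ p ∈ W, ∀ i, deriv (fun s => U s i p.2) p.1 = K (U p.1) i p.2

/-- A smooth `2π`-periodic solution over the times in `I`. -/
structure IsSol (I : Set ℝ) (U : ℝ → Fld) : Prop where
  smooth : ∀ i, SmoothOn (I ×ˢ univ) (fun t => U t i)
  periodic : ∀ t ∈ I, ∀ i, Function.Periodic (U t i) (2 * Real.pi)
  eqn : SolvesOn (I ×ˢ univ) U

/-- `(u, D_t u, D_t² u, D_t³ u)`. -/
def tower (u : ℝ → ℝ → ℝ) : ℝ → Fld := fun t i => (Dt u)^[(i : ℕ)] u t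

/-- The functional `∫₀^{2π} d[U] dx` with density `d`. -/
def functional (d : Fld → ℝ → ℝ) (U : Fld) : ℝ := ∫ x in (0 : ℝ)..(2 * Real.pi), d U x

/-- The functional `F` is constant along every smooth periodic solution on an open time interval. -/
def Conserved {E : Type*} (F : Fld → E) : Prop :=
  ∀ (I : Set ℝ) (U : ℝ → Fld), IsOpen I → I.OrdConnected → IsSol I U →
    ∀ s ∈ I, ∀ t ∈ I, F (U s) = F (U t)

/-- The standard bilinear form `∫₀^{2π} ⟨a, b⟩ dx`. -/
def pair (a b : Fld) : ℝ := ∫ x in (0 : ℝ)..(2 * Real.pi), ∑ i, a i x * b i x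

/-- `g` is the gradient of the functional `F` at `U`. -/
def IsGrad (F : Fld → ℝ) (U g : Fld) : Prop :=
  IsM g ∧ ∀ φ, IsM φ → HasDerivAt (fun ε : ℝ => F (U + ε • φ)) (pair φ g) 0

/-! ### Matrix differential operators depending on the fields -/

/-- Operators `P[U]` acting on four-component fields. -/
abbrev Op := Fld → Fld → Fld

/-- The derivative of the operator `U ↦ P[U]` in the direction `c`, applied to `b`. -/
def opDeriv (P : Op) (U c b : Fld) : Fld :=
  fun i x => deriv (fun ε : ℝ => P (U + ε • c) b i x) 0

/-- The open set of points `x` where `z_x ≠ 0` and `z` lies in `D`. -/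
def reg (D : Set ℝ) (U : Fld) : Set ℝ := {x | deriv (U 3) x ≠ 0 ∧ U 3 x ∈ D}

/-- Smooth periodic test fields supported in `R`. -/
def Supported (R : Set ℝ) (a : Fld) : Prop := IsM a ∧ ∀ i, tsupport (a i) ⊆ R

/-- Skew-symmetry of `P[U]` on the fields supported in `R U`. -/
def IsSkew (P : Op) (R : Fld → Set ℝ) : Prop :=
  ∀ U, IsM U → ∀ a b, Supported (R U) a → Supported (R U) b →
    pair a (P U b) + pair b (P U a) = 0

/-- Co-implectic operator: the two-form `(a, b) ↦ ∫ ⟨a, P[U] b⟩ dx` is skew and closed. -/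
def IsCoImplectic (P : Op) (R : Fld → Set ℝ) : Prop :=
  IsSkew P R ∧
  ∀ U, IsM U → ∀ a b c, Supported (R U) a → Supported (R U) b → Supported (R U) c →
    pair a (opDeriv P U c b) + pair b (opDeriv P U a c) + pair c (opDeriv P U b a) = 0

/-- Implectic (Poisson) operator: skew, and satisfying the Jacobi identity. -/
def IsImplectic (P : Op) (R : Fld → Set ℝ) : Prop :=
  IsSkew P R ∧
  ∀ U, IsM U → ∀ a b c, Supported (R U) a → Supported (R U) b → Supported (R U) c →
    pair a (opDeriv P U (P U b) c) + pair b (opDeriv P U (P U c) a)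
      + pair c (opDeriv P U (P U a) b) = 0

/-- The co-implectic operator `ϑ⁻¹`
`( 0, 0, -∂, ∂ w_x/z_x ; 0, ∂, 0, -∂ v_x/z_x ; -∂, 0, 0, ∂ u_x/z_x ;
w_x/z_x ∂, -v_x/z_x ∂, u_x/z_x ∂, ½ (A ∂ + ∂ A) )`, `A = (v_x² - 2 u_x w_x) / z_x²`. -/
def Theta : Op := fun U Y =>
  let ux := deriv (U 0)
  let vx := deriv (U 1)
  let wx := deriv (U 2)
  let zx := deriv (U 3)
  let A : ℝ → ℝ := fun x => (vx x ^ 2 - 2 * ux x * wx x) / zx x ^ 2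
  ![fun x => - deriv (Y 2) x + deriv (fun y => wx y / zx y * Y 3 y) x,
    fun x => deriv (Y 1) x - deriv (fun y => vx y / zx y * Y 3 y) x,
    fun x => - deriv (Y 0) x + deriv (fun y => ux y / zx y * Y 3 y) x,
    fun x => wx x / zx x * deriv (Y 0) x - vx x / zx x * deriv (Y 1) x
      + ux x / zx x * deriv (Y 2) x
      + (A x * deriv (Y 3) x + deriv (fun y => A y * Y 3 y) x) / 2]

/-- The nonlocal operator `ϑ`, as a relation between covectors `g` and vectors `Y`:
`Y = ϑ g` with
`ϑ = -( 0, 0, ∂⁻¹, u_x ∂⁻¹ ; 0, -∂⁻¹, 0, v_x ∂⁻¹ ; ∂⁻¹, 0, 0, w_x ∂⁻¹ ;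
∂⁻¹ u_x, ∂⁻¹ v_x, ∂⁻¹ w_x, z_x ∂⁻¹ + ∂⁻¹ z_x )`,
where each `∂⁻¹` may return any smooth periodic antiderivative: `G i` is `∂⁻¹ (g i)` and
`S` is `∂⁻¹ (u_x g 0 + v_x g 1 + w_x g 2 + z_x g 3)`. -/
def ThetaInv (U g Y : Fld) : Prop :=
  ∃ (G : Fld) (S : ℝ → ℝ), IsM G ∧ ContDiff ℝ ∞ S ∧ Function.Periodic S (2 * Real.pi) ∧
    (∀ i x, deriv (G i) x = g i x) ∧
    (∀ x, deriv S x = ∑ i, deriv (U i) x * g i x) ∧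
    (∀ x, Y 0 x = - (G 2 x + deriv (U 0) x * G 3 x)) ∧
    (∀ x, Y 1 x = - (- G 1 x + deriv (U 1) x * G 3 x)) ∧
    (∀ x, Y 2 x = - (G 0 x + deriv (U 2) x * G 3 x)) ∧
    (∀ x, Y 3 x = - (S x + deriv (U 3) x * G 3 x))

/-- The local matrix operator
`η_φ = (φ(z)/z_x) ( 0, 1, u_x, 0 ; -1, 0, v_x, 0 ; -u_x, -v_x, 0, -z_x ; 0, 0, z_x, 0 )`. -/
def eta (φ : ℝ → ℝ) : Op := fun U g =>
  let c : ℝ → ℝ := fun x => φ (U 3 x) / deriv (U 3) x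
  ![fun x => c x * (g 1 x + deriv (U 0) x * g 2 x),
    fun x => c x * (- g 0 x + deriv (U 1) x * g 2 x),
    fun x => - (c x * (deriv (U 0) x * g 0 x + deriv (U 1) x * g 1 x + deriv (U 3) x * g 3 x)),
    fun x => c x * (deriv (U 3) x * g 2 x)]

/-! ### Hamiltonians and conservation laws -/

/-- `H = ∫ (u z_x - v w_x) dx`. -/
def H : Fld → ℝ := functional fun U x => U 0 x * deriv (U 3) x - U 1 x * deriv (U 2) x

/-- `A_n = ∫ [ z^n z_x (u w - v²/2) + z^(n+2)/(n+2) ] dx`. -/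
def HA (n : ℕ) : Fld → ℝ := functional fun U x =>
  U 3 x ^ n * deriv (U 3) x * (U 0 x * U 2 x - U 1 x ^ 2 / 2) + U 3 x ^ (n + 2) / ((n : ℝ) + 2)

/-- `B_n = ∫ z^n z_x (w² - 2 v z) dx`. -/
def HB (n : ℕ) : Fld → ℝ := functional fun U x =>
  U 3 x ^ n * deriv (U 3) x * (U 2 x ^ 2 - 2 * U 1 x * U 3 x)

/-- Six further polynomial densities, depending on arbitrary constants. -/
def polyDensity (k : Fin 5 → ℝ) (j : Fin 6) (U : Fld) (x : ℝ) : ℝ :=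
  let u := U 0 x
  let v := U 1 x
  let w := U 2 x
  let z := U 3 x
  let ux := deriv (U 0) x
  let vx := deriv (U 1) x
  let wx := deriv (U 2) x
  let zx := deriv (U 3) x
  ![v * wx - u * zx,
    3 * ux * z ^ 2 + 4 * wx * v * z + 2 * zx * v * w,
    3 * ux * z * (3 * u * z + 2 * v * w) - 6 * vx * z * (u * w + v ^ 2)
      + 6 * wx * (u * v * z + 2 * u * w ^ 2 - v ^ 2 * w) + 6 * z * (w ^ 2 - 2 * v * z),
    k 0 * (zx * (2 * u * w - v ^ 2) + z ^ 2)
      + k 1 * (2 * wx * (u * z - v * w) + 2 * zx * (v ^ 2 - u * w)),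
    zx * (w ^ 2 - 2 * v * z),
    zx * w - z * wx] j

/-- The ten radicands of the non-polynomial densities, depending on arbitrary constants. -/
def radicand (k : Fin 5 → ℝ) (j : Fin 10) (U : Fld) (x : ℝ) : ℝ :=
  let u := U 0 x
  let v := U 1 x
  let w := U 2 x
  let z := U 3 x
  let ux := deriv (U 0) x
  let vx := deriv (U 1) x
  let wx := deriv (U 2) x
  let zx := deriv (U 3) x
  let uxx := iteratedDeriv 2 (U 0) x
  let vxx := iteratedDeriv 2 (U 1) x
  let wxx := iteratedDeriv 2 (U 2) x
  let zxx := iteratedDeriv 2 (U 3) x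
  let uxxx := iteratedDeriv 3 (U 0) x
  let vxxx := iteratedDeriv 3 (U 1) x
  let wxxx := iteratedDeriv 3 (U 2) x
  let zxxx := iteratedDeriv 3 (U 3) x
  ![wx ^ 2 - 2 * vx * zx,
    uxx * zx - ux * zxx + vx * wxx - vxx * wx,
    9 * ux ^ 2 * zx - 6 * ux * vx * wx + 2 * vx ^ 3 - 12 * vx * zx + 6 * wx ^ 2,
    u * (2 * vx * zx - wx ^ 2) + v * (vx * wx - 3 * ux * zx)
      + w * (ux * wx - vx ^ 2 + 2 * zx) + z * (ux * vx - 2 * wx),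
    uxx * (2 * vx * zx - wx ^ 2) + vxx * (vx * wx - 3 * ux * zx)
      + wxx * (ux * wx - vx ^ 2 + 2 * zx) + zxx * (ux * vx - 2 * wx),
    zx * wxx - zxx * wx,
    k 0 * (v * (2 * vx * zx - wx ^ 2) + z * (4 * zx - ux * wx) + w * (vx * wx - 3 * ux * zx))
      + k 1 * (z * (2 * zx + vx ^ 2 - 2 * ux * wx)),
    uxxx * (2 * vx * zx - wx ^ 2) + vxxx * (vx * wx - 3 * ux * zx)
      + zxxx * (ux * vx - 2 * wx) + wxxx * (ux * wx - vx ^ 2 + 2 * zx)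
      + 3 * uxx * (vxx * zx - 3 * vx * zxx + wxx * wx)
      + 3 * vxx * (2 * ux * zxx - vxx * wx + vx * wxx) - 3 * wxx ^ 2 * ux,
    4 * ux ^ 2 * wx ^ 2 - 4 * ux * vx ^ 2 * wx - 8 * ux * zx * wx + vx ^ 4
      + 4 * vx ^ 2 * zx + 4 * zx ^ 2,
    k 2 * (u * (zx * wxx - zxx * wx) + v * (vx * zxx - vxx * zx) + z * zxx
        + w * (uxx * zx - ux * zxx))
      + k 3 * (z * (uxx * wx - ux * wxx + 2 * zxx)
        + w * (uxx * zx - ux * zxx - vxx * wx + vx * wxx))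
      + k 4 * (zx * (vx ^ 2 - 2 * ux * wx + 2 * zx))] j

/-- The orders of the roots to be taken of the ten radicands. -/
def rootOrder : Fin 10 → ℕ := ![2, 3, 3, 2, 4, 3, 2, 5, 4, 3]

/-- `∫ z^n (∏ⱼ Pⱼ^(mⱼ))^(1/d) dx` with `d = ∑ⱼ mⱼ dⱼ`, where `Pⱼ` are the radicands and `dⱼ` the
orders of the roots; the principal branch of the complex power is used. -/
def HN (k : Fin 5 → ℝ) (n : ℕ) (m : Fin 10 → ℕ) (U : Fld) : ℂ :=
  ∫ x in (0 : ℝ)..(2 * Real.pi), ((U 3 x ^ n : ℝ) : ℂ) *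
    ((∏ j, radicand k j U x ^ m j : ℝ) : ℂ) ^ (1 / ((∑ j, m j * rootOrder j : ℕ) : ℂ))

/-! ### Lax representation -/

/-- The matrix `ℓ[u, v, w, z; l]` of the equation `f_x = ℓ f`. -/
def ell (l : ℂ) (U : Fld) (r₁ r₂ : ℝ → ℝ) (x : ℝ) : Matrix (Fin 4) (Fin 4) ℂ :=
  let ux : ℂ := (deriv (U 0) x : ℝ)
  let vx : ℂ := (deriv (U 1) x : ℝ)
  let wx : ℂ := (deriv (U 2) x : ℝ)
  let zx : ℂ := (deriv (U 3) x : ℝ)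
  !![- l ^ 3 * ux, l ^ 2 * vx, - l * wx, zx;
     - 4 * l ^ 4, 3 * l ^ 3 * ux, - 2 * l ^ 2 * vx, l * wx;
     - 10 * l ^ 5 * (r₁ x : ℂ), 6 * l ^ 4, - 3 * l ^ 3 * ux, l ^ 2 * vx;
     - 20 * l ^ 6 * (r₂ x : ℂ), 10 * l ^ 5 * (r₁ x : ℂ), - 4 * l ^ 4, l ^ 3 * ux]

/-- The matrix `q(l)`. -/
def qMat (l : ℂ) : Matrix (Fin 4) (Fin 4) ℂ :=
  !![0, 0, 0, 0; l, 0, 0, 0; 0, l, 0, 0; 0, 0, l, 0]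

/-- The matrix `p(ℓ) = -u ℓ + q` of the equation `f_t = p(ℓ) f`. -/
def pMat (l : ℂ) (U : Fld) (r₁ r₂ : ℝ → ℝ) (x : ℝ) : Matrix (Fin 4) (Fin 4) ℂ :=
  - ((U 0 x : ℝ) : ℂ) • ell l U r₁ r₂ x + qMat l

/-- The compatibility condition `ℓ_t - p_x + [ℓ, p] = 0` of `f_x = ℓ f`, `f_t = p f`
at the point `(t, x)`. -/
def ZeroCurvature (l : ℂ) (U : ℝ → Fld) (r₁ r₂ : ℝ → ℝ → ℝ) (t x : ℝ) : Prop :=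
  Matrix.of (fun i j => deriv (fun s => ell l (U s) (r₁ s) (r₂ s) x i j) t)
    - Matrix.of (fun i j => deriv (fun y => pMat l (U t) (r₁ t) (r₂ t) y i j) x)
    + (ell l (U t) (r₁ t) (r₂ t) x * pMat l (U t) (r₁ t) (r₂ t) x
      - pMat l (U t) (r₁ t) (r₂ t) x * ell l (U t) (r₁ t) (r₂ t) x) = 0

/-- `D_t r₁ + r₁ u_x = 1` and `D_t r₂ + r₂ u_x = r₁` on `W`. -/
def SolvesR (W : Set (ℝ × ℝ)) (U : ℝ → Fld) (r₁ r₂ : ℝ → ℝ → ℝ) : Prop :=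
  ∀ p ∈ W,
    Dt (fun t => U t 0) r₁ p.1 p.2 + r₁ p.1 p.2 * deriv (U p.1 0) p.2 = 1 ∧
    Dt (fun t => U t 0) r₂ p.1 p.2 + r₂ p.1 p.2 * deriv (U p.1 0) p.2 = r₁ p.1 p.2

/-- `r₁ = w_x/z_x - u_x w_x²/(2 z_x²) + v_x w_x³/(6 z_x³) - w_x⁵/(30 z_x⁴)`. -/
def rho₁ (U : Fld) (x : ℝ) : ℝ :=
  let ux := deriv (U 0) x
  let vx := deriv (U 1) x
  let wx := deriv (U 2) x
  let zx := deriv (U 3) x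
  wx / zx - ux * wx ^ 2 / (2 * zx ^ 2) + vx * wx ^ 3 / (6 * zx ^ 3) - wx ^ 5 / (30 * zx ^ 4)

/-- `r₂ = w_x²/(2 z_x²) - u_x w_x³/(3 z_x³) + v_x w_x⁴/(8 z_x⁴) - 19 w_x⁶/(720 z_x⁵)`. -/
def rho₂ (U : Fld) (x : ℝ) : ℝ :=
  let ux := deriv (U 0) x
  let vx := deriv (U 1) x
  let wx := deriv (U 2) x
  let zx := deriv (U 3) x
  wx ^ 2 / (2 * zx ^ 2) - ux * wx ^ 3 / (3 * zx ^ 3) + vx * wx ^ 4 / (8 * zx ^ 4)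
    - 19 * wx ^ 6 / (720 * zx ^ 5)

end Riemann4

end

open Set MeasureTheory
open scoped ContDiff

noncomputable section

namespace Riemann4

/-! ### Partial derivatives of smooth functions of two variables -/

/-! Everything rests on two facts. Along characteristics the system reads `D_t (u, v, w, z) = (v, w,
z, 0)`, a nilpotent shift, and `D_t ∂f = ∂ D_t f - u_x ∂f`. Hence the convective derivative of any
differential polynomial in the fields can be computed algebraically, and `d/dt ∫ρ = ∫ (D_t ρ + ρ
u_x)` because `∂(uρ)` integrates to zero. In the code `D_t` is the ordinary derivative along the
straight line tangent to the characteristic, so the product and power rules come from one-variable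
calculus.

A smooth density is conserved when `D_t ρ + ρ u_x` is a total derivative (`conserved_of_flux`), and
the fluxes are explicit. Each radicand satisfies `D_t P = -d u_x P`, so formally `z^n P^(1/d)` is
transported with zero flux. The roots are not smooth at the zeros of `P`. They are therefore
replaced by smooth functions at uniform distance `δ`, whose defect in Euler's identity for
homogeneity of degree `1/d` is `O(δ)`; the regularised functional drifts by `O(δ)` and `δ → 0`
(`conserved_root`). The principal complex root of a real number is a fixed complex combination of
`|r|^(1/d)` and `sign r |r|^(1/d)`, so two regularisations suffice.

The Hamiltonian part is transparent where `z_x ≠ 0`, with `z` as the coordinate. `hat U Y i = Y_i -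
(U_i)_x / z_x * Y_3` is the variation of `U_i` at fixed `z`; it kills the reparametrisations `f
U_x`. In these variables `ϑ⁻¹` is a first-order form with constant symmetric coefficients
(`Theta_eq`, `sum_mul_Theta`), which yields skewness, closedness, the kernel and the range. Since
`K` is the shift minus `u U_x`, its hat is `(v, w, z)`. On the range of `ϑ⁻¹` the operator `η_φ`
acts on hats as multiplication by `φ(z)/z_x` together with an exchange of components, so `ϑ⁻¹ η_φ
ϑ⁻¹` is again explicit. Closedness and the Jacobi identity are proved by exhibiting the cyclic sum
as a total derivative of a compactly described flux supported in the regular set. Linearity of `η_φ`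
in `φ` turns the Jacobi identity for all `φ` into compatibility of the family.

For the Lax pair, `uℓ` commutes with `ℓ`, so the curvature is `D_t ℓ + u_x ℓ + [ℓ, q]`; its entries
are monomials in `λ` times the `x`-derivatives of the residuals of the system and the residuals of
the equations for `r₁, r₂`. Linear independence is obtained by evaluating on special fields that
turn a relation into a polynomial with infinitely many roots. -/

/-- The partial derivative in the first variable. -/
def dT (f : ℝ → ℝ → ℝ) : ℝ → ℝ → ℝ := fun t x => deriv (fun s => f s x) t

/-- The partial derivative in the second variable. -/
def dX (f : ℝ → ℝ → ℝ) : ℝ → ℝ → ℝ := fun t x => deriv (f t) x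

theorem dX_apply (f : ℝ → ℝ → ℝ) (t : ℝ) : dX f t = deriv (f t) := rfl

section Calculus

variable {W : Set (ℝ × ℝ)} {f g : ℝ → ℝ → ℝ} {t x : ℝ}

theorem SmoothOn.contDiffAt (hW : IsOpen W) (hf : SmoothOn W f) (h : (t, x) ∈ W) :
    ContDiffAt ℝ ∞ (fun p : ℝ × ℝ => f p.1 p.2) (t, x) :=
  ContDiffOn.contDiffAt hf (hW.mem_nhds h)

theorem SmoothOn.hasFDerivAt (hW : IsOpen W) (hf : SmoothOn W f) (h : (t, x) ∈ W) :
    HasFDerivAt (fun p : ℝ × ℝ => f p.1 p.2) (fderiv ℝ (fun p : ℝ × ℝ => f p.1 p.2) (t, x))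
      (t, x) :=
  ((hf.contDiffAt hW h).differentiableAt (by simp)).hasFDerivAt

theorem SmoothOn.hasDerivAt_line_aux (hW : IsOpen W) (hf : SmoothOn W f) (h : (t, x) ∈ W)
    (a b : ℝ) :
    HasDerivAt (fun s => f (t + a * (s - t)) (x + b * (s - t)))
      (fderiv ℝ (fun p : ℝ × ℝ => f p.1 p.2) (t, x) (a, b)) t := by
  have h1 : HasDerivAt (fun s : ℝ => ((t + a * (s - t), x + b * (s - t)) : ℝ × ℝ)) (a, b) t := by
    have ha : ∀ c y : ℝ, HasDerivAt (fun s : ℝ => y + c * (s - t)) c t := fun c y => by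
      simpa using (((hasDerivAt_id t).sub_const t).const_mul c).const_add y
    exact (ha a t).prodMk (ha b x)
  have h2 := hf.hasFDerivAt hW h
  have h3 : (t, x) = ((t + a * (t - t), x + b * (t - t)) : ℝ × ℝ) := by simp
  rw [h3] at h2
  have h4 := h2.comp_hasDerivAt t h1
  rw [← h3] at h4
  exact h4

theorem SmoothOn.fderiv_t (hW : IsOpen W) (hf : SmoothOn W f) (h : (t, x) ∈ W) :
    HasDerivAt (fun s => f s x) (fderiv ℝ (fun p : ℝ × ℝ => f p.1 p.2) (t, x) (1, 0)) t := by
  simpa using hf.hasDerivAt_line_aux hW h 1 0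

theorem SmoothOn.fderiv_x (hW : IsOpen W) (hf : SmoothOn W f) (h : (t, x) ∈ W) :
    HasDerivAt (f t) (fderiv ℝ (fun p : ℝ × ℝ => f p.1 p.2) (t, x) (0, 1)) x := by
  have h1 := hf.hasFDerivAt hW h
  have h2 : HasDerivAt (fun y : ℝ => ((t, y) : ℝ × ℝ)) (0, 1) x :=
    (hasDerivAt_const x t).prodMk (hasDerivAt_id x)
  exact h1.comp_hasDerivAt x h2

theorem SmoothOn.hasDerivAt_t (hW : IsOpen W) (hf : SmoothOn W f) (h : (t, x) ∈ W) :
    HasDerivAt (fun s => f s x) (dT f t x) t :=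
  (hf.fderiv_t hW h).differentiableAt.hasDerivAt

theorem SmoothOn.hasDerivAt_x (hW : IsOpen W) (hf : SmoothOn W f) (h : (t, x) ∈ W) :
    HasDerivAt (f t) (dX f t x) x :=
  (hf.fderiv_x hW h).differentiableAt.hasDerivAt

theorem SmoothOn.dT_eq (hW : IsOpen W) (hf : SmoothOn W f) (h : (t, x) ∈ W) :
    dT f t x = fderiv ℝ (fun p : ℝ × ℝ => f p.1 p.2) (t, x) (1, 0) :=
  (hf.fderiv_t hW h).deriv

theorem SmoothOn.dX_eq (hW : IsOpen W) (hf : SmoothOn W f) (h : (t, x) ∈ W) :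
    dX f t x = fderiv ℝ (fun p : ℝ × ℝ => f p.1 p.2) (t, x) (0, 1) :=
  (hf.fderiv_x hW h).deriv

/-- The derivative along the line through `(t, x)` with slope `c`. -/
theorem SmoothOn.hasDerivAt_line (hW : IsOpen W) (hf : SmoothOn W f) (h : (t, x) ∈ W) (c : ℝ) :
    HasDerivAt (fun s => f s (x + c * (s - t))) (dT f t x + c * dX f t x) t := by
  have h1 := hf.hasDerivAt_line_aux hW h 1 c
  have h2 : ((1, c) : ℝ × ℝ) = (1, 0) + c • (0, 1) := by simp
  rw [h2, map_add, map_smul, ← hf.dT_eq hW h, ← hf.dX_eq hW h] at h1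
  simpa using h1

theorem SmoothOn.fderiv_apply (hW : IsOpen W) (hf : SmoothOn W f) (v : ℝ × ℝ) :
    ContDiffOn ℝ ∞ (fun p => fderiv ℝ (fun p : ℝ × ℝ => f p.1 p.2) p v) W := by
  have h1 : ContDiffOn ℝ ∞ (fderiv ℝ (fun p : ℝ × ℝ => f p.1 p.2)) W :=
    ContDiffOn.fderiv_of_isOpen hf hW (by simp)
  exact h1.clm_apply contDiffOn_const

theorem SmoothOn.smooth_dT (hW : IsOpen W) (hf : SmoothOn W f) : SmoothOn W (dT f) :=
  (hf.fderiv_apply hW (1, 0)).congr fun _ hp => hf.dT_eq hW hp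

theorem SmoothOn.smooth_dX (hW : IsOpen W) (hf : SmoothOn W f) : SmoothOn W (dX f) :=
  (hf.fderiv_apply hW (0, 1)).congr fun _ hp => hf.dX_eq hW hp

theorem eventually_slice_t (hW : IsOpen W) (h : (t, x) ∈ W) : ∀ᶠ s in nhds t, (s, x) ∈ W :=
  (Continuous.prodMk_left x).continuousAt.eventually (hW.mem_nhds h)

theorem eventually_slice_x (hW : IsOpen W) (h : (t, x) ∈ W) : ∀ᶠ y in nhds x, (t, y) ∈ W :=
  (Continuous.prodMk_right t).continuousAt.eventually (hW.mem_nhds h)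

theorem dT_congr (hW : IsOpen W) (hfg : ∀ p ∈ W, f p.1 p.2 = g p.1 p.2) (h : (t, x) ∈ W) :
    dT f t x = dT g t x :=
  Filter.EventuallyEq.deriv_eq ((eventually_slice_t hW h).mono fun s hs => hfg (s, x) hs)

theorem dX_congr (hW : IsOpen W) (hfg : ∀ p ∈ W, f p.1 p.2 = g p.1 p.2) (h : (t, x) ∈ W) :
    dX f t x = dX g t x :=
  Filter.EventuallyEq.deriv_eq ((eventually_slice_x hW h).mono fun s hs => hfg (t, s) hs)

theorem two_le_infty : (2 : WithTop ℕ∞) ≤ ∞ := WithTop.coe_le_coe.2 (le_top : (2 : ℕ∞) ≤ ⊤)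

theorem one_add_one_le_infty : (1 + 1 : WithTop ℕ∞) ≤ ∞ :=
  WithTop.coe_le_coe.2 (le_top : (1 + 1 : ℕ∞) ≤ ⊤)

/-- Symmetry of the second Fréchet derivative on the plane, read on the two coordinate vectors. The
slice derivatives are first replaced, near the point, by values of the Fréchet derivative. -/
theorem SmoothOn.dT_dX (hW : IsOpen W) (hf : SmoothOn W f) (h : (t, x) ∈ W) :
    dT (dX f) t x = dX (dT f) t x := by
  have hs : IsSymmSndFDerivAt ℝ (fun p : ℝ × ℝ => f p.1 p.2) (t, x) :=
    (hf.contDiffAt hW h).isSymmSndFDerivAt (by simpa using two_le_infty)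
  have key : ∀ v w : ℝ × ℝ,
      fderiv ℝ (fun p => fderiv ℝ (fun p : ℝ × ℝ => f p.1 p.2) p v) (t, x) w
        = fderiv ℝ (fderiv ℝ (fun p : ℝ × ℝ => f p.1 p.2)) (t, x) w v := by
    intro v w
    have h1 : DifferentiableAt ℝ (fderiv ℝ (fun p : ℝ × ℝ => f p.1 p.2)) (t, x) :=
      ((hf.contDiffAt hW h).fderiv_right (m := 1) one_add_one_le_infty).differentiableAt (by simp)
    have h2 := h1.hasFDerivAt.clm_apply (hasFDerivAt_const v (t, x))
    rw [h2.fderiv]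
    simp
  have e1 : dT (dX f) t x
      = dT (fun t x => fderiv ℝ (fun p : ℝ × ℝ => f p.1 p.2) (t, x) (0, 1)) t x :=
    dT_congr hW (fun p hp => hf.dX_eq hW hp) h
  have e2 : dX (dT f) t x
      = dX (fun t x => fderiv ℝ (fun p : ℝ × ℝ => f p.1 p.2) (t, x) (1, 0)) t x :=
    dX_congr hW (fun p hp => hf.dT_eq hW hp) h
  have s1 : SmoothOn W (fun t x => fderiv ℝ (fun p : ℝ × ℝ => f p.1 p.2) (t, x) (0, 1)) :=
    hf.fderiv_apply hW (0, 1)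
  have s2 : SmoothOn W (fun t x => fderiv ℝ (fun p : ℝ × ℝ => f p.1 p.2) (t, x) (1, 0)) :=
    hf.fderiv_apply hW (1, 0)
  rw [e1, e2, s1.dT_eq hW h, s2.dX_eq hW h]
  have k1 := key (0, 1) (1, 0)
  have k2 := key (1, 0) (0, 1)
  have k3 := hs.eq (1, 0) (0, 1)
  exact (k1.trans k3).trans k2.symm

theorem SmoothOn.contDiff_slice {I : Set ℝ} (hf : SmoothOn (I ×ˢ univ) f) (ht : t ∈ I) :
    ContDiff ℝ ∞ (f t) := by
  rw [← contDiffOn_univ]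
  exact ContDiffOn.comp (g := fun p : ℝ × ℝ => f p.1 p.2) hf
    (f := fun y : ℝ => ((t, y) : ℝ × ℝ))
    (contDiff_const.prodMk contDiff_id).contDiffOn fun y _ => ⟨ht, mem_univ _⟩

theorem Dt_eq (u f : ℝ → ℝ → ℝ) (t x : ℝ) : Dt u f t x = dT f t x + u t x * dX f t x := rfl

theorem SmoothOn.smooth_Dt {u : ℝ → ℝ → ℝ} (hW : IsOpen W) (hu : SmoothOn W u)
    (hf : SmoothOn W f) : SmoothOn W (Dt u f) :=
  ContDiffOn.add (hf.smooth_dT hW) (ContDiffOn.mul hu (hf.smooth_dX hW))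

/-- The convective derivative as a derivative along a line. -/
theorem SmoothOn.hasDerivAt_Dt {u : ℝ → ℝ → ℝ} (hW : IsOpen W) (hf : SmoothOn W f)
    (h : (t, x) ∈ W) :
    HasDerivAt (fun s => f s (x + u t x * (s - t))) (Dt u f t x) t :=
  hf.hasDerivAt_line hW h (u t x)

/-- `D_t ∂ f = ∂ D_t f - u_x ∂ f`. -/
theorem SmoothOn.Dt_dX {u : ℝ → ℝ → ℝ} (hW : IsOpen W) (hu : SmoothOn W u)
    (hf : SmoothOn W f) (h : (t, x) ∈ W) :
    Dt u (dX f) t x = dX (Dt u f) t x - dX u t x * dX f t x := by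
  have h1 : HasDerivAt (Dt u f t)
      (dX (dT f) t x + (dX u t x * dX f t x + u t x * dX (dX f) t x)) x :=
    ((hf.smooth_dT hW).hasDerivAt_x hW h).add
      ((hu.hasDerivAt_x hW h).mul ((hf.smooth_dX hW).hasDerivAt_x hW h))
  have h2 : dX (Dt u f) t x = _ := h1.deriv
  rw [h2, Dt_eq, hf.dT_dX hW h]
  ring

end Calculus

/-! ### Integrals over a period -/

theorem integral_deriv_eq_zero {F : ℝ → ℝ} (hF : ContDiff ℝ 1 F)
    (hp : Function.Periodic F (2 * Real.pi)) : ∫ x in (0 : ℝ)..(2 * Real.pi), deriv F x = 0 := by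
  rw [intervalIntegral.integral_eq_sub_of_hasDerivAt
    (fun x _ => (hF.differentiable (by simp) x).hasDerivAt)
    ((hF.continuous_deriv (by simp)).intervalIntegrable _ _)]
  have h := hp 0
  rw [zero_add] at h
  rw [h, sub_self]

/-- The integral of a total derivative with support in an open set vanishes. -/
theorem integral_eq_zero_of_hasDerivAt {R C : Set ℝ} {F f : ℝ → ℝ} (hR : IsOpen R)
    (hC : IsClosed C) (hCR : C ⊆ R) (hF : ContDiffOn ℝ ∞ F R)
    (hd : ∀ x ∈ R, HasDerivAt F (f x) x) (hF0 : ∀ x, x ∉ C → F x = 0)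
    (hf0 : ∀ x, x ∉ C → f x = 0) (hp : Function.Periodic F (2 * Real.pi)) :
    ∫ x in (0 : ℝ)..(2 * Real.pi), f x = 0 := by
  have hz : ∀ x, x ∉ C → F =ᶠ[nhds x] fun _ => 0 := fun x hx =>
    (hC.isOpen_compl.mem_nhds hx |> fun h => Filter.eventually_of_mem h fun y hy => hF0 y hy)
  have hsm : ContDiff ℝ 1 F := by
    rw [contDiff_iff_contDiffAt]
    intro x
    by_cases hx : x ∈ C
    · exact (hF.contDiffAt (hR.mem_nhds (hCR hx))).of_le (by simp)
    · exact contDiffAt_const.congr_of_eventuallyEq (hz x hx)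
  have hfd : f = deriv F := by
    funext x
    by_cases hx : x ∈ C
    · exact (hd x (hCR hx)).deriv.symm
    · rw [hf0 x hx, (hz x hx).deriv_eq, deriv_const]
  rw [hfd]
  exact integral_deriv_eq_zero hsm hp

/-- Differentiation under the integral sign. -/
theorem SmoothOn.hasDerivAt_integral {I : Set ℝ} (hI : IsOpen I) {f : ℝ → ℝ → ℝ}
    (hf : SmoothOn (I ×ˢ univ) f) {t : ℝ} (ht : t ∈ I) (a b : ℝ) :
    HasDerivAt (fun s => ∫ x in a..b, f s x) (∫ x in a..b, dT f t x) t := by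
  have hW : IsOpen (I ×ˢ (univ : Set ℝ)) := hI.prod isOpen_univ
  obtain ⟨r, hr, hball⟩ := Metric.nhds_basis_closedBall.mem_iff.1 (hI.mem_nhds ht)
  have hcd : ContinuousOn (fun p : ℝ × ℝ => dT f p.1 p.2) (I ×ˢ univ) :=
    ContDiffOn.continuousOn (hf.smooth_dT hW)
  -- The dominating function is the constant `M`: the time derivative is continuous, hence bounded
  -- on a compact neighbourhood of `t` times the interval of integration.
  obtain ⟨M, hM⟩ := ((isCompact_closedBall t r).prod (isCompact_uIcc (a := a) (b := b))).exists_bound_of_continuousOn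
    (hcd.mono fun p hp => ⟨hball hp.1, mem_univ _⟩)
  refine (intervalIntegral.hasDerivAt_integral_of_dominated_loc_of_deriv_le
    (F := f) (F' := dT f) (bound := fun _ => M)
    (Metric.closedBall_mem_nhds t hr) ?_ ?_ ?_ ?_ ?_ ?_).2
  · filter_upwards [hI.mem_nhds ht] with s hs
    exact (hf.contDiff_slice hs).continuous.aestronglyMeasurable
  · exact (hf.contDiff_slice ht).continuous.intervalIntegrable _ _
  · exact ((hf.smooth_dT hW).contDiff_slice ht).continuous.aestronglyMeasurable
  · refine Filter.Eventually.of_forall fun x hx s hs => hM (s, x) ⟨hs, ?_⟩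
    exact uIoc_subset_uIcc hx
  · exact intervalIntegrable_const
  · refine Filter.Eventually.of_forall fun x _ s hs => ?_
    exact hf.hasDerivAt_t hW ⟨hball hs, mem_univ _⟩

/-- The evolution of an integral, in terms of the convective derivative of its density. -/
theorem hasDerivAt_integral_Dt {I : Set ℝ} (hI : IsOpen I) {u f : ℝ → ℝ → ℝ}
    (hu : SmoothOn (I ×ˢ univ) u) (hf : SmoothOn (I ×ˢ univ) f) {t : ℝ} (ht : t ∈ I)
    (hup : Function.Periodic (u t) (2 * Real.pi)) (hfp : Function.Periodic (f t) (2 * Real.pi)) :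
    HasDerivAt (fun s => ∫ x in (0 : ℝ)..(2 * Real.pi), f s x)
      (∫ x in (0 : ℝ)..(2 * Real.pi), (Dt u f t x + f t x * dX u t x)) t := by
  have hW : IsOpen (I ×ˢ (univ : Set ℝ)) := hI.prod isOpen_univ
  have hcu := hu.contDiff_slice ht
  have hcf := hf.contDiff_slice ht
  have hct := (hf.smooth_dT hW).contDiff_slice ht
  have h1 := hf.hasDerivAt_integral hI ht 0 (2 * Real.pi)
  refine h1.congr_deriv ?_
  -- Adding the total derivative `∂(u f)` is free and turns `f_t` into `D_t f + f u_x`.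
  have h0 : ∫ x in (0 : ℝ)..(2 * Real.pi), deriv (fun y => u t y * f t y) x = 0 :=
    integral_deriv_eq_zero ((hcu.mul hcf).of_le (by simp)) (hup.mul hfp)
  have h2 : ∀ x, Dt u f t x + f t x * dX u t x
      = dT f t x + deriv (fun y => u t y * f t y) x := by
    intro x
    have hp : (t, x) ∈ I ×ˢ (univ : Set ℝ) := ⟨ht, mem_univ _⟩
    rw [((hu.hasDerivAt_x hW hp).fun_mul (hf.hasDerivAt_x hW hp)).deriv, Dt_eq]
    ring
  simp_rw [h2]
  rw [intervalIntegral.integral_add, h0, add_zero]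
  · exact hct.continuous.intervalIntegrable _ _
  · exact ((hcu.mul hcf).continuous_deriv (by simp)).intervalIntegrable _ _

theorem periodic_deriv {f : ℝ → ℝ} {c : ℝ} (hf : Function.Periodic f c) :
    Function.Periodic (deriv f) c := by
  intro x
  have h : (fun y => f (y + c)) = f := funext hf
  rw [← deriv_comp_add_const f c x, h]

theorem periodic_iteratedDeriv {f : ℝ → ℝ} {c : ℝ} (hf : Function.Periodic f c) (k : ℕ) :
    Function.Periodic (iteratedDeriv k f) c := by
  induction k with
  | zero => simpa using hf
  | succ k ih => rw [iteratedDeriv_succ]; exact periodic_deriv ih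

/-! ### Jets of solutions -/

/-- The iterated convective derivatives of the components of a solution: `(v, w, z, 0)`. -/
def shift (V : Fld) : Fld := ![V 1, V 2, V 3, 0]

theorem smoothOn_iteratedDeriv {W : Set (ℝ × ℝ)} (hW : IsOpen W) {f : ℝ → ℝ → ℝ}
    (hf : SmoothOn W f) (k : ℕ) : SmoothOn W (fun t => iteratedDeriv k (f t)) := by
  induction k with
  | zero => simpa using hf
  | succ k ih => simp_rw [iteratedDeriv_succ]; exact ih.smooth_dX hW

theorem iteratedDeriv_two' (f : ℝ → ℝ) : iteratedDeriv 2 f = deriv (deriv f) := by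
  rw [iteratedDeriv_succ, iteratedDeriv_one]

section Jets

variable {W : Set (ℝ × ℝ)} {U : ℝ → Fld} {t x : ℝ}

theorem smoothOn_zero : SmoothOn W (fun _ _ => 0) := contDiffOn_const

theorem smoothOn_shift (hU : ∀ i, SmoothOn W fun t => U t i) (i : Fin 4) :
    SmoothOn W (fun t => shift (U t) i) := by
  fin_cases i
  · exact hU 1
  · exact hU 2
  · exact hU 3
  · exact smoothOn_zero

/-- `K U i` is the shifted component minus `u ∂U_i`, so moving the transport term to the left leaves
the nilpotent shift `u → v → w → z → 0`. -/
theorem Dt_component (hs : SolvesOn W U) (i : Fin 4) (p : ℝ × ℝ) (hp : p ∈ W) :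
    Dt (fun s => U s 0) (fun s => U s i) p.1 p.2 = shift (U p.1) i p.2 := by
  have h := hs p hp i
  simp only [Dt]
  rw [h]
  fin_cases i <;> simp [K, shift]

/-- One application of the commutator `SmoothOn.Dt_dX`. The versions for two and three derivatives
iterate it; third order suffices because the radicands contain no higher derivatives. -/
theorem Dt_deriv (hW : IsOpen W) (hU : ∀ i, SmoothOn W fun t => U t i) (hs : SolvesOn W U)
    (i : Fin 4) (p : ℝ × ℝ) (hp : p ∈ W) :
    Dt (fun s => U s 0) (fun s => deriv (U s i)) p.1 p.2
      = deriv (shift (U p.1) i) p.2 - deriv (U p.1 0) p.2 * deriv (U p.1 i) p.2 := by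
  have h := (hU 0).Dt_dX hW (hU i) hp
  rw [dX_congr (g := fun s => shift (U s) i) hW (Dt_component hs i) hp] at h
  exact h

theorem Dt_deriv_two (hW : IsOpen W) (hU : ∀ i, SmoothOn W fun t => U t i) (hs : SolvesOn W U)
    (i : Fin 4) (p : ℝ × ℝ) (hp : p ∈ W) :
    Dt (fun s => U s 0) (fun s => iteratedDeriv 2 (U s i)) p.1 p.2
      = iteratedDeriv 2 (shift (U p.1) i) p.2 - iteratedDeriv 2 (U p.1 0) p.2 * deriv (U p.1 i) p.2
        - 2 * deriv (U p.1 0) p.2 * iteratedDeriv 2 (U p.1 i) p.2 := by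
  have h := (hU 0).Dt_dX hW ((hU i).smooth_dX hW) hp
  rw [dX_congr (f := Dt (fun s => U s 0) (dX fun t => U t i))
    (g := fun s y => deriv (shift (U s) i) y - deriv (U s 0) y * deriv (U s i) y)
    hW (Dt_deriv hW hU hs i) hp] at h
  have h1 := ((((smoothOn_shift hU i).smooth_dX hW).hasDerivAt_x hW hp).fun_sub
    ((((hU 0).smooth_dX hW).hasDerivAt_x hW hp).fun_mul
      (((hU i).smooth_dX hW).hasDerivAt_x hW hp))).deriv
  simp only [iteratedDeriv_two']
  change Dt _ (dX (dX fun t => U t i)) _ _ = _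
  rw [h]
  rw [show dX (fun s y => deriv (shift (U s) i) y - deriv (U s 0) y * deriv (U s i) y) p.1 p.2
    = _ from h1]
  simp only [dX_apply]
  ring

theorem Dt_deriv_three (hW : IsOpen W) (hU : ∀ i, SmoothOn W fun t => U t i)
    (hs : SolvesOn W U) (i : Fin 4) (p : ℝ × ℝ) (hp : p ∈ W) :
    Dt (fun s => U s 0) (fun s => iteratedDeriv 3 (U s i)) p.1 p.2
      = iteratedDeriv 3 (shift (U p.1) i) p.2 - iteratedDeriv 3 (U p.1 0) p.2 * deriv (U p.1 i) p.2
        - 3 * iteratedDeriv 2 (U p.1 0) p.2 * iteratedDeriv 2 (U p.1 i) p.2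
        - 3 * deriv (U p.1 0) p.2 * iteratedDeriv 3 (U p.1 i) p.2 := by
  have h := (hU 0).Dt_dX hW (smoothOn_iteratedDeriv hW (hU i) 2) hp
  rw [dX_congr (g := fun s y => iteratedDeriv 2 (shift (U s) i) y
      - iteratedDeriv 2 (U s 0) y * deriv (U s i) y
      - 2 * deriv (U s 0) y * iteratedDeriv 2 (U s i) y) hW (Dt_deriv_two hW hU hs i) hp] at h
  have h1 := (((((smoothOn_iteratedDeriv hW (smoothOn_shift hU i) 2)).hasDerivAt_x hW hp).fun_sub
    (((smoothOn_iteratedDeriv hW (hU 0) 2).hasDerivAt_x hW hp).fun_mul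
      (((hU i).smooth_dX hW).hasDerivAt_x hW hp))).fun_sub
    (((((hU 0).smooth_dX hW).hasDerivAt_x hW hp).const_mul 2).fun_mul
      ((smoothOn_iteratedDeriv hW (hU i) 2).hasDerivAt_x hW hp))).deriv
  have e : ∀ f : ℝ → ℝ, iteratedDeriv 3 f = deriv (iteratedDeriv 2 f) := fun f =>
    iteratedDeriv_succ
  simp only [e]
  change Dt _ (dX (fun s => iteratedDeriv 2 (U s i))) _ _ = _
  rw [h]
  rw [show dX (fun s y => iteratedDeriv 2 (shift (U s) i) y
      - iteratedDeriv 2 (U s 0) y * deriv (U s i) y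
      - 2 * deriv (U s 0) y * iteratedDeriv 2 (U s i) y) p.1 p.2 = _ from h1]
  simp only [dX_apply, iteratedDeriv_two']
  ring

/-- Stating the jet equations as `HasDerivAt` along the line of slope `u(t, x)` makes `D_t` of
composite densities available through the usual differentiation rules; `Dt_eq_of_hasDerivAt_line`
translates back. -/
theorem hasDerivAt_line_component (hW : IsOpen W) (hU : ∀ i, SmoothOn W fun t => U t i)
    (hs : SolvesOn W U) (h : (t, x) ∈ W) (i : Fin 4) :
    HasDerivAt (fun s => U s i (x + U t 0 x * (s - t))) (shift (U t) i x) t :=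
  ((hU i).hasDerivAt_Dt (u := fun s => U s 0) hW h).congr_deriv (Dt_component hs i _ h)

theorem hasDerivAt_line_deriv (hW : IsOpen W) (hU : ∀ i, SmoothOn W fun t => U t i)
    (hs : SolvesOn W U) (h : (t, x) ∈ W) (i : Fin 4) :
    HasDerivAt (fun s => deriv (U s i) (x + U t 0 x * (s - t)))
      (deriv (shift (U t) i) x - deriv (U t 0) x * deriv (U t i) x) t :=
  (((hU i).smooth_dX hW).hasDerivAt_Dt (u := fun s => U s 0) hW h).congr_deriv
    (Dt_deriv hW hU hs i _ h)

theorem hasDerivAt_line_deriv_two (hW : IsOpen W) (hU : ∀ i, SmoothOn W fun t => U t i)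
    (hs : SolvesOn W U) (h : (t, x) ∈ W) (i : Fin 4) :
    HasDerivAt (fun s => iteratedDeriv 2 (U s i) (x + U t 0 x * (s - t)))
      (iteratedDeriv 2 (shift (U t) i) x - iteratedDeriv 2 (U t 0) x * deriv (U t i) x
        - 2 * deriv (U t 0) x * iteratedDeriv 2 (U t i) x) t :=
  Dt_deriv_two hW hU hs i _ h ▸
    (smoothOn_iteratedDeriv hW (hU i) 2).hasDerivAt_Dt (u := fun s => U s 0) hW h

theorem hasDerivAt_line_deriv_three (hW : IsOpen W) (hU : ∀ i, SmoothOn W fun t => U t i)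
    (hs : SolvesOn W U) (h : (t, x) ∈ W) (i : Fin 4) :
    HasDerivAt (fun s => iteratedDeriv 3 (U s i) (x + U t 0 x * (s - t)))
      (iteratedDeriv 3 (shift (U t) i) x - iteratedDeriv 3 (U t 0) x * deriv (U t i) x
        - 3 * iteratedDeriv 2 (U t 0) x * iteratedDeriv 2 (U t i) x
        - 3 * deriv (U t 0) x * iteratedDeriv 3 (U t i) x) t :=
  Dt_deriv_three hW hU hs i _ h ▸
    (smoothOn_iteratedDeriv hW (hU i) 3).hasDerivAt_Dt (u := fun s => U s 0) hW h

/-- The convective derivative from the derivative along the characteristic direction. -/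
theorem Dt_eq_of_hasDerivAt_line (hW : IsOpen W) {f u : ℝ → ℝ → ℝ} (hf : SmoothOn W f)
    (h : (t, x) ∈ W) {c : ℝ} (hc : HasDerivAt (fun s => f s (x + u t x * (s - t))) c t) :
    Dt u f t x = c :=
  (hf.hasDerivAt_Dt hW h).unique hc

end Jets

/-! ### Equivalence of the system with `D_t⁴ u = 0` -/

theorem smoothOn_iterate_Dt {W : Set (ℝ × ℝ)} (hW : IsOpen W) {u : ℝ → ℝ → ℝ}
    (hu : SmoothOn W u) (k : ℕ) : SmoothOn W ((Dt u)^[k] u) := by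
  induction k with
  | zero => exact hu
  | succ k ih => rw [Function.iterate_succ_apply']; exact hu.smooth_Dt hW ih

theorem periodic_iterate_Dt {I : Set ℝ} (hI : IsOpen I) {u : ℝ → ℝ → ℝ}
    (hu : ∀ t ∈ I, Function.Periodic (u t) (2 * Real.pi)) (k : ℕ) :
    ∀ t ∈ I, Function.Periodic ((Dt u)^[k] u t) (2 * Real.pi) := by
  induction k with
  | zero => exact hu
  | succ k ih =>
    intro t ht x
    rw [Function.iterate_succ_apply', Dt_eq, Dt_eq, hu t ht x]
    have h1 : dX ((Dt u)^[k] u) t (x + 2 * Real.pi) = dX ((Dt u)^[k] u) t x :=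
      periodic_deriv (ih t ht) x
    have h2 : dT ((Dt u)^[k] u) t (x + 2 * Real.pi) = dT ((Dt u)^[k] u) t x :=
      Filter.EventuallyEq.deriv_eq ((hI.mem_nhds ht |> fun h =>
        Filter.eventually_of_mem h fun s hs => ih s hs x))
    rw [h1, h2]

theorem isSol_tower {I : Set ℝ} {u : ℝ → ℝ → ℝ} (hI : IsOpen I)
    (hu : SmoothOn (I ×ˢ univ) u) (hp : ∀ t ∈ I, Function.Periodic (u t) (2 * Real.pi))
    (h4 : ∀ t ∈ I, ∀ x, (Dt u)^[4] u t x = 0) : IsSol I (tower u) := by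
  refine ⟨fun i => smoothOn_iterate_Dt (hI.prod isOpen_univ) hu i,
    fun t ht i => periodic_iterate_Dt hI hp i t ht, ?_⟩
  rintro ⟨t, x⟩ ⟨ht, -⟩ i
  -- This is the definition of `Dt`, solved for the time derivative. It is the `k`-th equation of
  -- the system for `k < 3`; for `k = 3` the hypothesis `D_t⁴ u = 0` removes the first term.
  have key : ∀ k : ℕ, deriv (fun s => (Dt u)^[k] u s x) t
      = (Dt u)^[k + 1] u t x - u t x * deriv ((Dt u)^[k] u t) x := by
    intro k
    rw [Function.iterate_succ_apply']
    simp only [Dt]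
    ring
  have h := key i
  change deriv (fun s => (Dt u)^[(i : ℕ)] u s x) t = K (tower u t) i x
  rw [h]
  fin_cases i
  · simp [K, tower]
  · simp [K, tower]
  · simp [K, tower]
  · have := h4 t ht x
    simp [K, tower] at this ⊢
    exact this

theorem Dt_congr {W : Set (ℝ × ℝ)} (hW : IsOpen W) {u f g : ℝ → ℝ → ℝ} {t x : ℝ}
    (hfg : ∀ p ∈ W, f p.1 p.2 = g p.1 p.2) (h : (t, x) ∈ W) : Dt u f t x = Dt u g t x := by
  rw [Dt_eq, Dt_eq, dT_congr hW hfg h, dX_congr hW hfg h]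

theorem IsSol.eq_tower {I : Set ℝ} {U : ℝ → Fld} (hI : IsOpen I) (hU : IsSol I U) {t : ℝ}
    (ht : t ∈ I) (x : ℝ) :
    (∀ i, U t i x = tower (fun s => U s 0) t i x) ∧
      (Dt (fun s => U s 0))^[4] (fun s => U s 0) t x = 0 := by
  have hW : IsOpen (I ×ˢ (univ : Set ℝ)) := hI.prod isOpen_univ
  set D := Dt (fun s => U s 0) with hD
  have hmem : ∀ t x, t ∈ I → ((t, x) : ℝ × ℝ) ∈ I ×ˢ (univ : Set ℝ) := fun t x h => ⟨h, mem_univ _⟩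
  -- `Dt` depends only on germs, so an identity for the `k`-th iterate on the open set `I × ℝ` may
  -- be substituted before differentiating once more.
  have step : ∀ (k : ℕ) (f : ℝ → ℝ → ℝ) (g : ℝ → ℝ → ℝ),
      (∀ p ∈ I ×ˢ (univ : Set ℝ), D^[k] (fun s => U s 0) p.1 p.2 = f p.1 p.2) →
      (∀ p ∈ I ×ˢ (univ : Set ℝ), D f p.1 p.2 = g p.1 p.2) →
      (∀ p ∈ I ×ˢ (univ : Set ℝ), D^[k + 1] (fun s => U s 0) p.1 p.2 = g p.1 p.2) := by
    intro k f g h1 h2 p hp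
    rw [Function.iterate_succ_apply', ← h2 p hp]
    exact Dt_congr hW h1 hp
  have h0 : ∀ p ∈ I ×ˢ (univ : Set ℝ), D^[0] (fun s => U s 0) p.1 p.2 = U p.1 0 p.2 :=
    fun p _ => rfl
  have h1 := step 0 _ (fun s => U s 1) h0 fun p hp => Dt_component hU.eqn 0 p hp
  have h2 := step 1 _ (fun s => U s 2) h1 fun p hp => Dt_component hU.eqn 1 p hp
  have h3 := step 2 _ (fun s => U s 3) h2 fun p hp => Dt_component hU.eqn 2 p hp
  have h4 := step 3 _ (fun _ => 0) h3 fun p hp => Dt_component hU.eqn 3 p hp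
  refine ⟨fun i => ?_, h4 (t, x) (hmem t x ht)⟩
  fin_cases i
  · rfl
  · exact (h1 (t, x) (hmem t x ht)).symm
  · exact (h2 (t, x) (hmem t x ht)).symm
  · exact (h3 (t, x) (hmem t x ht)).symm

/-! ### Conservation laws with smooth densities -/

/-- Mean value inequality with Lipschitz constant `0`; order-connectedness makes the time set
convex. -/
theorem conserved_of_hasDerivAt_zero {E : Type*} [NormedAddCommGroup E] [NormedSpace ℝ E]
    {F : Fld → E}
    (h : ∀ (I : Set ℝ) (U : ℝ → Fld), IsOpen I → IsSol I U → ∀ t ∈ I,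
      HasDerivAt (fun s => F (U s)) 0 t) : Conserved F := by
  intro I U hI hoc hU s hs t ht
  have h1 := hoc.convex.norm_image_sub_le_of_norm_hasDerivWithin_le (𝕜 := ℝ)
    (f := fun s => F (U s)) (f' := fun _ => 0) (C := 0)
    (fun x hx => (h I U hI hU x hx).hasDerivWithinAt) (by simp) hs ht
  rw [zero_mul, norm_le_zero_iff, sub_eq_zero] at h1
  exact h1.symm

/-- A density `ρ` with `D_t ρ + ρ u_x = ∂ Ψ` is conserved. -/
theorem conserved_of_flux {ρ Ψ : Fld → ℝ → ℝ}
    (hρ : ∀ (I : Set ℝ) (U : ℝ → Fld), IsOpen I → IsSol I U →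
      SmoothOn (I ×ˢ univ) fun t => ρ (U t))
    (hΨ : ∀ V : Fld, IsM V → ContDiff ℝ ∞ (Ψ V))
    (hρp : ∀ V, (∀ i, Function.Periodic (V i) (2 * Real.pi)) →
      Function.Periodic (ρ V) (2 * Real.pi))
    (hΨp : ∀ V, (∀ i, Function.Periodic (V i) (2 * Real.pi)) →
      Function.Periodic (Ψ V) (2 * Real.pi))
    (h : ∀ (I : Set ℝ) (U : ℝ → Fld), IsOpen I → IsSol I U → ∀ t ∈ I, ∀ x,
      HasDerivAt (fun s => ρ (U s) (x + U t 0 x * (s - t)))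
        (deriv (Ψ (U t)) x - ρ (U t) x * deriv (U t 0) x) t) :
    Conserved (functional ρ) := by
  refine conserved_of_hasDerivAt_zero fun I U hI hU t ht => ?_
  have hW : IsOpen (I ×ˢ (univ : Set ℝ)) := hI.prod isOpen_univ
  have h1 := hasDerivAt_integral_Dt hI (hU.smooth 0) (hρ I U hI hU) ht (hU.periodic t ht 0)
    (hρp _ (hU.periodic t ht))
  refine h1.congr_deriv ?_
  refine Eq.trans ?_ (integral_deriv_eq_zero
    ((hΨ (U t) ⟨fun i => (hU.smooth i).contDiff_slice ht, hU.periodic t ht⟩).of_le (by simp))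
    (hΨp _ (hU.periodic t ht)))
  congr 1
  funext x
  have h2 := Dt_eq_of_hasDerivAt_line (u := fun s => U s 0) hW (hρ I U hI hU)
    (show (t, x) ∈ I ×ˢ (univ : Set ℝ) from ⟨ht, mem_univ _⟩) (h I U hI hU t ht x)
  rw [h2]
  simp only [dX_apply]
  ring

theorem IsM.hasDerivAt {V : Fld} (hV : IsM V) (i : Fin 4) (x : ℝ) :
    HasDerivAt (V i) (deriv (V i) x) x :=
  ((hV.smooth i).differentiable (by simp) x).hasDerivAt

theorem IsM.contDiff_deriv {V : Fld} (hV : IsM V) (i : Fin 4) : ContDiff ℝ ∞ (deriv (V i)) :=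
  ((contDiff_infty_iff_deriv).1 (hV.smooth i)).2

theorem IsM.hasDerivAt_deriv {V : Fld} (hV : IsM V) (i : Fin 4) (x : ℝ) :
    HasDerivAt (deriv (V i)) (deriv (deriv (V i)) x) x :=
  ((hV.contDiff_deriv i).differentiable (by simp) x).hasDerivAt

theorem IsSol.isM {I : Set ℝ} {U : ℝ → Fld} (hU : IsSol I U) {t : ℝ} (ht : t ∈ I) : IsM (U t) :=
  ⟨fun i => (hU.smooth i).contDiff_slice ht, hU.periodic t ht⟩

theorem shift_zero (V : Fld) : shift V 0 = V 1 := rfl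
theorem shift_one (V : Fld) : shift V 1 = V 2 := rfl
theorem shift_two (V : Fld) : shift V 2 = V 3 := rfl
theorem shift_three (V : Fld) : shift V 3 = fun _ => 0 := rfl

theorem iteratedDeriv_zero_fun (k : ℕ) (x : ℝ) : iteratedDeriv k (fun _ : ℝ => (0 : ℝ)) x = 0 := by
  simp

/-- The fluxes of the polynomial conservation laws. -/
def polyFlux (k : Fin 5 → ℝ) (j : Fin 6) (U : Fld) (x : ℝ) : ℝ :=
  let u := U 0 x
  let v := U 1 x
  let w := U 2 x
  let z := U 3 x
  ![w ^ 2 / 2, 3 * z ^ 2 * v + 2 * w ^ 2 * z,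
    3 * u * v * z ^ 2 + 12 * u * z * w ^ 2 - 6 * z * v ^ 2 * w,
    k 0 * (u * z ^ 2) - k 1 * (2 / 3 * w ^ 3), 0, 0] j

/-- Leaves both derivatives as metavariables, to be filled in while the differentiation rules are
applied; the conservation law then remains as the single algebraic identity `d = c - r`. -/
theorem exists_hasDerivAt_and {f g : ℝ → ℝ} {c d r x t : ℝ} (hf : HasDerivAt f d t)
    (hg : HasDerivAt g c x) (h : d = c - r) :
    ∃ c, HasDerivAt g c x ∧ HasDerivAt f (c - r) t :=
  ⟨c, hg, h ▸ hf⟩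

theorem conserved_polyDensity (k : Fin 5 → ℝ) (j : Fin 6) :
    Conserved (functional (polyDensity k j)) := by
  refine conserved_of_flux (Ψ := polyFlux k j) ?_ ?_ ?_ ?_ ?_
  · intro I U hI hU
    have hW : IsOpen (I ×ˢ (univ : Set ℝ)) := hI.prod isOpen_univ
    have h0 : ∀ i, ContDiffOn ℝ ∞ (fun p : ℝ × ℝ => U p.1 i p.2) (I ×ˢ univ) := hU.smooth
    have h1 : ∀ i, ContDiffOn ℝ ∞ (fun p : ℝ × ℝ => deriv (U p.1 i) p.2) (I ×ˢ univ) :=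
      fun i => (hU.smooth i).smooth_dX hW
    unfold SmoothOn
    fin_cases j <;> simp only [polyDensity, Fin.zero_eta, Fin.mk_one, Fin.reduceFinMk,
      Matrix.cons_val] <;>
    repeat' first
      | with_reducible exact h0 _
      | with_reducible exact h1 _
      | exact contDiffOn_const
      | apply ContDiffOn.sub
      | apply ContDiffOn.add
      | apply ContDiffOn.mul
  · intro V hV
    have h0 := hV.smooth
    change ContDiff ℝ ∞ fun x => polyFlux k j V x
    fin_cases j <;> simp only [polyFlux, Fin.zero_eta, Fin.mk_one, Fin.reduceFinMk,
      Matrix.cons_val] <;> fun_prop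
  · intro V hV x
    have h0 := fun i => hV i x
    have h1 := fun i => periodic_deriv (hV i) x
    simp only [polyDensity, h0, h1]
  · intro V hV x
    have h0 := fun i => hV i x
    simp only [polyFlux, h0]
  · intro I U hI hU t ht x
    have hW : IsOpen (I ×ˢ (univ : Set ℝ)) := hI.prod isOpen_univ
    have hp : (t, x) ∈ I ×ˢ (univ : Set ℝ) := ⟨ht, mem_univ _⟩
    have h0 := hasDerivAt_line_component hW hU.smooth hU.eqn hp
    have h1 := hasDerivAt_line_deriv hW hU.smooth hU.eqn hp
    have hx := (hU.isM ht).hasDerivAt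
    have d : ∃ c, HasDerivAt (fun y => polyFlux k j (U t) y) c x ∧
      HasDerivAt (fun s => polyDensity k j (U s) (x + U t 0 x * (s - t)))
        (c - polyDensity k j (U t) x * deriv (U t 0) x) t := by
      fin_cases j <;> simp only [polyFlux, polyDensity, Fin.zero_eta, Fin.mk_one, Fin.reduceFinMk,
        Matrix.cons_val] <;>
      (apply exists_hasDerivAt_and
       · repeat' first
            | with_reducible exact h0 _
            | with_reducible exact h1 _
            | with_reducible exact hasDerivAt_const _ _
            | with_reducible apply HasDerivAt.fun_pow
            | with_reducible apply HasDerivAt.fun_sub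
            | with_reducible apply HasDerivAt.fun_add
            | with_reducible apply HasDerivAt.fun_mul
       · repeat' first
            | with_reducible exact hx _ _
            | with_reducible exact hasDerivAt_const _ _
            | with_reducible apply HasDerivAt.fun_pow
            | with_reducible apply HasDerivAt.fun_sub
            | with_reducible apply HasDerivAt.fun_add
            | with_reducible apply HasDerivAt.div_const
            | with_reducible apply HasDerivAt.fun_mul
       · simp only [shift_zero, shift_one, shift_two, shift_three, sub_self, mul_zero, add_zero, deriv_const]
         push_cast
         ring)
    obtain ⟨c, hc, hd⟩ := d
    rwa [show deriv (polyFlux k j (U t)) x = c from hc.deriv]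

/-- `z` is constant along characteristics, `D_t z_x = -u_x z_x`, and `D_t (u w - v²/2) = u z`. Hence
`D_t ρ + ρ u_x = u z^(n+1) z_x + u_x z^(n+2)/(n+2)`, an exact derivative. -/
theorem conserved_HA (n : ℕ) : Conserved (HA n) := by
  have hn : (n : ℝ) + 2 ≠ 0 := by positivity
  refine conserved_of_flux (Ψ := fun U x => U 0 x * U 3 x ^ (n + 2) / ((n : ℝ) + 2)) ?_ ?_ ?_ ?_ ?_
  · intro I U hI hU
    have hW : IsOpen (I ×ˢ (univ : Set ℝ)) := hI.prod isOpen_univ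
    have h0 : ∀ i, ContDiffOn ℝ ∞ (fun p : ℝ × ℝ => U p.1 i p.2) (I ×ˢ univ) := hU.smooth
    have h1 : ∀ i, ContDiffOn ℝ ∞ (fun p : ℝ × ℝ => deriv (U p.1 i) p.2) (I ×ˢ univ) :=
      fun i => (hU.smooth i).smooth_dX hW
    exact ((((h0 3).pow n).mul (h1 3)).mul (((h0 0).mul (h0 2)).sub (((h0 1).pow 2).div_const 2))).add
      (((h0 3).pow (n + 2)).div_const _)
  · intro V hV
    have h0 := hV.smooth
    fun_prop
  · intro V hV x
    have h0 := fun i => hV i x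
    have h1 := fun i => periodic_deriv (hV i) x
    simp only [h0, h1]
  · intro V hV x
    have h0 := fun i => hV i x
    simp only [h0]
  · intro I U hI hU t ht x
    have hW : IsOpen (I ×ˢ (univ : Set ℝ)) := hI.prod isOpen_univ
    have hp : (t, x) ∈ I ×ˢ (univ : Set ℝ) := ⟨ht, mem_univ _⟩
    have h0 := hasDerivAt_line_component hW hU.smooth hU.eqn hp
    have h1 := hasDerivAt_line_deriv hW hU.smooth hU.eqn hp
    have hx := (hU.isM ht).hasDerivAt
    rw [(((hx 0 x).fun_mul ((hx 3 x).fun_pow (n + 2))).div_const ((n : ℝ) + 2)).deriv]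
    refine (((((h0 3).fun_pow n).fun_mul (h1 3)).fun_mul
      (((h0 0).fun_mul (h0 2)).fun_sub (((h0 1).fun_pow 2).div_const 2))).fun_add
      (((h0 3).fun_pow (n + 2)).div_const ((n : ℝ) + 2))).congr_deriv ?_
    simp only [shift_zero, shift_one, shift_two, shift_three, sub_self, mul_zero, add_zero,
      deriv_const, Nat.add_succ_sub_one]
    push_cast
    field_simp
    ring

/-- Both `z` and `w² - 2 v z` are constant along characteristics, while `z_x` has weight one; the
flux is zero. -/
theorem conserved_HB (n : ℕ) : Conserved (HB n) := by
  refine conserved_of_flux (Ψ := fun _ _ => 0) ?_ ?_ ?_ ?_ ?_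
  · intro I U hI hU
    have hW : IsOpen (I ×ˢ (univ : Set ℝ)) := hI.prod isOpen_univ
    have h0 : ∀ i, ContDiffOn ℝ ∞ (fun p : ℝ × ℝ => U p.1 i p.2) (I ×ˢ univ) := hU.smooth
    have h1 : ∀ i, ContDiffOn ℝ ∞ (fun p : ℝ × ℝ => deriv (U p.1 i) p.2) (I ×ˢ univ) :=
      fun i => (hU.smooth i).smooth_dX hW
    exact (((h0 3).pow n).mul (h1 3)).mul
      (((h0 2).pow 2).sub ((contDiffOn_const.mul (h0 1)).mul (h0 3)))
  · exact fun _ _ => contDiff_const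
  · intro V hV x
    have h0 := fun i => hV i x
    have h1 := fun i => periodic_deriv (hV i) x
    simp only [h0, h1]
  · exact fun _ _ _ => rfl
  · intro I U hI hU t ht x
    have hW : IsOpen (I ×ˢ (univ : Set ℝ)) := hI.prod isOpen_univ
    have hp : (t, x) ∈ I ×ˢ (univ : Set ℝ) := ⟨ht, mem_univ _⟩
    have h0 := hasDerivAt_line_component hW hU.smooth hU.eqn hp
    have h1 := hasDerivAt_line_deriv hW hU.smooth hU.eqn hp
    refine ((((h0 3).fun_pow n).fun_mul (h1 3)).fun_mul
      (((h0 2).fun_pow 2).fun_sub (((h0 1).const_mul 2).fun_mul (h0 3)))).congr_deriv ?_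
    simp only [shift_one, shift_two, shift_three, sub_self, mul_zero, add_zero,
      deriv_const]
    push_cast
    ring

/-! ### Conservation laws with non-polynomial densities -/

-- Each radicand has weight `d_j`: it satisfies `D_t P = -d_j u_x P`. After differentiation of its
-- monomials by the jet equations this is a polynomial identity in the jet.
set_option maxHeartbeats 1000000 in
theorem hasDerivAt_line_radicand {W : Set (ℝ × ℝ)} {U : ℝ → Fld} {t x : ℝ} (hW : IsOpen W)
    (hU : ∀ i, SmoothOn W fun t => U t i) (hs : SolvesOn W U) (h : (t, x) ∈ W)
    (k : Fin 5 → ℝ) (j : Fin 10) :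
    HasDerivAt (fun s => radicand k j (U s) (x + U t 0 x * (s - t)))
      (-((rootOrder j : ℝ) * deriv (U t 0) x) * radicand k j (U t) x) t := by
  have h0 := hasDerivAt_line_component hW hU hs h
  have h1 := hasDerivAt_line_deriv hW hU hs h
  have h2 := hasDerivAt_line_deriv_two hW hU hs h
  have h3 := hasDerivAt_line_deriv_three hW hU hs h
  fin_cases j <;> simp only [radicand, rootOrder, Fin.zero_eta, Fin.mk_one, Fin.reduceFinMk,
    Matrix.cons_val] <;>
  (apply HasDerivAt.congr_deriv
   · repeat' first
      | with_reducible exact h0 _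
      | with_reducible exact h1 _
      | with_reducible exact h2 _
      | with_reducible exact h3 _
      | with_reducible exact hasDerivAt_const _ _
      | with_reducible apply HasDerivAt.fun_pow
      | with_reducible apply HasDerivAt.fun_sub
      | with_reducible apply HasDerivAt.fun_add
      | with_reducible apply HasDerivAt.fun_mul
   · simp only [shift_zero, shift_one, shift_two, shift_three, sub_self, mul_zero, zero_mul,
       add_zero, deriv_const, iteratedDeriv_zero_fun]
     push_cast
     ring)

set_option maxHeartbeats 1000000 in
theorem smoothOn_radicand {W : Set (ℝ × ℝ)} {U : ℝ → Fld} (hW : IsOpen W)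
    (hU : ∀ i, SmoothOn W fun t => U t i) (k : Fin 5 → ℝ) (j : Fin 10) :
    SmoothOn W fun t => radicand k j (U t) := by
  have h0 : ∀ i, ContDiffOn ℝ ∞ (fun p : ℝ × ℝ => U p.1 i p.2) W := hU
  have h1 : ∀ i, ContDiffOn ℝ ∞ (fun p : ℝ × ℝ => deriv (U p.1 i) p.2) W :=
    fun i => (hU i).smooth_dX hW
  have h2 : ∀ i, ContDiffOn ℝ ∞ (fun p : ℝ × ℝ => iteratedDeriv 2 (U p.1 i) p.2) W :=
    fun i => smoothOn_iteratedDeriv hW (hU i) 2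
  have h3 : ∀ i, ContDiffOn ℝ ∞ (fun p : ℝ × ℝ => iteratedDeriv 3 (U p.1 i) p.2) W :=
    fun i => smoothOn_iteratedDeriv hW (hU i) 3
  unfold SmoothOn
  fin_cases j <;> simp only [radicand, Fin.zero_eta, Fin.mk_one, Fin.reduceFinMk,
    Matrix.cons_val] <;>
  repeat' first
    | with_reducible exact h0 _
    | with_reducible exact h1 _
    | with_reducible exact h2 _
    | with_reducible exact h3 _
    | exact contDiffOn_const
    | apply ContDiffOn.sub
    | apply ContDiffOn.add
    | apply ContDiffOn.mul

theorem periodic_radicand {V : Fld} (hV : ∀ i, Function.Periodic (V i) (2 * Real.pi))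
    (k : Fin 5 → ℝ) (j : Fin 10) : Function.Periodic (radicand k j V) (2 * Real.pi) := by
  intro x
  have h0 := fun i => hV i x
  have h1 := fun i => periodic_deriv (hV i) x
  have h2 := fun i => periodic_iteratedDeriv (hV i) 2 x
  have h3 := fun i => periodic_iteratedDeriv (hV i) 3 x
  simp only [radicand, h0, h1, h2, h3]

/-- Weights add under multiplication, as with logarithmic derivatives, but without dividing by
factors that may vanish. -/
theorem hasDerivAt_prod_pow {ι : Type*} {f : ι → ℝ → ℝ} {d m : ι → ℕ} {a t : ℝ}
    (h : ∀ j, HasDerivAt (f j) (-((d j : ℝ) * a) * f j t) t) (S : Finset ι) :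
    HasDerivAt (fun s => ∏ j ∈ S, f j s ^ m j)
      (-(((∑ j ∈ S, m j * d j : ℕ) : ℝ) * a) * ∏ j ∈ S, f j t ^ m j) t := by
  classical
  induction S using Finset.induction_on with
  | empty => simpa using hasDerivAt_const t (1 : ℝ)
  | insert j S hj ih =>
    simp only [Finset.prod_insert hj, Finset.sum_insert hj]
    refine (((h j).fun_pow (m j)).fun_mul ih).congr_deriv ?_
    -- The power rule produces the truncated exponent `m j - 1`, so exponent zero is treated apart.
    rcases Nat.eq_zero_or_pos (m j) with h0 | h0
    · simp [h0]
    · obtain ⟨q, hq⟩ : ∃ q, m j = q + 1 := ⟨m j - 1, by omega⟩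
      rw [hq]
      simp only [Nat.add_succ_sub_one]
      push_cast
      ring

/-! ### Regularisation of roots -/

/-- `f` is a uniform limit of smooth functions that are almost homogeneous of degree `1/d`. -/
def AlmostHomogeneous (d : ℕ) (f : ℝ → ℝ) : Prop :=
  ∃ C : ℝ, ∀ δ > 0, ∃ g : ℝ → ℝ, ContDiff ℝ ∞ g ∧ (∀ r, |g r - f r| ≤ δ) ∧
    ∀ r, |g r - d * r * deriv g r| ≤ C * δ

theorem AlmostHomogeneous.continuous {d : ℕ} {f : ℝ → ℝ} (hf : AlmostHomogeneous d f) :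
    Continuous f := by
  refine continuous_of_uniform_approx_of_continuous fun u hu => ?_
  obtain ⟨ε, hε, h⟩ := Metric.mem_uniformity_dist.1 hu
  obtain ⟨C, hC⟩ := hf
  obtain ⟨g, hg, hfg, -⟩ := hC (ε / 2) (by positivity)
  refine ⟨g, hg.continuous, fun y => h ?_⟩
  rw [dist_comm, Real.dist_eq]
  linarith [hfg y]

/-- Fixes the scale `e = δ^d` of the regularisation: with `p = 1/d` one gets `(e²)^(p/2) = δ`. -/
theorem rpow_base_identity {d : ℕ} (hd : 0 < d) {δ : ℝ} (hδ : 0 < δ) :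
    ((δ ^ d) ^ 2) ^ (1 / (d : ℝ) / 2) = δ := by
  have h1 : (0 : ℝ) ≤ δ ^ d := by positivity
  rw [← Real.rpow_natCast (δ ^ d) 2, ← Real.rpow_mul h1, ← Real.rpow_natCast δ d,
    ← Real.rpow_mul hδ.le]
  have hd' : (d : ℝ) ≠ 0 := by positivity
  rw [show (d : ℝ) * (((2 : ℕ) : ℝ) * (1 / (d : ℝ) / 2)) = 1 by push_cast; field_simp, Real.rpow_one]

/-- The regularisation is `g(r) = (r² + e²)^(p/2)` with `p = 1/d` and `e = δ^d`. Subadditivity of `s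
↦ s^(p/2)` bounds the distance to `|r|^p` by `(e²)^(p/2) = δ`. Since `d p = 1`, the Euler defect is
`g - d r g' = e² (r² + e²)^(p/2 - 1)`; the exponent is negative, so this is largest at `r = 0`,
where it equals `δ`. -/
theorem almostHomogeneous_abs {d : ℕ} (hd : 0 < d) :
    AlmostHomogeneous d fun r => |r| ^ (1 / (d : ℝ)) := by
  refine ⟨1, fun δ hδ => ?_⟩
  have hd' : (1 : ℝ) ≤ d := by exact_mod_cast hd
  set p : ℝ := 1 / (d : ℝ) with hp
  have hp0 : 0 < p := by positivity
  have hp1 : p ≤ 1 := by rw [hp, div_le_one (by positivity)]; exact hd'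
  have hdp : (d : ℝ) * p = 1 := by rw [hp]; field_simp
  set e : ℝ := δ ^ d with he
  have he0 : 0 < e := by positivity
  have heδ : (e ^ 2) ^ (p / 2) = δ := rpow_base_identity hd hδ
  have hQ : ∀ r : ℝ, 0 < r ^ 2 + e ^ 2 := fun r => by positivity
  have hder : ∀ r : ℝ, HasDerivAt (fun r : ℝ => (r ^ 2 + e ^ 2) ^ (p / 2))
      (2 * r * (p / 2) * (r ^ 2 + e ^ 2) ^ (p / 2 - 1)) r := by
    intro r
    have h1 : HasDerivAt (fun r : ℝ => r ^ 2 + e ^ 2) (2 * r) r := by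
      simpa using (hasDerivAt_pow 2 r).add_const (e ^ 2)
    exact h1.rpow_const (Or.inl (hQ r).ne')
  refine ⟨fun r => (r ^ 2 + e ^ 2) ^ (p / 2), ?_, ?_, ?_⟩
  · exact ContDiff.rpow_const_of_ne (by fun_prop) fun r => (hQ r).ne'
  · intro r
    have h1 : |r| ^ p = (r ^ 2) ^ (p / 2) := by
      rw [← sq_abs, ← Real.rpow_natCast |r| 2, ← Real.rpow_mul (abs_nonneg r)]
      congr 1; push_cast; ring
    have h2 : (r ^ 2) ^ (p / 2) ≤ (r ^ 2 + e ^ 2) ^ (p / 2) :=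
      Real.rpow_le_rpow (by positivity) (by nlinarith) (by positivity)
    have h3 := Real.rpow_add_le_add_rpow (a := r ^ 2) (b := e ^ 2) (p := p / 2) (by positivity)
      (by positivity) (by positivity) (by linarith)
    rw [heδ] at h3
    simp only
    rw [h1, abs_of_nonneg (by linarith)]
    linarith
  · intro r
    have h4 : (r ^ 2 + e ^ 2) ^ (p / 2) = (r ^ 2 + e ^ 2) ^ (p / 2 - 1) * (r ^ 2 + e ^ 2) := by
      rw [← Real.rpow_add_one (hQ r).ne']; congr 1; ring
    have h5 : (r ^ 2 + e ^ 2) ^ (p / 2) - d * r * deriv (fun r : ℝ => (r ^ 2 + e ^ 2) ^ (p / 2)) r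
        = (r ^ 2 + e ^ 2) ^ (p / 2 - 1) * e ^ 2 := by
      rw [(hder r).deriv, h4]
      linear_combination (-(r ^ 2 * (r ^ 2 + e ^ 2) ^ (p / 2 - 1))) * hdp
    have h6 : (r ^ 2 + e ^ 2) ^ (p / 2 - 1) ≤ (e ^ 2) ^ (p / 2 - 1) :=
      Real.rpow_le_rpow_of_nonpos (by positivity) (by nlinarith) (by linarith)
    have h7 : (e ^ 2) ^ (p / 2 - 1) * e ^ 2 = δ := by
      rw [← Real.rpow_add_one (by positivity), ← heδ]; congr 1; ring
    simp only
    rw [h5, abs_of_nonneg (mul_nonneg (Real.rpow_nonneg (hQ r).le _) (by positivity)), one_mul]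
    nlinarith [sq_nonneg e]

/-- The odd analogue `g(r) = r s^(p-1)` with `s = √(r² + e²)` and `e = δ^d`. Its Euler defect is
`-(d-1) r e² s^(p-3)`, bounded by `(d-1) δ` through `|r| ≤ s` and `e ≤ s`. -/
theorem almostHomogeneous_sign {d : ℕ} (hd : 0 < d) :
    AlmostHomogeneous d fun r => SignType.sign r * |r| ^ (1 / (d : ℝ)) := by
  refine ⟨(d : ℝ) - 1, fun δ hδ => ?_⟩
  have hd' : (1 : ℝ) ≤ d := by exact_mod_cast hd
  set p : ℝ := 1 / (d : ℝ) with hp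
  have hp0 : 0 < p := by positivity
  have hp1 : p ≤ 1 := by rw [hp, div_le_one (by positivity)]; exact hd'
  have hdp : (d : ℝ) * p = 1 := by rw [hp]; field_simp
  set e : ℝ := δ ^ d with he
  have he0 : 0 < e := by positivity
  have heδ : (e ^ 2) ^ (p / 2) = δ := rpow_base_identity hd hδ
  have hQ : ∀ r : ℝ, 0 < r ^ 2 + e ^ 2 := fun r => by positivity
  have hep : e ^ p = δ := by
    rw [← heδ, ← Real.rpow_natCast e 2, ← Real.rpow_mul he0.le]; congr 1; push_cast; ring
  have hder : ∀ r : ℝ, HasDerivAt (fun r : ℝ => r * (r ^ 2 + e ^ 2) ^ (p / 2 - 1 / 2))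
      (1 * (r ^ 2 + e ^ 2) ^ (p / 2 - 1 / 2)
        + r * (2 * r * (p / 2 - 1 / 2) * (r ^ 2 + e ^ 2) ^ (p / 2 - 1 / 2 - 1))) r := by
    intro r
    have h1 : HasDerivAt (fun r : ℝ => r ^ 2 + e ^ 2) (2 * r) r := by
      simpa using (hasDerivAt_pow 2 r).add_const (e ^ 2)
    exact (hasDerivAt_id r).fun_mul (h1.rpow_const (Or.inl (hQ r).ne'))
  -- the square root of `r² + e²`
  have hsq : ∀ r : ℝ, ∃ s : ℝ, |r| ≤ s ∧ e ≤ s ∧ s ≤ |r| + e ∧ 0 < s ∧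
      ∀ a : ℝ, (r ^ 2 + e ^ 2) ^ (a / 2) = s ^ a := by
    intro r
    refine ⟨Real.sqrt (r ^ 2 + e ^ 2), Real.abs_le_sqrt (by nlinarith),
      Real.le_sqrt_of_sq_le (by nlinarith), ?_, Real.sqrt_pos.2 (hQ r), fun a => ?_⟩
    · rw [Real.sqrt_le_left (by positivity)]
      nlinarith [sq_abs r, abs_nonneg r]
    · rw [Real.sqrt_eq_rpow, ← Real.rpow_mul (hQ r).le]; congr 1; ring
  refine ⟨fun r => r * (r ^ 2 + e ^ 2) ^ (p / 2 - 1 / 2), ?_, ?_, ?_⟩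
  · exact contDiff_id.mul (ContDiff.rpow_const_of_ne (by fun_prop) fun r => (hQ r).ne')
  · intro r
    obtain ⟨s, hs1, hs2, hs3, hs0, hs⟩ := hsq r
    have h1 : (r ^ 2 + e ^ 2) ^ (p / 2 - 1 / 2) = s ^ (p - 1) := by
      rw [← hs]; congr 1; ring
    have h2 : r * s ^ (p - 1) - SignType.sign r * |r| ^ p
        = SignType.sign r * (|r| * s ^ (p - 1) - |r| ^ p) := by
      nth_rewrite 1 [← sign_mul_abs r]; ring
    simp only
    rw [h1, h2, abs_mul]
    have h3 : |((SignType.sign r : SignType) : ℝ)| ≤ 1 := by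
      rcases lt_trichotomy r 0 with h | h | h <;> simp [h]
    have h4 : |r| * s ^ (p - 1) ≤ |r| ^ p := by
      rcases (abs_nonneg r).eq_or_lt with h | h
      · rw [← h, zero_mul, Real.zero_rpow hp0.ne']
      · have : |r| ^ p = |r| * |r| ^ (p - 1) := by
          rw [mul_comm, ← Real.rpow_add_one h.ne']; congr 1; ring
        rw [this]
        exact mul_le_mul_of_nonneg_left
          (Real.rpow_le_rpow_of_nonpos h hs1 (by linarith)) h.le
    -- The difference is at most `s^p - |r| s^(p-1) = s^(p-1) (s - |r|) ≤ e^(p-1) e = δ`, because `p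
    -- ≤ 1`, `e ≤ s` and `s ≤ |r| + e`.
    have h5 : |r| ^ p - |r| * s ^ (p - 1) ≤ δ := by
      have e1 : |r| ^ p ≤ s ^ p := Real.rpow_le_rpow (abs_nonneg r) hs1 hp0.le
      have e2 : s ^ p = s ^ (p - 1) * s := by
        rw [← Real.rpow_add_one hs0.ne']; congr 1; ring
      have e3 : s ^ (p - 1) ≤ e ^ (p - 1) :=
        Real.rpow_le_rpow_of_nonpos he0 hs2 (by linarith)
      have e4 : δ = e ^ (p - 1) * e := by
        rw [← hep, ← Real.rpow_add_one he0.ne']; congr 1; ring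
      have e5 : 0 < s ^ (p - 1) := Real.rpow_pos_of_pos hs0 _
      nlinarith [mul_le_mul_of_nonneg_left (show s - |r| ≤ e by linarith) e5.le,
        mul_le_mul_of_nonneg_right e3 he0.le]
    rw [abs_of_nonpos (by linarith : |r| * s ^ (p - 1) - |r| ^ p ≤ 0)]
    nlinarith [abs_nonneg ((SignType.sign r : SignType) : ℝ)]
  · intro r
    obtain ⟨s, hs1, hs2, hs3, hs0, hs⟩ := hsq r
    have hss : r ^ 2 + e ^ 2 = s ^ 2 := by
      have := hs 2
      rwa [div_self two_ne_zero, Real.rpow_one, Real.rpow_two] at this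
    have h1 : (r ^ 2 + e ^ 2) ^ (p / 2 - 1 / 2) = s ^ (p - 3) * s ^ 2 := by
      rw [← Real.rpow_two s, ← Real.rpow_add hs0, show p - 3 + 2 = p - 1 by ring, ← hs]
      congr 1; ring
    have h2 : (r ^ 2 + e ^ 2) ^ (p / 2 - 1 / 2 - 1) = s ^ (p - 3) := by
      rw [← hs]; congr 1; ring
    have h5 : r * (r ^ 2 + e ^ 2) ^ (p / 2 - 1 / 2)
        - d * r * deriv (fun r : ℝ => r * (r ^ 2 + e ^ 2) ^ (p / 2 - 1 / 2)) r
        = -(((d : ℝ) - 1) * (r * s ^ (p - 3) * e ^ 2)) := by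
      rw [(hder r).deriv, h2, h1, ← hss]
      linear_combination (-(r ^ 3 * s ^ (p - 3))) * hdp
    simp only
    rw [h5, abs_neg, abs_mul, abs_of_nonneg (by linarith : (0 : ℝ) ≤ d - 1)]
    refine mul_le_mul_of_nonneg_left ?_ (by linarith)
    have e5 : 0 < s ^ (p - 3) := Real.rpow_pos_of_pos hs0 _
    rw [abs_mul, abs_mul, abs_of_pos e5, abs_of_nonneg (by positivity : (0 : ℝ) ≤ e ^ 2)]
    have e6 : s ^ (p - 2) = s * s ^ (p - 3) := by
      rw [mul_comm, ← Real.rpow_add_one hs0.ne']; congr 1; ring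
    have e7 : s ^ (p - 2) ≤ e ^ (p - 2) :=
      Real.rpow_le_rpow_of_nonpos he0 hs2 (by linarith)
    have e8 : δ = e ^ (p - 2) * e ^ 2 := by
      rw [← Real.rpow_two, ← Real.rpow_add he0, ← hep]; congr 1; ring
    calc |r| * s ^ (p - 3) * e ^ 2 ≤ s * s ^ (p - 3) * e ^ 2 := by gcongr
      _ = s ^ (p - 2) * e ^ 2 := by rw [e6]
      _ ≤ e ^ (p - 2) * e ^ 2 := by gcongr
      _ = δ := e8.symm

/-! ### Conservation of root functionals -/

/-- With `f` exactly homogeneous of degree `1/d` and smooth, `f(R)` would be transported like a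
density with zero flux. Using the regularisation `g` instead, the time derivative of `∫ z^n g(R)` is
the integral of `z^n u_x` times the Euler defect, which is `O(δ)` uniformly on the compact rectangle
between the two times. Replacing `f` by `g` costs another `O(δ)` at each end. -/
theorem conserved_root {d : ℕ} {f : ℝ → ℝ} (hf : AlmostHomogeneous d f) (n : ℕ)
    {R : Fld → ℝ → ℝ}
    (hR : ∀ (I : Set ℝ) (U : ℝ → Fld), IsOpen I → IsSol I U →
      SmoothOn (I ×ˢ univ) fun t => R (U t))
    (hRp : ∀ V, (∀ i, Function.Periodic (V i) (2 * Real.pi)) →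
      Function.Periodic (R V) (2 * Real.pi))
    (hRt : ∀ (I : Set ℝ) (U : ℝ → Fld), IsOpen I → IsSol I U → ∀ t ∈ I, ∀ x,
      HasDerivAt (fun s => R (U s) (x + U t 0 x * (s - t)))
        (-((d : ℝ) * deriv (U t 0) x) * R (U t) x) t) :
    Conserved (functional fun U x => U 3 x ^ n * f (R U x)) := by
  intro I U hI hoc hU s hs t ht
  have hW : IsOpen (I ×ˢ (univ : Set ℝ)) := hI.prod isOpen_univ
  have hfc := hf.continuous
  obtain ⟨C, hC⟩ := hf
  have hJ : uIcc s t ⊆ I := hoc.uIcc_subset hs ht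
  have hz : SmoothOn (I ×ˢ univ) fun t x => U t 3 x ^ n := (hU.smooth 3).pow n
  have hzu : SmoothOn (I ×ˢ univ) fun t x => U t 3 x ^ n * deriv (U t 0) x :=
    ContDiffOn.mul hz ((hU.smooth 0).smooth_dX hW)
  have hsub : uIcc s t ×ˢ uIcc 0 (2 * Real.pi) ⊆ I ×ˢ (univ : Set ℝ) :=
    prod_mono hJ (subset_univ _)
  have hcomp : IsCompact (uIcc s t ×ˢ uIcc 0 (2 * Real.pi)) := isCompact_uIcc.prod isCompact_uIcc
  obtain ⟨N, hN⟩ := hcomp.exists_bound_of_continuousOn ((ContDiffOn.continuousOn hz).mono hsub)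
  obtain ⟨M, hM⟩ := hcomp.exists_bound_of_continuousOn ((ContDiffOn.continuousOn hzu).mono hsub)
  have hpi : (0 : ℝ) ≤ 2 * Real.pi := by positivity
  -- approximation of the functional
  have key : ∀ δ > 0, |functional (fun U x => U 3 x ^ n * f (R U x)) (U s)
      - functional (fun U x => U 3 x ^ n * f (R U x)) (U t)|
      ≤ (2 * (N * (2 * Real.pi)) + M * C * (2 * Real.pi) * |t - s|) * δ := by
    intro δ hδ
    obtain ⟨g, hg, hgf, hgd⟩ := hC δ hδ
    set G : ℝ → ℝ := fun τ => ∫ x in (0 : ℝ)..(2 * Real.pi), U τ 3 x ^ n * g (R (U τ) x) with hG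
    have happ : ∀ τ ∈ uIcc s t,
        |functional (fun U x => U 3 x ^ n * f (R U x)) (U τ) - G τ| ≤ N * (2 * Real.pi) * δ := by
      intro τ hτ
      have c1 := (hz.contDiff_slice (hJ hτ)).continuous
      have c2 := ((hR I U hI hU).contDiff_slice (hJ hτ)).continuous
      simp only [functional, hG]
      have c3 : Continuous fun x => U τ 3 x ^ n * f (R (U τ) x) := c1.mul (hfc.comp c2)
      have c4 : Continuous fun x => U τ 3 x ^ n * g (R (U τ) x) :=
        c1.mul (hg.continuous.comp c2)
      rw [← intervalIntegral.integral_sub (c3.intervalIntegrable _ _)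
        (c4.intervalIntegrable _ _)]
      have h := intervalIntegral.norm_integral_le_of_norm_le_const (a := 0) (b := 2 * Real.pi)
        (C := N * δ) (f := fun x => U τ 3 x ^ n * f (R (U τ) x) - U τ 3 x ^ n * g (R (U τ) x)) ?_
      · rw [Real.norm_eq_abs, sub_zero, abs_of_nonneg hpi] at h
        linarith
      · intro x hx
        rw [← mul_sub, norm_mul]
        refine mul_le_mul (hN (τ, x) ⟨hτ, uIoc_subset_uIcc hx⟩) ?_ (norm_nonneg _)
          ((norm_nonneg _).trans (hN (τ, x) ⟨hτ, uIoc_subset_uIcc hx⟩))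
        rw [Real.norm_eq_abs, abs_sub_comm]
        exact hgf _
    have hGs : SmoothOn (I ×ˢ univ) fun t x => U t 3 x ^ n * g (R (U t) x) :=
      ContDiffOn.mul hz (hg.comp_contDiffOn (hR I U hI hU))
    -- Here `R` has weight `d` and `D_t z = 0`, so `D_t ρ + ρ u_x` for `ρ = z^n g(R)` collapses to
    -- `z^n u_x (g - d R g')`.
    have hder : ∀ τ ∈ I, HasDerivAt G (∫ x in (0 : ℝ)..(2 * Real.pi),
        U τ 3 x ^ n * deriv (U τ 0) x * (g (R (U τ) x) - d * R (U τ) x * deriv g (R (U τ) x)))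
        τ := by
      intro τ hτ
      have h1 := hasDerivAt_integral_Dt hI (hU.smooth 0) hGs hτ (hU.periodic τ hτ 0) (by
        intro x
        simp only [hU.periodic τ hτ 3 x, hRp _ (hU.periodic τ hτ) x])
      refine h1.congr_deriv ?_
      congr 1
      funext x
      have hp : (τ, x) ∈ I ×ˢ (univ : Set ℝ) := ⟨hτ, mem_univ _⟩
      have l1 := hasDerivAt_line_component hW hU.smooth hU.eqn hp 3
      have l2 := hRt I U hI hU τ hτ x
      have l3 : HasDerivAt g (deriv g (R (U τ) x)) (R (U τ) (x + U τ 0 x * (τ - τ))) := by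
        rw [sub_self, mul_zero, add_zero]
        exact (hg.differentiable (by simp) _).hasDerivAt
      have l4 := (l1.fun_pow n).fun_mul (l3.comp τ l2)
      have l5 := Dt_eq_of_hasDerivAt_line (u := fun s => U s 0) hW hGs hp l4
      rw [l5]
      simp only [shift_three, sub_self, mul_zero, add_zero, zero_mul, zero_add, dX_apply,
        Function.comp]
      ring
    have hbd := (convex_uIcc s t).norm_image_sub_le_of_norm_hasDerivWithin_le (𝕜 := ℝ)
      (f := G) (C := M * (C * δ) * (2 * Real.pi))
      (fun τ hτ => (hder τ (hJ hτ)).hasDerivWithinAt) (fun τ hτ => ?_) left_mem_uIcc right_mem_uIcc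
    · have a1 := happ s left_mem_uIcc
      have a2 := happ t right_mem_uIcc
      rw [Real.norm_eq_abs, Real.norm_eq_abs] at hbd
      rw [abs_le] at a1 a2 hbd ⊢
      constructor <;> nlinarith
    · have h := intervalIntegral.norm_integral_le_of_norm_le_const (a := 0) (b := 2 * Real.pi)
        (C := M * (C * δ)) (f := fun x => U τ 3 x ^ n * deriv (U τ 0) x *
          (g (R (U τ) x) - d * R (U τ) x * deriv g (R (U τ) x))) ?_
      · rwa [sub_zero, abs_of_nonneg hpi] at h
      · intro x hx
        rw [norm_mul]
        exact mul_le_mul (hM (τ, x) ⟨hτ, uIoc_subset_uIcc hx⟩) (hgd _) (norm_nonneg _)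
          ((norm_nonneg _).trans (hM (τ, x) ⟨hτ, uIoc_subset_uIcc hx⟩))
  set A := 2 * (N * (2 * Real.pi)) + M * C * (2 * Real.pi) * |t - s|
  rw [← sub_eq_zero, ← abs_nonpos_iff]
  refine le_of_forall_pos_le_add fun ε hε => ?_
  -- Dividing by `|A| + 1` avoids deciding the sign of `A` and the case `A = 0`.
  have h := key (ε / (|A| + 1)) (by positivity)
  have h2 : A * (ε / (|A| + 1)) ≤ ε := by
    rw [mul_div_assoc', div_le_iff₀ (by positivity)]
    nlinarith [le_abs_self A]
  linarith

/-- The principal complex root of a real number. -/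
theorem ofReal_cpow_eq {d : ℕ} (hd : 0 < d) (r : ℝ) :
    (r : ℂ) ^ (1 / (d : ℂ))
      = (1 + Complex.exp (Real.pi * Complex.I * (1 / (d : ℂ)))) / 2 * ((|r| ^ (1 / (d : ℝ)) : ℝ) : ℂ)
        + (1 - Complex.exp (Real.pi * Complex.I * (1 / (d : ℂ)))) / 2
          * ((SignType.sign r * |r| ^ (1 / (d : ℝ)) : ℝ) : ℂ) := by
  have hd' : (d : ℝ) ≠ 0 := by positivity
  have hc : (1 / (d : ℂ)) = ((1 / (d : ℝ) : ℝ) : ℂ) := by push_cast; rfl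
  rcases lt_trichotomy r 0 with h | h | h
  · rw [Complex.ofReal_cpow_of_nonpos h.le, hc, ← Complex.ofReal_neg,
      ← Complex.ofReal_cpow (by linarith), abs_of_neg h, sign_neg h]
    simp only [SignType.coe_neg, SignType.coe_one]
    push_cast
    ring
  · have h0 : (0 : ℝ) ^ (1 / (d : ℝ)) = 0 := Real.zero_rpow (by positivity)
    have h1 : (0 : ℂ) ^ (1 / (d : ℂ)) = 0 := Complex.zero_cpow (by
      rw [hc]; exact_mod_cast (by positivity : (1 / (d : ℝ)) ≠ 0))
    simp only [h, Complex.ofReal_zero, h1, abs_zero, h0, mul_zero, add_zero]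
  · rw [hc, ← Complex.ofReal_cpow h.le, abs_of_pos h, sign_pos h, SignType.coe_one]
    push_cast
    ring

theorem sum_mul_rootOrder_pos {m : Fin 10 → ℕ} (hm : m ≠ 0) : 0 < ∑ j, m j * rootOrder j := by
  obtain ⟨j, hj⟩ := Function.ne_iff.1 hm
  refine Finset.sum_pos' (fun _ _ => Nat.zero_le _) ⟨j, Finset.mem_univ _, ?_⟩
  refine Nat.mul_pos (Nat.pos_of_ne_zero hj) ?_
  fin_cases j <;> simp [rootOrder]

theorem conserved_HN (k : Fin 5 → ℝ) (n : ℕ) (m : Fin 10 → ℕ) (hm : m ≠ 0) :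
    Conserved (HN k n m) := by
  set d : ℕ := ∑ j, m j * rootOrder j with hd
  have hd0 : 0 < d := sum_mul_rootOrder_pos hm
  set R : Fld → ℝ → ℝ := fun U x => ∏ j, radicand k j U x ^ m j with hR
  have hRs : ∀ (I : Set ℝ) (U : ℝ → Fld), IsOpen I → IsSol I U →
      SmoothOn (I ×ˢ univ) fun t => R (U t) := fun I U hI hU =>
    contDiffOn_prod fun j _ =>
      ContDiffOn.pow (smoothOn_radicand (hI.prod isOpen_univ) hU.smooth k j) (m j)
  have hRp : ∀ V, (∀ i, Function.Periodic (V i) (2 * Real.pi)) →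
      Function.Periodic (R V) (2 * Real.pi) := fun V hV x => by
    simp only [hR, fun j => periodic_radicand hV k j x]
  have hRt : ∀ (I : Set ℝ) (U : ℝ → Fld), IsOpen I → IsSol I U → ∀ t ∈ I, ∀ x,
      HasDerivAt (fun s => R (U s) (x + U t 0 x * (s - t)))
        (-((d : ℝ) * deriv (U t 0) x) * R (U t) x) t := fun I U hI hU t ht x => by
    have h := hasDerivAt_prod_pow
      (f := fun j s => radicand k j (U s) (x + U t 0 x * (s - t))) (d := rootOrder) (m := m)
      (a := deriv (U t 0) x) (t := t) (fun j => by
        simpa using hasDerivAt_line_radicand (hI.prod isOpen_univ) hU.smooth hU.eqn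
          (show (t, x) ∈ I ×ˢ (univ : Set ℝ) from ⟨ht, mem_univ _⟩) k j) Finset.univ
    simpa only [sub_self, mul_zero, add_zero] using h
  -- The even and the odd real root are conserved separately; the complex functional is their
  -- combination by `ofReal_cpow_eq`, with coefficients depending only on `d`.
  have h1 := conserved_root (almostHomogeneous_abs hd0) n hRs hRp hRt
  have h2 := conserved_root (almostHomogeneous_sign hd0) n hRs hRp hRt
  intro I U hI hoc hU s hs t ht
  have key : ∀ τ ∈ I, HN k n m (U τ)
      = (1 + Complex.exp (Real.pi * Complex.I * (1 / (d : ℂ)))) / 2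
          * (functional (fun U x => U 3 x ^ n * |R U x| ^ (1 / (d : ℝ))) (U τ) : ℝ)
        + (1 - Complex.exp (Real.pi * Complex.I * (1 / (d : ℂ)))) / 2
          * (functional (fun U x => U 3 x ^ n *
              (SignType.sign (R U x) * |R U x| ^ (1 / (d : ℝ)))) (U τ) : ℝ) := by
    intro τ hτ
    have c1 : Continuous fun x => U τ 3 x ^ n := ((hU.isM hτ).smooth 3).continuous.pow n
    have c2 := ((hRs I U hI hU).contDiff_slice hτ).continuous
    have c3 := c1.mul ((almostHomogeneous_abs hd0).continuous.comp c2)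
    have c4 := c1.mul ((almostHomogeneous_sign hd0).continuous.comp c2)
    simp only [functional]
    rw [← intervalIntegral.integral_ofReal, ← intervalIntegral.integral_ofReal,
      ← intervalIntegral.integral_const_mul, ← intervalIntegral.integral_const_mul,
      ← intervalIntegral.integral_add]
    · refine intervalIntegral.integral_congr fun x _ => ?_
      simp only [← hd]
      rw [ofReal_cpow_eq hd0]
      push_cast
      ring
    · exact ((Complex.continuous_ofReal.comp c3).const_mul _).intervalIntegrable _ _
    · exact ((Complex.continuous_ofReal.comp c4).const_mul _).intervalIntegrable _ _
  rw [key s hs, key t ht, h1 I U hI hoc hU s hs t ht, h2 I U hI hoc hU s hs t ht]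

/-! ### Gradients -/

theorem contDiff_deriv {f : ℝ → ℝ} (hf : ContDiff ℝ ∞ f) : ContDiff ℝ ∞ (deriv f) :=
  (contDiff_infty_iff_deriv.1 hf).2

theorem IsM.sub {a b : Fld} (ha : IsM a) (hb : IsM b) : IsM (a - b) :=
  ⟨fun i => (ha.smooth i).sub (hb.smooth i), fun i => (ha.periodic i).sub (hb.periodic i)⟩

theorem isM_vec {f₀ f₁ f₂ f₃ : ℝ → ℝ} (h₀ : ContDiff ℝ ∞ f₀) (h₁ : ContDiff ℝ ∞ f₁)
    (h₂ : ContDiff ℝ ∞ f₂) (h₃ : ContDiff ℝ ∞ f₃) (p₀ : Function.Periodic f₀ (2 * Real.pi))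
    (p₁ : Function.Periodic f₁ (2 * Real.pi)) (p₂ : Function.Periodic f₂ (2 * Real.pi))
    (p₃ : Function.Periodic f₃ (2 * Real.pi)) : IsM ![f₀, f₁, f₂, f₃] := by
  constructor <;> intro i <;> fin_cases i <;> assumption

theorem variation_apply (U φ : Fld) (ε : ℝ) (i : Fin 4) (x : ℝ) :
    (U + ε • φ) i x = U i x + ε * φ i x := rfl

theorem deriv_variation {U φ : Fld} (hU : ∀ i, ContDiff ℝ ∞ (U i)) (hφ : ∀ i, ContDiff ℝ ∞ (φ i))
    (ε : ℝ) (i : Fin 4) (x : ℝ) :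
    deriv ((U + ε • φ) i) x = deriv (U i) x + ε * deriv (φ i) x := by
  have h1 : HasDerivAt (U i) (deriv (U i) x) x :=
    ((hU i).differentiable (by simp) x).hasDerivAt
  have h2 : HasDerivAt (φ i) (deriv (φ i) x) x :=
    ((hφ i).differentiable (by simp) x).hasDerivAt
  exact (h1.add (h2.const_mul ε)).deriv

theorem hasDerivAt_affine (a b t : ℝ) : HasDerivAt (fun ε : ℝ => a + ε * b) b t := by
  simpa using ((hasDerivAt_id t).mul_const b).const_add a

/-- The first variation of a density equals `⟨φ, g⟩` up to `∂Ξ`, where `Ξ` collects the boundary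
terms of the integrations by parts and vanishes over a period. -/
theorem isGrad_of_flux {d : Fld → ℝ → ℝ} {U g : Fld} (hg : IsM g)
    (h : ∀ φ, IsM φ → SmoothOn (univ ×ˢ univ) (fun ε => d (U + ε • φ)) ∧
      ∃ Ξ : ℝ → ℝ, ContDiff ℝ ∞ Ξ ∧ Function.Periodic Ξ (2 * Real.pi) ∧
        ∀ x, HasDerivAt (fun ε : ℝ => d (U + ε • φ) x) (∑ i, φ i x * g i x + deriv Ξ x) 0) :
    IsGrad (functional d) U g := by
  refine ⟨hg, fun φ hφ => ?_⟩
  obtain ⟨hs, Ξ, hΞ, hp, hd⟩ := h φ hφ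
  refine (hs.hasDerivAt_integral isOpen_univ (mem_univ (0 : ℝ)) 0 (2 * Real.pi)).congr_deriv ?_
  have h1 : ∀ x, dT (fun ε => d (U + ε • φ)) 0 x = ∑ i, φ i x * g i x + deriv Ξ x :=
    fun x => (hd x).deriv
  simp_rw [h1]
  have hc : Continuous fun x => ∑ i, φ i x * g i x :=
    continuous_finsetSum _ fun i _ => (hφ.smooth i).continuous.mul (hg.smooth i).continuous
  rw [intervalIntegral.integral_add (hc.intervalIntegrable _ _)
    ((contDiff_deriv hΞ).continuous.intervalIntegrable _ _),
    integral_deriv_eq_zero (hΞ.of_le (by simp)) hp, add_zero]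
  rfl

/-- Testing against `φ = g - h`, which is itself an admissible variation, makes the integral of `|g
- h|²` vanish; continuity and periodicity do the rest. This lets results about arbitrary gradients
be checked on explicit ones. -/
theorem IsGrad.unique {F : Fld → ℝ} {U g h : Fld} (hg : IsGrad F U g) (hh : IsGrad F U h) :
    g = h := by
  have hgh := hg.1.sub hh.1
  have h1 := (hg.2 _ hgh).unique (hh.2 _ hgh)
  set q : ℝ → ℝ := fun x => ∑ i, (g i x - h i x) ^ 2 with hq
  have hcg : ∀ i, Continuous (g i) := fun i => (hg.1.smooth i).continuous
  have hch : ∀ i, Continuous (h i) := fun i => (hh.1.smooth i).continuous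
  have hqc : Continuous q := by
    refine continuous_finsetSum _ fun i _ => ?_
    exact ((hcg i).sub (hch i)).pow 2
  have hint : ∫ x in (0 : ℝ)..(2 * Real.pi), q x = 0 := by
    have h2 : ∫ x in (0 : ℝ)..(2 * Real.pi),
        (∑ i, (g - h) i x * g i x - ∑ i, (g - h) i x * h i x) = 0 := by
      rw [intervalIntegral.integral_sub]
      · exact sub_eq_zero.2 h1
      · exact (continuous_finsetSum _ fun i _ =>
          ((hcg i).sub (hch i)).mul (hcg i)).intervalIntegrable _ _
      · exact (continuous_finsetSum _ fun i _ =>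
          ((hcg i).sub (hch i)).mul (hch i)).intervalIntegrable _ _
    rw [← h2]
    congr 1
    funext x
    rw [← Finset.sum_sub_distrib]
    refine Finset.sum_congr rfl fun i _ => ?_
    simp only [Pi.sub_apply]
    ring
  have hzero : ∀ x ∈ Icc 0 (2 * Real.pi), q x = 0 := by
    by_contra! hne
    obtain ⟨x, hx, hqx⟩ := hne
    have hnn : ∀ x, 0 ≤ q x := fun x => Finset.sum_nonneg fun i _ => sq_nonneg _
    have := intervalIntegral.integral_pos (by positivity : (0 : ℝ) < 2 * Real.pi)
      hqc.continuousOn (fun x _ => hnn x) ⟨x, hx, lt_of_le_of_ne (hnn x) hqx.symm⟩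
    exact this.ne' hint
  have hqp : Function.Periodic q (2 * Real.pi) := fun x => by
    simp only [hq, fun i => hg.1.periodic i x, fun i => hh.1.periodic i x]
  funext i x
  obtain ⟨y, hy, hxy⟩ := hqp.exists_mem_Ico₀ (by positivity) x
  have hqx : q x = 0 := by rw [hxy]; exact hzero y ⟨hy.1, hy.2.le⟩
  have := (Finset.sum_eq_zero_iff_of_nonneg fun i _ => sq_nonneg _).1 hqx i (Finset.mem_univ i)
  nlinarith [this]

/-- The gradient of `H`. -/
def gradH (U : Fld) : Fld :=
  ![deriv (U 3), fun x => - deriv (U 2) x, deriv (U 1), fun x => - deriv (U 0) x]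

/-- The gradient of `A_n`. -/
def gradHA (n : ℕ) (U : Fld) : Fld :=
  ![fun x => U 3 x ^ n * deriv (U 3) x * U 2 x,
    fun x => - (U 3 x ^ n * deriv (U 3) x * U 1 x),
    fun x => U 3 x ^ n * deriv (U 3) x * U 0 x,
    fun x => U 3 x ^ (n + 1) - U 3 x ^ n * (deriv (U 0) x * U 2 x + U 0 x * deriv (U 2) x
      - U 1 x * deriv (U 1) x)]

/-- The gradient of `B_n`. -/
def gradHB (n : ℕ) (U : Fld) : Fld :=
  ![fun _ => 0,
    fun x => - (2 * U 3 x ^ (n + 1) * deriv (U 3) x),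
    fun x => 2 * U 3 x ^ n * deriv (U 3) x * U 2 x,
    fun x => 2 * U 3 x ^ (n + 1) * deriv (U 1) x - 2 * U 3 x ^ n * U 2 x * deriv (U 2) x]

theorem isGrad_H {U : Fld} (hU : IsM U) : IsGrad H U (gradH U) := by
  have s0 := hU.smooth
  have s1 := fun i => contDiff_deriv (hU.smooth i)
  have p1 := fun i => periodic_deriv (hU.periodic i)
  refine isGrad_of_flux (isM_vec (s1 3) (s1 2).neg (s1 1) (s1 0).neg (p1 3)
    (fun x => by rw [p1 2 x]) (p1 1) (fun x => by rw [p1 0 x])) fun φ hφ => ?_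
  have q0 := hφ.smooth
  have q1 := fun i => contDiff_deriv (hφ.smooth i)
  simp only [variation_apply, deriv_variation s0 q0]
  -- Boundary term from moving the derivative off `φ₃` in `u ∂φ₃` and off `φ₂` in `v ∂φ₂`.
  refine ⟨ContDiff.contDiffOn (by fun_prop), fun x => U 0 x * φ 3 x - U 1 x * φ 2 x, ?_, ?_, ?_⟩
  · fun_prop
  · intro x
    simp only [fun i => hU.periodic i x, fun i => hφ.periodic i x]
  · intro x
    rw [(((hU.hasDerivAt 0 x).fun_mul (hφ.hasDerivAt 3 x)).fun_sub
      ((hU.hasDerivAt 1 x).fun_mul (hφ.hasDerivAt 2 x))).deriv]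
    refine (((hasDerivAt_affine _ _ _).fun_mul (hasDerivAt_affine _ _ _)).fun_sub
      ((hasDerivAt_affine _ _ _).fun_mul (hasDerivAt_affine _ _ _))).congr_deriv ?_
    simp only [Fin.sum_univ_four, gradH, Matrix.cons_val, zero_mul, add_zero]
    ring

theorem isM_gradHA (n : ℕ) {U : Fld} (hU : IsM U) : IsM (gradHA n U) := by
  have s0 := hU.smooth
  have s1 := fun i => contDiff_deriv (hU.smooth i)
  refine isM_vec (by fun_prop) (by fun_prop) (by fun_prop) (by fun_prop) ?_ ?_ ?_ ?_ <;> intro x <;>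
  simp only [fun i => hU.periodic i x, fun i => periodic_deriv (hU.periodic i) x]

theorem isM_gradHB (n : ℕ) {U : Fld} (hU : IsM U) : IsM (gradHB n U) := by
  have s0 := hU.smooth
  have s1 := fun i => contDiff_deriv (hU.smooth i)
  refine isM_vec (by fun_prop) (by fun_prop) (by fun_prop) (by fun_prop) ?_ ?_ ?_ ?_ <;> intro x <;>
  simp only [fun i => hU.periodic i x, fun i => periodic_deriv (hU.periodic i) x]

theorem isGrad_HA (n : ℕ) {U : Fld} (hU : IsM U) : IsGrad (HA n) U (gradHA n U) := by
  have hn : (n : ℝ) + 2 ≠ 0 := by positivity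
  refine isGrad_of_flux (isM_gradHA n hU) fun φ hφ => ?_
  have s0 := hU.smooth
  have s1 := fun i => contDiff_deriv (hU.smooth i)
  have q0 := hφ.smooth
  have q1 := fun i => contDiff_deriv (hφ.smooth i)
  simp only [variation_apply, deriv_variation s0 q0]
  -- Moving the derivative off `φ₃` gives this boundary term. The resulting `n z^(n-1) z_x` cancels
  -- the one from varying `z^n`, which is why the gradient has no such term.
  refine ⟨ContDiff.contDiffOn (by fun_prop),
    fun x => U 3 x ^ n * φ 3 x * (U 0 x * U 2 x - U 1 x ^ 2 / 2), by fun_prop, ?_, ?_⟩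
  · intro x
    simp only [fun i => hU.periodic i x, fun i => hφ.periodic i x]
  · intro x
    have hx := fun i => hU.hasDerivAt i x
    rw [((((hx 3).fun_pow n).fun_mul (hφ.hasDerivAt 3 x)).fun_mul
      (((hx 0).fun_mul (hx 2)).fun_sub (((hx 1).fun_pow 2).div_const 2))).deriv]
    have ha := fun a b => hasDerivAt_affine a b 0
    refine (((((ha (U 3 x) (φ 3 x)).fun_pow n).fun_mul (ha _ _)).fun_mul
      (((ha _ _).fun_mul (ha _ _)).fun_sub (((ha _ _).fun_pow 2).div_const 2))).fun_add
      (((ha _ _).fun_pow (n + 2)).div_const _)).congr_deriv ?_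
    simp only [Fin.sum_univ_four, gradHA, Matrix.cons_val, zero_mul, add_zero,
      Nat.add_succ_sub_one]
    push_cast
    field_simp
    ring

theorem isGrad_HB (n : ℕ) {U : Fld} (hU : IsM U) : IsGrad (HB n) U (gradHB n U) := by
  refine isGrad_of_flux (isM_gradHB n hU) fun φ hφ => ?_
  have s0 := hU.smooth
  have s1 := fun i => contDiff_deriv (hU.smooth i)
  have q0 := hφ.smooth
  have q1 := fun i => contDiff_deriv (hφ.smooth i)
  simp only [variation_apply, deriv_variation s0 q0]
  refine ⟨ContDiff.contDiffOn (by fun_prop),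
    fun x => U 3 x ^ n * φ 3 x * (U 2 x ^ 2 - 2 * U 1 x * U 3 x), by fun_prop, ?_, ?_⟩
  · intro x
    simp only [fun i => hU.periodic i x, fun i => hφ.periodic i x]
  · intro x
    have hx := fun i => hU.hasDerivAt i x
    rw [((((hx 3).fun_pow n).fun_mul (hφ.hasDerivAt 3 x)).fun_mul
      (((hx 2).fun_pow 2).fun_sub (((hx 1).const_mul 2).fun_mul (hx 3)))).deriv]
    have ha := fun a b => hasDerivAt_affine a b 0
    refine ((((ha (U 3 x) (φ 3 x)).fun_pow n).fun_mul (ha _ _)).fun_mul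
      (((ha _ _).fun_pow 2).fun_sub (((ha _ _).const_mul 2).fun_mul (ha _ _)))).congr_deriv ?_
    simp only [Fin.sum_univ_four, gradHB, Matrix.cons_val, zero_mul, add_zero]
    push_cast
    ring

/-- The gradient of a member of the family `A_n`, `B_n`. -/
def gradAB : ℕ ⊕ ℕ → Fld → Fld := Sum.elim gradHA gradHB

theorem isGrad_elim (n : ℕ ⊕ ℕ) {U : Fld} (hU : IsM U) :
    IsGrad (Sum.elim HA HB n) U (gradAB n U) := by
  cases n with
  | inl n => exact isGrad_HA n hU
  | inr n => exact isGrad_HB n hU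

/-! ### Involution and the local Hamiltonian form of `K` -/

/-- The convention `1 / 0 = 0` makes the whole operator vanish where `z_x = 0`, so pointwise
identities hold on all of `ℝ` and the pairing may be taken over a full period. -/
theorem eta_one_eq_zero {U g : Fld} {x : ℝ} (hx : deriv (U 3) x = 0) (i : Fin 4) :
    eta (fun _ => 1) U g i x = 0 := by
  fin_cases i <;> simp [eta, hx]

/-- The brackets vanish already before integration, as an algebraic identity between the explicit
gradients. -/
theorem involution_pointwise (n m : ℕ ⊕ ℕ) (U : Fld) (x : ℝ) :
    ∑ i, gradAB n U i x * eta (fun _ => 1) U (gradAB m U) i x = 0 := by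
  by_cases hx : deriv (U 3) x = 0
  · simp only [eta_one_eq_zero hx, mul_zero, Finset.sum_const_zero]
  · rcases n with n | n <;> rcases m with m | m <;>
    · simp only [gradAB, Sum.elim_inl, Sum.elim_inr, Fin.sum_univ_four, eta, gradHA, gradHB,
        Matrix.cons_val]
      field_simp
      ring

theorem involution (n m : ℕ ⊕ ℕ) {U g h : Fld} (hU : IsM U)
    (hg : IsGrad (Sum.elim HA HB n) U g) (hh : IsGrad (Sum.elim HA HB m) U h) :
    (∀ x ∈ reg univ U, ∑ i, g i x * eta (fun _ => 1) U h i x = 0) ∧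
      pair g (eta (fun _ => 1) U h) = 0 := by
  rw [hg.unique (isGrad_elim n hU), hh.unique (isGrad_elim m hU)]
  refine ⟨fun x _ => involution_pointwise n m U x, ?_⟩
  simp only [pair, involution_pointwise, intervalIntegral.integral_zero]

/-- The first three components of the gradient carry the factor `z^n z_x`, which cancels the
coefficient `z^(-n)/z_x`; the fourth enters only in the third row, where `z^(n+1)` leaves `z`. -/
theorem K_eq_eta_gradHA (n : ℕ) {U : Fld} {x : ℝ} (hx : x ∈ reg {s | s ^ n ≠ 0} U)
    (i : Fin 4) : K U i x = - eta (fun s => (s ^ n)⁻¹) U (gradHA n U) i x := by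
  obtain ⟨h1, h2⟩ := hx
  have h3 : U 3 x ^ n ≠ 0 := h2
  fin_cases i <;> simp only [K, eta, gradHA, Fin.zero_eta, Fin.mk_one, Fin.reduceFinMk,
    Matrix.cons_val, pow_succ] <;> field_simp <;> ring

/-- Triangular elimination: the last row kills `g 2`, then the first two rows kill `g 1` and `g 0`,
and the third leaves `g 3`. -/
theorem eta_one_nondegenerate {U : Fld} {x : ℝ} (hx : deriv (U 3) x ≠ 0) {g : Fld}
    (h : ∀ i, eta (fun _ => 1) U g i x = 0) (i : Fin 4) : g i x = 0 := by
  have h0 := h 0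
  have h1 := h 1
  have h2 := h 2
  have h3 := h 3
  simp only [eta, Matrix.cons_val, one_div, mul_eq_zero, inv_eq_zero, hx, false_or, neg_eq_zero]
    at h0 h1 h2 h3
  rw [h3, mul_zero, add_zero] at h0 h1
  have h1' : g 0 x = 0 := by linarith
  rw [h0, h1', mul_zero, mul_zero, zero_add, zero_add] at h2
  have h2' : g 3 x = 0 := (mul_eq_zero.1 h2).resolve_left hx
  fin_cases i <;> assumption

/-! ### Locally supported integrands -/

theorem continuous_of_continuousOn_of_eq_zero {R C : Set ℝ} {f : ℝ → ℝ} (hR : IsOpen R)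
    (hC : IsClosed C) (hCR : C ⊆ R) (hf : ContinuousOn f R) (h0 : ∀ x, x ∉ C → f x = 0) :
    Continuous f := by
  rw [continuous_iff_continuousAt]
  intro x
  by_cases hx : x ∈ C
  · exact hf.continuousAt (hR.mem_nhds (hCR hx))
  · have h : f =ᶠ[nhds x] fun _ => 0 :=
      Filter.eventually_of_mem (hC.isOpen_compl.mem_nhds hx) fun y hy => h0 y hy
    exact continuousAt_const.congr h.symm

/-- The form in which every skewness and cyclic identity is used. Only the sum of the three
integrands is exact, and only on the open set `R`; vanishing off the closed set `C` gives the
continuity needed to combine the integrals, so values produced by division by zero outside `R` never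
matter. -/
theorem integral_add_add_eq_zero {R C : Set ℝ} {F f₁ f₂ f₃ : ℝ → ℝ} (hR : IsOpen R)
    (hC : IsClosed C) (hCR : C ⊆ R) (hF : ContDiffOn ℝ ∞ F R)
    (h₁ : ContinuousOn f₁ R) (h₂ : ContinuousOn f₂ R) (h₃ : ContinuousOn f₃ R)
    (hd : ∀ x ∈ R, HasDerivAt F (f₁ x + f₂ x + f₃ x) x) (hF0 : ∀ x, x ∉ C → F x = 0)
    (hz₁ : ∀ x, x ∉ C → f₁ x = 0) (hz₂ : ∀ x, x ∉ C → f₂ x = 0) (hz₃ : ∀ x, x ∉ C → f₃ x = 0)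
    (hp : Function.Periodic F (2 * Real.pi)) :
    (∫ x in (0 : ℝ)..(2 * Real.pi), f₁ x) + (∫ x in (0 : ℝ)..(2 * Real.pi), f₂ x)
      + (∫ x in (0 : ℝ)..(2 * Real.pi), f₃ x) = 0 := by
  have c₁ := continuous_of_continuousOn_of_eq_zero hR hC hCR h₁ hz₁
  have c₂ := continuous_of_continuousOn_of_eq_zero hR hC hCR h₂ hz₂
  have c₃ := continuous_of_continuousOn_of_eq_zero hR hC hCR h₃ hz₃
  have c₁₂ : Continuous fun x => f₁ x + f₂ x := c₁.add c₂
  rw [← intervalIntegral.integral_add (c₁.intervalIntegrable _ _) (c₂.intervalIntegrable _ _),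
    ← intervalIntegral.integral_add (c₁₂.intervalIntegrable _ _) (c₃.intervalIntegrable _ _)]
  exact integral_eq_zero_of_hasDerivAt hR hC hCR hF hd hF0
    (fun x hx => by rw [hz₁ x hx, hz₂ x hx, hz₃ x hx]; norm_num) hp

/-- The joint support of three fields. -/
def jointSupport (a b c : Fld) : Set ℝ :=
  ⋃ i, (tsupport (a i) ∪ tsupport (b i) ∪ tsupport (c i))

theorem isClosed_jointSupport (a b c : Fld) : IsClosed (jointSupport a b c) :=
  isClosed_iUnion_of_finite fun _ =>
    ((isClosed_tsupport _).union (isClosed_tsupport _)).union (isClosed_tsupport _)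

theorem jointSupport_subset {R : Set ℝ} {a b c : Fld} (ha : Supported R a) (hb : Supported R b)
    (hc : Supported R c) : jointSupport a b c ⊆ R :=
  iUnion_subset fun i => union_subset (union_subset (ha.2 i) (hb.2 i)) (hc.2 i)

theorem eq_zero_of_notMem_jointSupport {a b c : Fld} {x : ℝ} (hx : x ∉ jointSupport a b c)
    (i : Fin 4) : a i x = 0 ∧ b i x = 0 ∧ c i x = 0 := by
  have h : x ∉ tsupport (a i) ∪ tsupport (b i) ∪ tsupport (c i) := fun h =>
    hx (mem_iUnion.2 ⟨i, h⟩)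
  simp only [mem_union, not_or] at h
  exact ⟨image_eq_zero_of_notMem_tsupport h.1.1, image_eq_zero_of_notMem_tsupport h.1.2,
    image_eq_zero_of_notMem_tsupport h.2⟩

theorem isOpen_reg {D : Set ℝ} (hD : IsOpen D) {U : Fld} (hU : IsM U) : IsOpen (reg D U) :=
  (isOpen_ne_fun (hU.contDiff_deriv 3).continuous continuous_const).inter
    (hD.preimage (hU.smooth 3).continuous)

theorem hasDerivAt_of_contDiffOn {R : Set ℝ} (hR : IsOpen R) {f : ℝ → ℝ}
    (hf : ContDiffOn ℝ ∞ f R) {x : ℝ} (hx : x ∈ R) : HasDerivAt f (deriv f x) x :=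
  ((hf.contDiffAt (hR.mem_nhds hx)).differentiableAt (by simp)).hasDerivAt

theorem contDiffOn_deriv {R : Set ℝ} (hR : IsOpen R) {f : ℝ → ℝ}
    (hf : ContDiffOn ℝ ∞ f R) : ContDiffOn ℝ ∞ (deriv f) R :=
  hf.deriv_of_isOpen hR (by simp)

theorem deriv_congr_of_isOpen {R : Set ℝ} (hR : IsOpen R) {f g : ℝ → ℝ}
    (h : ∀ x ∈ R, f x = g x) {x : ℝ} (hx : x ∈ R) : deriv f x = deriv g x :=
  Filter.EventuallyEq.deriv_eq (Filter.eventually_of_mem (hR.mem_nhds hx) h)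

/-! ### The structure of `ϑ⁻¹` -/

/-- The slopes `u_x / z_x`, `v_x / z_x`, `w_x / z_x`. -/
def slope (U : Fld) (i : Fin 4) (x : ℝ) : ℝ := deriv (U i) x / deriv (U 3) x

/-- The variation of a component at fixed `z`. -/
def hat (U Y : Fld) (i : Fin 4) (x : ℝ) : ℝ := Y i x - slope U i x * Y 3 x

theorem contDiffOn_slope {D : Set ℝ} {U : Fld} (hU : IsM U) (i : Fin 4) :
    ContDiffOn ℝ ∞ (slope U i) (reg D U) :=
  (hU.contDiff_deriv i).contDiffOn.div (hU.contDiff_deriv 3).contDiffOn fun _ hx => hx.1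

theorem contDiffOn_hat {D : Set ℝ} {U Y : Fld} (hU : IsM U)
    (hY : ∀ i, ContDiffOn ℝ ∞ (Y i) (reg D U)) (i : Fin 4) :
    ContDiffOn ℝ ∞ (hat U Y i) (reg D U) :=
  (hY i).sub ((contDiffOn_slope hU i).mul (hY 3))

theorem periodic_slope {U : Fld} (hU : IsM U) (i : Fin 4) :
    Function.Periodic (slope U i) (2 * Real.pi) := fun x => by
  simp only [slope, periodic_deriv (hU.periodic i) x, periodic_deriv (hU.periodic 3) x]

theorem periodic_hat {U Y : Fld} (hU : IsM U) (hY : IsM Y) (i : Fin 4) :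
    Function.Periodic (hat U Y i) (2 * Real.pi) := fun x => by
  simp only [hat, periodic_slope hU i x, hY.periodic i x, hY.periodic 3 x]

/-- All of `ϑ⁻¹` factors through derivatives of hats. In the last row the coefficients of `Y₃'` and
`Y₃` reassemble to `A` and `A'/2`. -/
theorem Theta_eq {D : Set ℝ} (hD : IsOpen D) {U Y : Fld} (hU : IsM U) {x : ℝ}
    (hx : x ∈ reg D U) (hY : ∀ i, DifferentiableAt ℝ (Y i) x) :
    Theta U Y 0 x = - deriv (hat U Y 2) x ∧ Theta U Y 1 x = deriv (hat U Y 1) x ∧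
    Theta U Y 2 x = - deriv (hat U Y 0) x ∧
    Theta U Y 3 x = slope U 0 x * deriv (hat U Y 2) x - slope U 1 x * deriv (hat U Y 1) x
      + slope U 2 x * deriv (hat U Y 0) x := by
  have hs := fun i => hasDerivAt_of_contDiffOn (isOpen_reg hD hU) (contDiffOn_slope hU i) hx
  have hy := fun i => (hY i).hasDerivAt
  have hm : ∀ i, HasDerivAt (fun y => deriv (U i) y / deriv (U 3) y * Y 3 y)
      (deriv (slope U i) x * Y 3 x + slope U i x * deriv (Y 3) x) x :=
    fun i => (hs i).fun_mul (hy 3)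
  have hh : ∀ i, deriv (hat U Y i) x
      = deriv (Y i) x - (deriv (slope U i) x * Y 3 x + slope U i x * deriv (Y 3) x) :=
    fun i => ((hy i).fun_sub ((hs i).fun_mul (hy 3))).deriv
  -- In terms of slopes, `A` is the quadratic expression `s₁² - 2 s₀ s₂`, so its derivative needs
  -- only those of the slopes.
  have hA : (fun y => (deriv (U 1) y ^ 2 - 2 * deriv (U 0) y * deriv (U 2) y)
      / deriv (U 3) y ^ 2 * Y 3 y)
      = fun y => (slope U 1 y ^ 2 - 2 * (slope U 0 y * slope U 2 y)) * Y 3 y := by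
    funext y
    simp only [slope]
    ring
  have hA' := (((((hs 1).fun_pow 2).fun_sub (((hs 0).fun_mul (hs 2)).const_mul 2))).fun_mul
    (hy 3)).deriv
  refine ⟨?_, ?_, ?_, ?_⟩
  · simp only [Theta, Matrix.cons_val]
    rw [(hm 2).deriv, hh]
    ring
  · simp only [Theta, Matrix.cons_val]
    rw [(hm 1).deriv, hh]
  · simp only [Theta, Matrix.cons_val]
    rw [(hm 0).deriv, hh]
    ring
  · simp only [Theta, Matrix.cons_val]
    rw [hA, hA', hh, hh, hh]
    simp only [slope]
    push_cast
    ring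

/-- The last row is minus the slope combination of the other three; multiplying by `z_x` gives
orthogonality to `U_x`. -/
theorem sum_deriv_mul_Theta {D : Set ℝ} (hD : IsOpen D) {U Y : Fld} (hU : IsM U) {x : ℝ}
    (hx : x ∈ reg D U) (hY : ∀ i, DifferentiableAt ℝ (Y i) x) :
    ∑ i, deriv (U i) x * Theta U Y i x = 0 := by
  obtain ⟨h0, h1, h2, h3⟩ := Theta_eq hD hU hx hY
  have hz : deriv (U 3) x ≠ 0 := hx.1
  rw [Fin.sum_univ_four, h0, h1, h2, h3]
  simp only [slope]
  field_simp
  ring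

/-- A multiple of `U_x` is an infinitesimal reparametrisation of `x`; its variation at fixed `z` is
zero. -/
theorem Theta_smul_deriv {U : Fld} (hU : IsM U) {f : ℝ → ℝ} (hf : ContDiff ℝ ∞ f) {x : ℝ}
    (hx : x ∈ reg univ U) (i : Fin 4) : Theta U (fun j y => f y * deriv (U j) y) i x = 0 := by
  have hh : ∀ i, deriv (hat U (fun j y => f y * deriv (U j) y) i) x = 0 := fun i => by
    rw [deriv_congr_of_isOpen (g := fun _ => 0) (isOpen_reg isOpen_univ hU) ?_ hx, deriv_const]
    intro y hy
    have hz : deriv (U 3) y ≠ 0 := hy.1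
    simp only [hat, slope]
    field_simp
    ring
  obtain ⟨h0, h1, h2, h3⟩ := Theta_eq isOpen_univ hU hx
    (Y := fun j y => f y * deriv (U j) y) fun j =>
      (hf.mul (hU.contDiff_deriv j)).differentiable (by simp) x
  simp only [hh, mul_zero, neg_zero, sub_zero, add_zero] at h0 h1 h2 h3
  fin_cases i <;> assumption

theorem differentiableAt_K {U : Fld} (hU : IsM U) (i : Fin 4) (x : ℝ) :
    DifferentiableAt ℝ (K U i) x := by
  have s0 := hU.smooth
  have s1 := fun i => contDiff_deriv (hU.smooth i)
  have h : ContDiff ℝ ∞ (K U i) := by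
    fin_cases i
    · exact (s0 1).sub ((s0 0).mul (s1 0))
    · exact (s0 2).sub ((s0 0).mul (s1 1))
    · exact (s0 3).sub ((s0 0).mul (s1 2))
    · exact ((s0 0).mul (s1 3)).neg
  exact h.differentiable (by simp) x

theorem Theta_K {U : Fld} (hU : IsM U) {x : ℝ} (hx : x ∈ reg univ U) (i : Fin 4) :
    Theta U (K U) i x = - gradH U i x := by
  have hz : deriv (U 3) x ≠ 0 := hx.1
  -- `K` is the shift `(v, w, z, 0)` minus `u U_x`, and the hat kills the second part. The index 3
  -- is excluded because `i + 1` wraps round in `Fin 4`.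
  have h : ∀ i : Fin 4, i ≠ 3 → ∀ y ∈ reg univ U, hat U (K U) i y = U (i + 1) y := by
    intro i hi y hy
    have hzy : deriv (U 3) y ≠ 0 := hy.1
    fin_cases i
    · simp [hat, slope, K]; field_simp; ring
    · simp [hat, slope, K]; field_simp; ring
    · simp [hat, slope, K]; field_simp; ring
    · exact absurd rfl hi
  have hd : ∀ i : Fin 4, i ≠ 3 → deriv (hat U (K U) i) x = deriv (U (i + 1)) x := fun i hi =>
    deriv_congr_of_isOpen (isOpen_reg isOpen_univ hU) (h i hi) hx
  obtain ⟨h0, h1, h2, h3⟩ := Theta_eq isOpen_univ hU hx (Y := K U) fun i => differentiableAt_K hU i x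
  have d0 : deriv (hat U (K U) 0) x = deriv (U 1) x := hd 0 (by decide)
  have d1 : deriv (hat U (K U) 1) x = deriv (U 2) x := hd 1 (by decide)
  have d2 : deriv (hat U (K U) 2) x = deriv (U 3) x := hd 2 (by decide)
  rw [d2] at h0 h3
  rw [d1] at h1 h3
  rw [d0] at h2 h3
  fin_cases i
  · exact h0
  · simpa [gradH] using h1
  · exact h2
  · simp only [gradH, Fin.reduceFinMk, Matrix.cons_val]
    rw [h3]
    simp only [slope]
    field_simp
    ring

/-! ### The nonlocal operator `ϑ` -/

theorem ThetaInv_gradH {U : Fld} (hU : IsM U) : ThetaInv U (gradH U) (- K U) := by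
  have s0 := hU.smooth
  -- The components of the gradient are exact derivatives, with antiderivatives `(z, -w, v, -u)`.
  -- The density `Σ (U_i)_x g_i` cancels in pairs, so its antiderivative may be taken to be zero.
  refine ⟨![U 3, fun x => - U 2 x, U 1, fun x => - U 0 x], fun _ => 0,
    isM_vec (s0 3) (s0 2).neg (s0 1) (s0 0).neg (hU.periodic 3)
      (fun x => by rw [hU.periodic 2 x]) (hU.periodic 1) (fun x => by rw [hU.periodic 0 x]),
    contDiff_const, fun _ => rfl, ?_, ?_, ?_, ?_, ?_, ?_⟩
  · intro i x
    fin_cases i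
    · rfl
    · exact (hU.hasDerivAt 2 x).fun_neg.deriv
    · rfl
    · exact (hU.hasDerivAt 0 x).fun_neg.deriv
  · intro x
    simp only [deriv_const, Fin.sum_univ_four, gradH, Matrix.cons_val]
    ring
  all_goals
    intro x
    simp only [Pi.neg_apply, K, Matrix.cons_val]
    ring

/-- Substituting derivatives of the antiderivatives for the covectors makes the sum of the two
integrands a total derivative of a periodic function. No integration constant is fixed, so skewness
holds for every choice. -/
theorem ThetaInv_skew {U : Fld} {g h Y Z : Fld} (hY : ThetaInv U g Y) (hZ : ThetaInv U h Z)
    (hU : IsM U) : pair g Z + pair h Y = 0 := by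
  obtain ⟨G, S, hG, hS, hSp, hGd, hSd, y0, y1, y2, y3⟩ := hY
  obtain ⟨E, T, hE, hT, hTp, hEd, hTd, z0, z1, z2, z3⟩ := hZ
  have s1 := fun i => contDiff_deriv (hU.smooth i)
  have sG := hG.smooth
  have sE := hE.smooth
  have e1 := fun i => contDiff_deriv (hE.smooth i)
  have g1 := fun i => contDiff_deriv (hG.smooth i)
  have eg : ∀ i, g i = deriv (G i) := fun i => funext fun x => (hGd i x).symm
  have eh : ∀ i, h i = deriv (E i) := fun i => funext fun x => (hEd i x).symm
  have hg : ∀ i, ContDiff ℝ ∞ (g i) := fun i => by rw [eg]; exact g1 i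
  have hh : ∀ i, ContDiff ℝ ∞ (h i) := fun i => by rw [eh]; exact e1 i
  have c1 : Continuous fun x => ∑ i, g i x * Z i x := by
    simp only [Fin.sum_univ_four, z0, z1, z2, z3]
    have : Continuous fun x => g 0 x * -(E 2 x + deriv (U 0) x * E 3 x)
        + g 1 x * -(-E 1 x + deriv (U 1) x * E 3 x) + g 2 x * -(E 0 x + deriv (U 2) x * E 3 x)
        + g 3 x * -(T x + deriv (U 3) x * E 3 x) :=
      ContDiff.continuous (𝕜 := ℝ) (n := ∞) (by fun_prop)
    exact this
  have c2 : Continuous fun x => ∑ i, h i x * Y i x := by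
    simp only [Fin.sum_univ_four, y0, y1, y2, y3]
    have : Continuous fun x => h 0 x * -(G 2 x + deriv (U 0) x * G 3 x)
        + h 1 x * -(-G 1 x + deriv (U 1) x * G 3 x) + h 2 x * -(G 0 x + deriv (U 2) x * G 3 x)
        + h 3 x * -(S x + deriv (U 3) x * G 3 x) :=
      ContDiff.continuous (𝕜 := ℝ) (n := ∞) (by fun_prop)
    exact this
  rw [pair, pair, ← intervalIntegral.integral_add (c1.intervalIntegrable _ _)
    (c2.intervalIntegrable _ _)]
  have key : ∀ x, ∑ i, g i x * Z i x + ∑ i, h i x * Y i x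
      = deriv (fun x => -(G 0 x * E 2 x + G 2 x * E 0 x - G 1 x * E 1 x + S x * E 3 x
        + T x * G 3 x)) x := by
    intro x
    have dG := fun i => hG.hasDerivAt i x
    have dE := fun i => hE.hasDerivAt i x
    have dS : HasDerivAt S (deriv S x) x := (hS.differentiable (by simp) x).hasDerivAt
    have dT' : HasDerivAt T (deriv T x) x := (hT.differentiable (by simp) x).hasDerivAt
    rw [((((((dG 0).fun_mul (dE 2)).fun_add ((dG 2).fun_mul (dE 0))).fun_sub
      ((dG 1).fun_mul (dE 1))).fun_add (dS.fun_mul (dE 3))).fun_add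
      (dT'.fun_mul (dG 3))).fun_neg.deriv, hSd, hTd]
    simp only [Fin.sum_univ_four, y0, y1, y2, y3, z0, z1, z2, z3, hGd, hEd]
    ring
  simp_rw [key]
  refine integral_deriv_eq_zero (ContDiff.of_le (n := ∞) (by fun_prop) (by simp)) fun x => ?_
  simp only [fun i => hG.periodic i x, fun i => hE.periodic i x, hSp x, hTp x]

theorem eq_const_of_deriv_eq_zero {S : ℝ → ℝ} (hS : ContDiff ℝ ∞ S) (h : ∀ x, deriv S x = 0)
    (x : ℝ) : S x = S 0 :=
  is_const_of_deriv_eq_zero (hS.differentiable (by simp)) h x 0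

/-- Orthogonality to `U_x` makes `S` constant. Adding that constant to the fourth component leaves
`(-G₂, G₁, -G₀, 0) - G₃ U_x`, whose hats are `-G₂, G₁, -G₀`; `Theta_eq` then returns `g`, the last
component again by orthogonality. -/
theorem Theta_ThetaInv {U g Y : Fld} (hU : IsM U) (hY : ThetaInv U g Y)
    (hg : ∀ x, ∑ i, deriv (U i) x * g i x = 0) :
    ∃ c : ℝ, ∀ x ∈ reg univ U, ∀ i,
      Theta U (Y + fun j _ => if j = 3 then c else 0) i x = g i x := by
  obtain ⟨G, S, hG, hS, hSp, hGd, hSd, y0, y1, y2, y3⟩ := hY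
  have hSc : ∀ x, S x = S 0 := eq_const_of_deriv_eq_zero hS fun x => by rw [hSd, hg]
  refine ⟨S 0, fun x hx => ?_⟩
  set Y' : Fld := Y + fun j _ => if j = 3 then S 0 else 0 with hY'
  have e0 : Y' 0 = fun x => -(G 2 x + deriv (U 0) x * G 3 x) := funext fun x => by
    simp [hY', y0]
  have e1 : Y' 1 = fun x => -(-G 1 x + deriv (U 1) x * G 3 x) := funext fun x => by
    simp [hY', y1]
  have e2 : Y' 2 = fun x => -(G 0 x + deriv (U 2) x * G 3 x) := funext fun x => by
    simp [hY', y2]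
  have e3 : Y' 3 = fun x => -(deriv (U 3) x * G 3 x) := funext fun x => by
    simp [hY', y3, hSc x]
  have s1 := fun i => contDiff_deriv (hU.smooth i)
  have sG := hG.smooth
  have hd : ∀ i, DifferentiableAt ℝ (Y' i) x := by
    intro i
    refine ContDiff.differentiable (n := ∞) ?_ (by simp) x
    fin_cases i
    · change ContDiff ℝ ∞ (Y' 0); rw [e0]; fun_prop
    · change ContDiff ℝ ∞ (Y' 1); rw [e1]; fun_prop
    · change ContDiff ℝ ∞ (Y' 2); rw [e2]; fun_prop
    · change ContDiff ℝ ∞ (Y' 3); rw [e3]; fun_prop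
  have hz : deriv (U 3) x ≠ 0 := hx.1
  have hR := isOpen_reg isOpen_univ hU
  have d0 : deriv (hat U Y' 0) x = - g 2 x := by
    rw [deriv_congr_of_isOpen (g := fun x => - G 2 x) hR ?_ hx]
    · rw [(hG.hasDerivAt 2 x).fun_neg.deriv, hGd]
    · intro y hy
      have hzy : deriv (U 3) y ≠ 0 := hy.1
      simp only [hat, slope, e0, e3]; field_simp; ring
  have d1 : deriv (hat U Y' 1) x = g 1 x := by
    rw [deriv_congr_of_isOpen (g := G 1) hR ?_ hx]
    · rw [hGd]
    · intro y hy
      have hzy : deriv (U 3) y ≠ 0 := hy.1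
      simp only [hat, slope, e1, e3]; field_simp; ring
  have d2 : deriv (hat U Y' 2) x = - g 0 x := by
    rw [deriv_congr_of_isOpen (g := fun x => - G 0 x) hR ?_ hx]
    · rw [(hG.hasDerivAt 0 x).fun_neg.deriv, hGd]
    · intro y hy
      have hzy : deriv (U 3) y ≠ 0 := hy.1
      simp only [hat, slope, e2, e3]; field_simp; ring
  obtain ⟨h0, h1, h2, h3⟩ := Theta_eq isOpen_univ hU hx hd
  rw [d2] at h0 h3
  rw [d1] at h1 h3
  rw [d0] at h2 h3
  rw [neg_neg] at h0 h2
  intro i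
  fin_cases i
  · exact h0
  · exact h1
  · exact h2
  · have := hg x
    rw [Fin.sum_univ_four] at this
    change Theta U Y' 3 x = g 3 x
    rw [h3]
    simp only [slope]
    field_simp
    linarith

/-! ### Variations of the coefficients of `ϑ⁻¹` -/

theorem isM_variation {U c : Fld} (hU : IsM U) (hc : IsM c) (ε : ℝ) : IsM (U + ε • c) :=
  ⟨fun i => (hU.smooth i).add (contDiff_const.mul (hc.smooth i)), fun i x => by
    simp only [variation_apply, hU.periodic i x, hc.periodic i x]⟩

/-- The points `(ε, x)` with `x` in the regular set of `U + ε c`. -/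
def regFamily (D : Set ℝ) (U c : Fld) : Set (ℝ × ℝ) := {p | p.2 ∈ reg D (U + p.1 • c)}

/-- Provides an open set in the `(ε, x)`-plane containing each `(0, x)` with `x` regular, on which
`∂_ε` and `∂_x` commute. -/
theorem isOpen_regFamily {D : Set ℝ} (hD : IsOpen D) {U c : Fld} (hU : IsM U) (hc : IsM c) :
    IsOpen (regFamily D U c) := by
  have s0 := hU.smooth 3
  have s1 := hU.contDiff_deriv 3
  have c0 := hc.smooth 3
  have c1 := hc.contDiff_deriv 3
  have h1 : Continuous fun p : ℝ × ℝ => U 3 p.2 + p.1 * c 3 p.2 :=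
    ContDiff.continuous (𝕜 := ℝ) (n := ∞) (by fun_prop)
  have h2 : Continuous fun p : ℝ × ℝ => deriv (U 3) p.2 + p.1 * deriv (c 3) p.2 :=
    ContDiff.continuous (𝕜 := ℝ) (n := ∞) (by fun_prop)
  have h3 : regFamily D U c = {p : ℝ × ℝ | deriv (U 3) p.2 + p.1 * deriv (c 3) p.2 ≠ 0} ∩
      (fun p : ℝ × ℝ => U 3 p.2 + p.1 * c 3 p.2) ⁻¹' D := by
    ext p
    simp only [regFamily, reg, mem_ofPred_eq, deriv_variation hU.smooth hc.smooth, variation_apply,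
      mem_inter_iff, mem_preimage]
  rw [h3]
  exact (isOpen_ne_fun h2 continuous_const).inter (hD.preimage h1)

theorem mem_regFamily {D : Set ℝ} {U c : Fld} {x : ℝ} (hx : x ∈ reg D U) :
    ((0, x) : ℝ × ℝ) ∈ regFamily D U c := by
  simpa [regFamily] using hx

theorem smoothOn_slope_family {D : Set ℝ} {U c : Fld} (hU : IsM U) (hc : IsM c) (i : Fin 4) :
    SmoothOn (regFamily D U c) fun ε => slope (U + ε • c) i := by
  have s1 := fun i => hU.contDiff_deriv i
  have c1 := fun i => hc.contDiff_deriv i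
  have h : ∀ i, ContDiffOn ℝ ∞ (fun p : ℝ × ℝ => deriv ((U + p.1 • c) i) p.2)
      (regFamily D U c) := fun i => by
    simp only [deriv_variation hU.smooth hc.smooth]
    exact ContDiff.contDiffOn (by fun_prop)
  exact (h i).div (h 3) fun _ hp => hp.1

theorem smoothOn_hat_family {D : Set ℝ} {U c b : Fld} (hU : IsM U) (hc : IsM c) (hb : IsM b)
    (i : Fin 4) : SmoothOn (regFamily D U c) fun ε => hat (U + ε • c) b i := by
  have h : ∀ i, ContDiffOn ℝ ∞ (fun p : ℝ × ℝ => b i p.2) (regFamily D U c) := fun i =>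
    ((hb.smooth i).comp contDiff_snd).contDiffOn
  exact (h i).sub (ContDiffOn.mul (smoothOn_slope_family hU hc i) (h 3))

/-- The variation of the slopes. -/
def slopeVar (U c : Fld) (i : Fin 4) (x : ℝ) : ℝ :=
  (deriv (c i) x - slope U i x * deriv (c 3) x) / deriv (U 3) x

/-- The variation of `hat U b` in the direction `c`. -/
def hatVar (U c b : Fld) (i : Fin 4) (x : ℝ) : ℝ := -(slopeVar U c i x * b 3 x)

theorem hasDerivAt_slope_family {D : Set ℝ} {U c : Fld} (hU : IsM U) (hc : IsM c) {x : ℝ}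
    (hx : x ∈ reg D U) (i : Fin 4) :
    HasDerivAt (fun ε : ℝ => slope (U + ε • c) i x) (slopeVar U c i x) 0 := by
  have hz : deriv (U 3) x ≠ 0 := hx.1
  simp only [slope, deriv_variation hU.smooth hc.smooth]
  refine ((hasDerivAt_affine _ _ 0).fun_div (hasDerivAt_affine _ _ 0) (by simpa using hz)).congr_deriv ?_
  simp only [slopeVar, slope, zero_mul, add_zero]
  field_simp

theorem hasDerivAt_hat_family {D : Set ℝ} {U c : Fld} (hU : IsM U) (hc : IsM c) (b : Fld) {x : ℝ}
    (hx : x ∈ reg D U) (i : Fin 4) :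
    HasDerivAt (fun ε : ℝ => hat (U + ε • c) b i x) (hatVar U c b i x) 0 :=
  ((hasDerivAt_slope_family hU hc hx i).mul_const (b 3 x)).const_sub (b i x)

/-- The mixed derivative of a smooth family whose variation is known. -/
theorem SmoothOn.hasDerivAt_deriv_family {W : Set (ℝ × ℝ)} (hW : IsOpen W) {f : ℝ → ℝ → ℝ}
    (hf : SmoothOn W f) {R : Set ℝ} (hR : IsOpen R) (hRW : ∀ y ∈ R, ((0, y) : ℝ × ℝ) ∈ W)
    {df : ℝ → ℝ} (hdf : ∀ y ∈ R, HasDerivAt (fun ε : ℝ => f ε y) (df y) 0) {x : ℝ} (hx : x ∈ R) :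
    HasDerivAt (fun ε : ℝ => deriv (f ε) x) (deriv df x) 0 := by
  have h1 := (hf.smooth_dX hW).hasDerivAt_t hW (hRW x hx)
  rw [hf.dT_dX hW (hRW x hx)] at h1
  have h2 : dX (dT f) 0 x = deriv df x :=
    deriv_congr_of_isOpen hR (fun y hy => (hdf y hy).deriv) hx
  rwa [h2] at h1

theorem hasDerivAt_deriv_hat_family {D : Set ℝ} (hD : IsOpen D) {U c b : Fld} (hU : IsM U)
    (hc : IsM c) (hb : IsM b) {x : ℝ} (hx : x ∈ reg D U) (i : Fin 4) :
    HasDerivAt (fun ε : ℝ => deriv (hat (U + ε • c) b i) x) (deriv (hatVar U c b i) x) 0 :=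
  (smoothOn_hat_family hU hc hb i).hasDerivAt_deriv_family (isOpen_regFamily hD hU hc)
    (isOpen_reg hD hU) (fun _ hy => mem_regFamily hy)
    (fun _ hy => hasDerivAt_hat_family hU hc b hy i) hx

theorem contDiffOn_slopeVar {D : Set ℝ} {U c : Fld} (hU : IsM U) (hc : IsM c) (i : Fin 4) :
    ContDiffOn ℝ ∞ (slopeVar U c i) (reg D U) :=
  ((hc.contDiff_deriv i).contDiffOn.sub
    ((contDiffOn_slope hU i).mul (hc.contDiff_deriv 3).contDiffOn)).div
    (hU.contDiff_deriv 3).contDiffOn fun _ hx => hx.1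

theorem contDiffOn_hatVar {D : Set ℝ} {U c b : Fld} (hU : IsM U) (hc : IsM c) (hb : IsM b)
    (i : Fin 4) : ContDiffOn ℝ ∞ (hatVar U c b i) (reg D U) :=
  ((contDiffOn_slopeVar hU hc i).mul (hb.smooth 3).contDiffOn).neg

theorem periodic_hatVar {U c b : Fld} (hU : IsM U) (hc : IsM c) (hb : IsM b)
    (i : Fin 4) : Function.Periodic (hatVar U c b i) (2 * Real.pi) := fun x => by
  simp only [hatVar, slopeVar, periodic_slope hU i x, hb.periodic 3 x, periodic_deriv (hc.periodic i) x,
    periodic_deriv (hc.periodic 3) x, periodic_deriv (hU.periodic 3) x]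

theorem hasDerivAt_hat {D : Set ℝ} (hD : IsOpen D) {U b : Fld} (hU : IsM U) (hb : IsM b) {x : ℝ}
    (hx : x ∈ reg D U) (i : Fin 4) : HasDerivAt (hat U b i) (deriv (hat U b i) x) x :=
  hasDerivAt_of_contDiffOn (isOpen_reg hD hU)
    (contDiffOn_hat hU (fun i => (hb.smooth i).contDiffOn) i) hx

theorem hasDerivAt_hatVar {D : Set ℝ} (hD : IsOpen D) {U c b : Fld} (hU : IsM U) (hc : IsM c)
    (hb : IsM b) {x : ℝ} (hx : x ∈ reg D U) (i : Fin 4) :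
    HasDerivAt (hatVar U c b i) (deriv (hatVar U c b i) x) x :=
  hasDerivAt_of_contDiffOn (isOpen_reg hD hU) (contDiffOn_hatVar hU hc hb i) hx

/-- Trades `c_i'` and `c_3'` for the derivative of the hat and an undifferentiated `c_3`; in this
form the terms of the cyclic sums match. -/
theorem slopeVar_eq {D : Set ℝ} (hD : IsOpen D) {U c : Fld} (hU : IsM U) (hc : IsM c) {x : ℝ}
    (hx : x ∈ reg D U) (i : Fin 4) :
    slopeVar U c i x
      = (deriv (hat U c i) x + deriv (slope U i) x * c 3 x) / deriv (U 3) x := by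
  have hs := hasDerivAt_of_contDiffOn (isOpen_reg hD hU) (contDiffOn_slope hU i) hx
  have h : deriv (hat U c i) x = _ :=
    ((hc.hasDerivAt i x).fun_sub (hs.fun_mul (hc.hasDerivAt 3 x))).deriv
  rw [h, slopeVar]
  ring

/-! ### `ϑ⁻¹` is co-implectic -/

/-- The last row contributes exactly the slope terms that turn `a` into its hat, leaving a form in
hats with constant symmetric coefficients. -/
theorem sum_mul_Theta {D : Set ℝ} (hD : IsOpen D) {U b : Fld} (hU : IsM U) (hb : IsM b) {x : ℝ}
    (hx : x ∈ reg D U) (a : Fld) :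
    ∑ i, a i x * Theta U b i x = - (hat U a 0 x * deriv (hat U b 2) x)
      + hat U a 1 x * deriv (hat U b 1) x - hat U a 2 x * deriv (hat U b 0) x := by
  obtain ⟨h0, h1, h2, h3⟩ := Theta_eq hD hU hx (Y := b) fun i => (hb.hasDerivAt i x).differentiableAt
  rw [Fin.sum_univ_four, h0, h1, h2, h3]
  simp only [hat]
  ring

/-- Product rule applied to `sum_mul_Theta`: with `a` and `b` fixed, `U` enters only through the
slopes, hence through both hats. -/
theorem sum_mul_opDeriv_Theta {D : Set ℝ} (hD : IsOpen D) {U b c : Fld} (hU : IsM U) (hb : IsM b)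
    (hc : IsM c) {x : ℝ} (hx : x ∈ reg D U) (a : Fld) :
    ∑ i, a i x * opDeriv Theta U c b i x
      = (- (hat U a 0 x * deriv (hatVar U c b 2) x) + hat U a 1 x * deriv (hatVar U c b 1) x
          - hat U a 2 x * deriv (hatVar U c b 0) x)
        + (- (hatVar U c a 0 x * deriv (hat U b 2) x) + hatVar U c a 1 x * deriv (hat U b 1) x
          - hatVar U c a 2 x * deriv (hat U b 0) x) := by
  have hev := eventually_slice_t (isOpen_regFamily hD hU hc) (mem_regFamily hx)
  have hT : ∀ᶠ ε in nhds (0 : ℝ), _ := hev.mono fun ε hε =>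
    Theta_eq hD (isM_variation hU hc ε) hε (Y := b) fun i => (hb.hasDerivAt i x).differentiableAt
  have hh := hasDerivAt_deriv_hat_family hD hU hc hb hx
  have hs := hasDerivAt_slope_family hU hc hx
  have e0 : opDeriv Theta U c b 0 x = - deriv (hatVar U c b 2) x :=
    ((hh 2).fun_neg.congr_of_eventuallyEq (hT.mono fun ε h => h.1)).deriv
  have e1 : opDeriv Theta U c b 1 x = deriv (hatVar U c b 1) x :=
    ((hh 1).congr_of_eventuallyEq (hT.mono fun ε h => h.2.1)).deriv
  have e2 : opDeriv Theta U c b 2 x = - deriv (hatVar U c b 0) x :=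
    ((hh 0).fun_neg.congr_of_eventuallyEq (hT.mono fun ε h => h.2.2.1)).deriv
  have e3 : opDeriv Theta U c b 3 x = _ :=
    (((((hs 0).fun_mul (hh 2)).fun_sub ((hs 1).fun_mul (hh 1))).fun_add
      ((hs 2).fun_mul (hh 0))).congr_of_eventuallyEq (hT.mono fun ε h => h.2.2.2)).deriv
  rw [Fin.sum_univ_four, e0, e1, e2, e3]
  simp only [zero_smul, add_zero, hat, hatVar]
  ring

theorem isSkew_Theta : IsSkew Theta (reg univ) := by
  intro U hU a b ha hb
  have hR := isOpen_reg isOpen_univ hU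
  have ha' := fun i => contDiffOn_hat (D := univ) hU (fun i => (ha.1.smooth i).contDiffOn) i
  have hb' := fun i => contDiffOn_hat (D := univ) hU (fun i => (hb.1.smooth i).contDiffOn) i
  have hcont : ∀ {a b : Fld}, IsM a → IsM b →
      ContinuousOn (fun x => ∑ i, a i x * Theta U b i x) (reg univ U) := by
    intro a b ha hb
    have ha' := fun i => contDiffOn_hat (D := univ) hU (fun i => (ha.smooth i).contDiffOn) i
    have hb' := fun i => contDiffOn_deriv hR
      (contDiffOn_hat (D := univ) hU (fun i => (hb.smooth i).contDiffOn) i)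
    refine ContinuousOn.congr (ContDiffOn.continuousOn (𝕜 := ℝ) (n := ∞) ?_)
      fun x hx => sum_mul_Theta isOpen_univ hU hb hx a
    exact (((ha' 0).mul (hb' 2)).neg.add ((ha' 1).mul (hb' 1))).sub ((ha' 2).mul (hb' 0))
  -- Skewness has only two integrands, so the third is taken to be zero and `b` is repeated in the
  -- joint support.
  have h := integral_add_add_eq_zero
    (F := fun x => - (hat U a 0 x * hat U b 2 x) + hat U a 1 x * hat U b 1 x
      - hat U a 2 x * hat U b 0 x) (f₃ := fun _ => 0) hR (isClosed_jointSupport a b b)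
    (jointSupport_subset ha hb hb)
    ((((ha' 0).mul (hb' 2)).neg.add ((ha' 1).mul (hb' 1))).sub ((ha' 2).mul (hb' 0)))
    (hcont ha.1 hb.1) (hcont hb.1 ha.1) continuousOn_const ?_ ?_ ?_ ?_ (fun _ _ => rfl) ?_
  · simpa [pair] using h
  · intro x hx
    have da := fun i => hasDerivAt_hat isOpen_univ hU ha.1 hx i
    have db := fun i => hasDerivAt_hat isOpen_univ hU hb.1 hx i
    refine ((((da 0).fun_mul (db 2)).fun_neg.fun_add ((da 1).fun_mul (db 1))).fun_sub
      ((da 2).fun_mul (db 0))).congr_deriv ?_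
    rw [sum_mul_Theta isOpen_univ hU hb.1 hx, sum_mul_Theta isOpen_univ hU ha.1 hx]
    ring
  · intro x hx
    have h0 := eq_zero_of_notMem_jointSupport hx
    simp only [hat, (h0 _).1, (h0 _).2.1]
    ring
  · intro x hx
    simp only [(eq_zero_of_notMem_jointSupport hx _).1, zero_mul, Finset.sum_const_zero]
  · intro x hx
    simp only [(eq_zero_of_notMem_jointSupport hx _).2.1, zero_mul, Finset.sum_const_zero]
  · intro x
    simp only [periodic_hat hU ha.1 _ x, periodic_hat hU hb.1 _ x]

/-- Integrating the derivative of each variation by parts leaves terms `a₃ ⟨b̂', ĉ'⟩ / z_x` and `a₃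
b₃ ⟨s', ĉ'⟩ / z_x` and their permutations, where `s` are the slopes. The form is symmetric, so they
cancel in pairs under cyclic relabelling. -/
theorem isCoImplectic_Theta : IsCoImplectic Theta (reg univ) := by
  refine ⟨isSkew_Theta, fun U hU a b c ha hb hc => ?_⟩
  have hR := isOpen_reg isOpen_univ hU
  have hat' : ∀ {a : Fld}, IsM a → ∀ i, ContDiffOn ℝ ∞ (hat U a i) (reg univ U) :=
    fun ha i => contDiffOn_hat hU (fun i => (ha.smooth i).contDiffOn) i
  have hcont : ∀ {a b c : Fld}, IsM a → IsM b → IsM c →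
      ContinuousOn (fun x => ∑ i, a i x * opDeriv Theta U c b i x) (reg univ U) := by
    intro a b c ha hb hc
    have sa := hat' ha
    have sb := fun i => contDiffOn_deriv hR (hat' hb i)
    have da := contDiffOn_hatVar (D := univ) hU hc ha
    have db := fun i => contDiffOn_deriv hR (contDiffOn_hatVar (D := univ) hU hc hb i)
    refine ContinuousOn.congr (ContDiffOn.continuousOn (𝕜 := ℝ) (n := ∞) ?_)
      fun x hx => sum_mul_opDeriv_Theta isOpen_univ hU hb hc hx a
    exact ((((sa 0).mul (db 2)).neg.add ((sa 1).mul (db 1))).sub ((sa 2).mul (db 0))).add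
      ((((da 0).mul (sb 2)).neg.add ((da 1).mul (sb 1))).sub ((da 2).mul (sb 0)))
  set T : Fld → Fld → Fld → ℝ → ℝ := fun a b c x => - (hat U a 0 x * hatVar U c b 2 x)
    + hat U a 1 x * hatVar U c b 1 x - hat U a 2 x * hatVar U c b 0 x with hT
  have hTs : ∀ {a b c : Fld}, IsM a → IsM b → IsM c → ContDiffOn ℝ ∞ (T a b c) (reg univ U) := by
    intro a b c ha hb hc
    have sa := hat' ha
    have db := contDiffOn_hatVar (D := univ) hU hc hb
    exact ((((sa 0).mul (db 2)).neg.add ((sa 1).mul (db 1))).sub ((sa 2).mul (db 0)))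
  have hTd : ∀ {a b c : Fld}, IsM a → IsM b → IsM c → ∀ x ∈ reg univ U,
      HasDerivAt (T a b c) (- (deriv (hat U a 0) x * hatVar U c b 2 x
          + hat U a 0 x * deriv (hatVar U c b 2) x)
        + (deriv (hat U a 1) x * hatVar U c b 1 x + hat U a 1 x * deriv (hatVar U c b 1) x)
        - (deriv (hat U a 2) x * hatVar U c b 0 x + hat U a 2 x * deriv (hatVar U c b 0) x)) x := by
    intro a b c ha hb hc x hx
    have da := fun i => hasDerivAt_hat isOpen_univ hU ha hx i
    have db := fun i => hasDerivAt_hatVar isOpen_univ hU hc hb hx i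
    exact (((da 0).fun_mul (db 2)).fun_neg.fun_add ((da 1).fun_mul (db 1))).fun_sub
      ((da 2).fun_mul (db 0))
  refine integral_add_add_eq_zero (F := fun x => T a b c x + T b c a x + T c a b x) hR
    (isClosed_jointSupport a b c) (jointSupport_subset ha hb hc)
    (((hTs ha.1 hb.1 hc.1).add (hTs hb.1 hc.1 ha.1)).add (hTs hc.1 ha.1 hb.1))
    (hcont ha.1 hb.1 hc.1) (hcont hb.1 hc.1 ha.1) (hcont hc.1 ha.1 hb.1) ?_ ?_ ?_ ?_ ?_ ?_
  · intro x hx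
    refine (((hTd ha.1 hb.1 hc.1 x hx).fun_add (hTd hb.1 hc.1 ha.1 x hx)).fun_add
      (hTd hc.1 ha.1 hb.1 x hx)).congr_deriv ?_
    rw [sum_mul_opDeriv_Theta isOpen_univ hU hb.1 hc.1 hx,
      sum_mul_opDeriv_Theta isOpen_univ hU hc.1 ha.1 hx,
      sum_mul_opDeriv_Theta isOpen_univ hU ha.1 hb.1 hx]
    simp only [hatVar, slopeVar_eq isOpen_univ hU ha.1 hx, slopeVar_eq isOpen_univ hU hb.1 hx,
      slopeVar_eq isOpen_univ hU hc.1 hx]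
    ring
  · intro x hx
    have h0 := eq_zero_of_notMem_jointSupport hx
    simp only [hT, hat, hatVar, (h0 _).1, (h0 _).2.1, (h0 _).2.2]
    ring
  · intro x hx
    simp only [(eq_zero_of_notMem_jointSupport hx _).1, zero_mul, Finset.sum_const_zero]
  · intro x hx
    simp only [(eq_zero_of_notMem_jointSupport hx _).2.1, zero_mul, Finset.sum_const_zero]
  · intro x hx
    simp only [(eq_zero_of_notMem_jointSupport hx _).2.2, zero_mul, Finset.sum_const_zero]
  · intro x
    simp only [hT, periodic_hat hU ha.1 _ x, periodic_hat hU hb.1 _ x, periodic_hat hU hc.1 _ x,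
      periodic_hatVar hU hc.1 hb.1 _ x, periodic_hatVar hU ha.1 hc.1 _ x, periodic_hatVar hU hb.1 ha.1 _ x]

/-! ### The operators `η_φ` are implectic -/

/-- The coefficient `φ(z) / z_x`. -/
def etaCoeff (φ : ℝ → ℝ) (U : Fld) (x : ℝ) : ℝ := φ (U 3 x) / deriv (U 3) x

/-- The derivative of `etaCoeff φ` at `U` in the direction `Y`. -/
def etaCoeffVar (φ : ℝ → ℝ) (U Y : Fld) (x : ℝ) : ℝ :=
  deriv φ (U 3 x) * Y 3 x / deriv (U 3) x - φ (U 3 x) * deriv (Y 3) x / deriv (U 3) x ^ 2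

section

variable {φ : ℝ → ℝ} {D : Set ℝ} {U Y : Fld} {x : ℝ}

theorem contDiffOn_etaCoeff (hφ : ContDiffOn ℝ ∞ φ D) (hU : IsM U) :
    ContDiffOn ℝ ∞ (etaCoeff φ U) (reg D U) :=
  (hφ.comp (hU.smooth 3).contDiffOn fun _ hx => hx.2).div (hU.contDiff_deriv 3).contDiffOn
    fun _ hx => hx.1

/-- In the Jacobi identity the direction is `η b`, known to be differentiable only at regular
points, so a pointwise hypothesis replaces global smoothness. -/
theorem deriv_variation_apply {i : Fin 4} (hU : IsM U) (hY : DifferentiableAt ℝ (Y i) x) (ε : ℝ) :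
    deriv ((U + ε • Y) i) x = deriv (U i) x + ε * deriv (Y i) x :=
  ((hU.hasDerivAt i x).fun_add (hY.hasDerivAt.const_mul ε)).deriv

theorem hasDerivAt_etaCoeff_family (hD : IsOpen D) (hφ : ContDiffOn ℝ ∞ φ D) (hU : IsM U)
    (hx : x ∈ reg D U) (hY : DifferentiableAt ℝ (Y 3) x) :
    HasDerivAt (fun ε : ℝ => etaCoeff φ (U + ε • Y) x) (etaCoeffVar φ U Y x) 0 := by
  have hz : deriv (U 3) x ≠ 0 := hx.1
  simp only [etaCoeff, deriv_variation_apply hU hY, variation_apply]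
  have h1 : HasDerivAt φ (deriv φ (U 3 x)) (U 3 x + 0 * Y 3 x) := by
    simpa using hasDerivAt_of_contDiffOn hD hφ hx.2
  refine ((h1.comp 0 (hasDerivAt_affine (U 3 x) (Y 3 x) 0)).fun_div
    (hasDerivAt_affine _ _ 0) (by simpa using hz)).congr_deriv ?_
  simp only [etaCoeffVar, Function.comp, zero_mul, add_zero]
  field_simp

theorem hasDerivAt_etaCoeff (hD : IsOpen D) (hφ : ContDiffOn ℝ ∞ φ D) (hU : IsM U)
    (hx : x ∈ reg D U) :
    HasDerivAt (etaCoeff φ U)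
      (deriv φ (U 3 x) - φ (U 3 x) * deriv (deriv (U 3)) x / deriv (U 3) x ^ 2) x := by
  have hz : deriv (U 3) x ≠ 0 := hx.1
  refine (((hasDerivAt_of_contDiffOn hD hφ hx.2).comp x (hU.hasDerivAt 3 x)).fun_div
    (hU.hasDerivAt_deriv 3 x) hz).congr_deriv ?_
  simp only [Function.comp]
  field_simp

/-- The skew form of `η_φ`, up to the factor `φ(z) / z_x`. -/
def etaForm (U a c : Fld) (x : ℝ) : ℝ :=
  a 0 x * c 1 x - a 1 x * c 0 x + deriv (U 0) x * (a 0 x * c 2 x - a 2 x * c 0 x)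
    + deriv (U 1) x * (a 1 x * c 2 x - a 2 x * c 1 x)
    + deriv (U 3) x * (a 3 x * c 2 x - a 2 x * c 3 x)

theorem sum_mul_eta (φ : ℝ → ℝ) (U a c : Fld) (x : ℝ) :
    ∑ i, a i x * eta φ U c i x = etaCoeff φ U x * etaForm U a c x := by
  simp only [Fin.sum_univ_four, eta, Matrix.cons_val, etaForm, etaCoeff]
  ring

/-- The matrix is skew at every point, so neither support conditions nor integration by parts are
needed. -/
theorem isSkew_eta (φ : ℝ → ℝ) (R : Fld → Set ℝ) : IsSkew (eta φ) R := by
  intro U _ a b _ _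
  have h : ∀ x, ∑ i, b i x * eta φ U a i x = - ∑ i, a i x * eta φ U b i x := fun x => by
    rw [sum_mul_eta, sum_mul_eta]
    simp only [etaForm]
    ring
  rw [pair, pair]
  simp_rw [h]
  rw [intervalIntegral.integral_neg, add_neg_cancel]

/-- The coefficients involve `z, u_x, v_x, z_x` but not `w_x`, so component `2` of the direction
drops out. -/
theorem sum_mul_opDeriv_eta (hD : IsOpen D) (hφ : ContDiffOn ℝ ∞ φ D) (hU : IsM U)
    (hx : x ∈ reg D U) (hY : ∀ i, DifferentiableAt ℝ (Y i) x) (a c : Fld) :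
    ∑ i, a i x * opDeriv (eta φ) U Y c i x = etaCoeffVar φ U Y x * etaForm U a c x
      + etaCoeff φ U x * (deriv (Y 0) x * (a 0 x * c 2 x - a 2 x * c 0 x)
        + deriv (Y 1) x * (a 1 x * c 2 x - a 2 x * c 1 x)
        + deriv (Y 3) x * (a 3 x * c 2 x - a 2 x * c 3 x)) := by
  have hk := hasDerivAt_etaCoeff_family hD hφ hU hx (hY 3)
  have hd : ∀ i, HasDerivAt (fun ε : ℝ => deriv ((U + ε • Y) i) x) (deriv (Y i) x) 0 := fun i => by
    simp only [deriv_variation_apply hU (hY i)]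
    exact hasDerivAt_affine _ _ 0
  have e0 : opDeriv (eta φ) U Y c 0 x = _ :=
    (hk.fun_mul (((hd 0).mul_const (c 2 x)).const_add (c 1 x))).deriv
  have e1 : opDeriv (eta φ) U Y c 1 x = _ :=
    (hk.fun_mul (((hd 1).mul_const (c 2 x)).const_add (- c 0 x))).deriv
  have e2 : opDeriv (eta φ) U Y c 2 x = _ :=
    (hk.fun_mul ((((hd 0).mul_const (c 0 x)).fun_add ((hd 1).mul_const (c 1 x))).fun_add
      ((hd 3).mul_const (c 3 x)))).fun_neg.deriv
  have e3 : opDeriv (eta φ) U Y c 3 x = _ :=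
    (hk.fun_mul ((hd 3).mul_const (c 2 x))).deriv
  rw [Fin.sum_univ_four, e0, e1, e2, e3]
  simp only [zero_smul, add_zero, etaForm]
  ring

theorem contDiffOn_eta (hφ : ContDiffOn ℝ ∞ φ D) (hU : IsM U) {g : Fld}
    (hg : ∀ i, ContDiffOn ℝ ∞ (g i) (reg D U)) (i : Fin 4) :
    ContDiffOn ℝ ∞ (eta φ U g i) (reg D U) := by
  have hk := contDiffOn_etaCoeff hφ hU
  have s1 := fun i => (hU.contDiff_deriv i).contDiffOn (s := reg D U)
  fin_cases i
  · exact hk.mul ((hg 1).add ((s1 0).mul (hg 2)))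
  · exact hk.mul ((hg 0).neg.add ((s1 1).mul (hg 2)))
  · exact (hk.mul ((((s1 0).mul (hg 0)).add ((s1 1).mul (hg 1))).add ((s1 3).mul (hg 3)))).neg
  · exact hk.mul ((s1 3).mul (hg 2))

theorem contDiffOn_etaForm {a c : Fld} (hU : IsM U) (ha : IsM a) (hc : IsM c) :
    ContDiffOn ℝ ∞ (etaForm U a c) (reg D U) := by
  have s1 := fun i => (hU.contDiff_deriv i).contDiffOn (s := reg D U)
  have sa := fun i => (ha.smooth i).contDiffOn (s := reg D U)
  have sc := fun i => (hc.smooth i).contDiffOn (s := reg D U)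
  have m : ∀ i j, ContDiffOn ℝ ∞ (fun x => a i x * c j x - a j x * c i x) (reg D U) :=
    fun i j => ((sa i).mul (sc j)).sub ((sa j).mul (sc i))
  exact (((m 0 1).add ((s1 0).mul (m 0 2))).add ((s1 1).mul (m 1 2))).add ((s1 3).mul (m 3 2))

end

theorem isImplectic_eta {φ : ℝ → ℝ} {D : Set ℝ} (hD : IsOpen D) (hφ : ContDiffOn ℝ ∞ φ D) :
    IsImplectic (eta φ) (reg D) := by
  refine ⟨isSkew_eta φ _, fun U hU a b c ha hb hc => ?_⟩
  have hR := isOpen_reg hD hU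
  have hk := contDiffOn_etaCoeff hφ hU
  have hY : ∀ {b : Fld}, IsM b → ∀ i, ContDiffOn ℝ ∞ (eta φ U b i) (reg D U) :=
    fun hb i => contDiffOn_eta hφ hU (fun i => (hb.smooth i).contDiffOn) i
  have hYd : ∀ {b : Fld}, IsM b → ∀ x ∈ reg D U, ∀ i, DifferentiableAt ℝ (eta φ U b i) x :=
    fun hb x hx i => (hasDerivAt_of_contDiffOn hR (hY hb i) hx).differentiableAt
  have s1 := fun i => (hU.contDiff_deriv i).contDiffOn (s := reg D U)
  have m : ∀ {a c : Fld}, IsM a → IsM c → ∀ i j,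
      ContDiffOn ℝ ∞ (fun x => a i x * c j x - a j x * c i x) (reg D U) :=
    fun ha hc i j => (((ha.smooth i).mul (hc.smooth j)).sub
      ((ha.smooth j).mul (hc.smooth i))).contDiffOn
  have hv : ∀ {b : Fld}, IsM b → ContDiffOn ℝ ∞ (etaCoeffVar φ U (eta φ U b)) (reg D U) := by
    intro b hb
    have h1 : ContDiffOn ℝ ∞ (fun x => deriv φ (U 3 x)) (reg D U) :=
      (contDiffOn_deriv hD hφ).comp (hU.smooth 3).contDiffOn fun _ hx => hx.2
    have h2 : ContDiffOn ℝ ∞ (fun x => φ (U 3 x)) (reg D U) :=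
      hφ.comp (hU.smooth 3).contDiffOn fun _ hx => hx.2
    exact ((h1.mul (hY hb 3)).div (s1 3) fun _ hx => hx.1).sub
      ((h2.mul (contDiffOn_deriv hR (hY hb 3))).div ((s1 3).pow 2) fun _ hx => pow_ne_zero 2 hx.1)
  have hcont : ∀ {a b c : Fld}, IsM a → IsM b → IsM c →
      ContinuousOn (fun x => ∑ i, a i x * opDeriv (eta φ) U (eta φ U b) c i x) (reg D U) := by
    intro a b c ha hb hc
    have m := m ha hc
    have y := fun i => contDiffOn_deriv hR (hY hb i)
    refine ContinuousOn.congr (ContDiffOn.continuousOn (𝕜 := ℝ) (n := ∞) ?_)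
      fun x hx => sum_mul_opDeriv_eta hD hφ hU hx (hYd hb x hx) a c
    exact ((hv hb).mul (contDiffOn_etaForm hU ha hc)).add (hk.mul
      ((((y 0).mul (m 0 2)).add ((y 1).mul (m 1 2))).add ((y 3).mul (m 3 2))))
  -- The flux comes from the first term of the cyclic sum by replacing each derivative of `η b` by
  -- `η b` itself. The term with `etaCoeff²` comes from the derivative of its fourth component
  -- inside `etaCoeffVar`, since `(η b)₃ / z_x = etaCoeff * b₂`.
  refine integral_add_add_eq_zero (F := fun x => etaCoeff φ U x * (eta φ U b 0 x *
      (a 0 x * c 2 x - a 2 x * c 0 x) + eta φ U b 1 x * (a 1 x * c 2 x - a 2 x * c 1 x)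
      + eta φ U b 3 x * (a 3 x * c 2 x - a 2 x * c 3 x))
      - etaCoeff φ U x ^ 2 * b 2 x * etaForm U a c x) hR
    (isClosed_jointSupport a b c) (jointSupport_subset ha hb hc) ?_
    (hcont ha.1 hb.1 hc.1) (hcont hb.1 hc.1 ha.1) (hcont hc.1 ha.1 hb.1) ?_ ?_ ?_ ?_ ?_ ?_
  · have m := m ha.1 hc.1
    have y := hY hb.1
    exact (hk.mul ((((y 0).mul (m 0 2)).add ((y 1).mul (m 1 2))).add ((y 3).mul (m 3 2)))).sub
      (((hk.pow 2).mul (hb.1.smooth 2).contDiffOn).mul (contDiffOn_etaForm hU ha.1 hc.1))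
  · intro x hx
    have hz : deriv (U 3) x ≠ 0 := hx.1
    have k' := hasDerivAt_etaCoeff hD hφ hU hx
    have du := fun i => hU.hasDerivAt_deriv i x
    have da := fun i => ha.1.hasDerivAt i x
    have db := fun i => hb.1.hasDerivAt i x
    have dc := fun i => hc.1.hasDerivAt i x
    have y0 : ∀ {b : Fld}, IsM b → HasDerivAt (eta φ U b 0) _ x := fun hb =>
      k'.fun_mul ((hb.hasDerivAt 1 x).fun_add ((du 0).fun_mul (hb.hasDerivAt 2 x)))
    have y1 : ∀ {b : Fld}, IsM b → HasDerivAt (eta φ U b 1) _ x := fun hb =>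
      k'.fun_mul ((hb.hasDerivAt 0 x).fun_neg.fun_add ((du 1).fun_mul (hb.hasDerivAt 2 x)))
    have y3 : ∀ {b : Fld}, IsM b → HasDerivAt (eta φ U b 3) _ x := fun hb =>
      k'.fun_mul ((du 3).fun_mul (hb.hasDerivAt 2 x))
    have w := fun i j => ((da i).fun_mul (dc j)).fun_sub ((da j).fun_mul (dc i))
    have dm := (((w 0 1).fun_add ((du 0).fun_mul (w 0 2))).fun_add
      ((du 1).fun_mul (w 1 2))).fun_add ((du 3).fun_mul (w 3 2))
    refine ((k'.fun_mul ((((y0 hb.1).fun_mul (w 0 2)).fun_add ((y1 hb.1).fun_mul (w 1 2))).fun_add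
      ((y3 hb.1).fun_mul (w 3 2)))).fun_sub
      (((k'.fun_pow 2).fun_mul (db 2)).fun_mul dm)).congr_deriv ?_
    rw [sum_mul_opDeriv_eta hD hφ hU hx (hYd hb.1 x hx),
      sum_mul_opDeriv_eta hD hφ hU hx (hYd hc.1 x hx),
      sum_mul_opDeriv_eta hD hφ hU hx (hYd ha.1 x hx)]
    simp only [etaCoeffVar, (y0 ha.1).deriv, (y0 hb.1).deriv, (y0 hc.1).deriv, (y1 ha.1).deriv,
      (y1 hb.1).deriv, (y1 hc.1).deriv, (y3 ha.1).deriv, (y3 hb.1).deriv, (y3 hc.1).deriv, etaForm]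
    simp only [eta, Matrix.cons_val, etaCoeff, Nat.cast_ofNat, Nat.add_one_sub_one, pow_one]
    field_simp
    ring
  · intro x hx
    have h0 := eq_zero_of_notMem_jointSupport hx
    simp only [etaForm, (h0 _).1, (h0 _).2.1, (h0 _).2.2]
    ring
  · intro x hx
    simp only [(eq_zero_of_notMem_jointSupport hx _).1, zero_mul, Finset.sum_const_zero]
  · intro x hx
    simp only [(eq_zero_of_notMem_jointSupport hx _).2.1, zero_mul, Finset.sum_const_zero]
  · intro x hx
    simp only [(eq_zero_of_notMem_jointSupport hx _).2.2, zero_mul, Finset.sum_const_zero]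
  · intro x
    simp only [etaCoeff, etaForm, eta, Matrix.cons_val, hU.periodic _ x, ha.1.periodic _ x, hb.1.periodic _ x,
      hc.1.periodic _ x, periodic_deriv (hU.periodic _) x]

/-! ### Compatibility of `η_φ` with `ϑ⁻¹` -/

/-- The components `0, 1` of `η_φ ϑ⁻¹ Y` at fixed `z`, with the indices shifted. -/
def momentum (φ : ℝ → ℝ) (U Y : Fld) (i : Fin 4) (x : ℝ) : ℝ :=
  etaCoeff φ U x * deriv (hat U Y i) x

/-- The variation of `momentum φ U b` in the direction `c`. -/
def momentumVar (φ : ℝ → ℝ) (U c b : Fld) (i : Fin 4) (x : ℝ) : ℝ :=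
  etaCoeffVar φ U c x * deriv (hat U b i) x + etaCoeff φ U x * deriv (hatVar U c b i) x

section

variable {φ : ℝ → ℝ} {D : Set ℝ} {U Y a b c : Fld} {x : ℝ}

theorem contDiffOn_Theta (hD : IsOpen D) (hU : IsM U) (hY : IsM Y) (i : Fin 4) :
    ContDiffOn ℝ ∞ (Theta U Y i) (reg D U) := by
  have h := fun x (hx : x ∈ reg D U) =>
    Theta_eq hD hU hx (Y := Y) fun i => (hY.hasDerivAt i x).differentiableAt
  have d := fun i => contDiffOn_deriv (isOpen_reg hD hU)
    (contDiffOn_hat (D := D) hU (fun i => (hY.smooth i).contDiffOn) i)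
  have s := fun i => contDiffOn_slope (D := D) hU i
  fin_cases i
  · exact (d 2).neg.congr fun x hx => (h x hx).1
  · exact (d 1).congr fun x hx => (h x hx).2.1
  · exact (d 0).neg.congr fun x hx => (h x hx).2.2.1
  · exact ((((s 0).mul (d 2)).sub ((s 1).mul (d 1))).add ((s 2).mul (d 0))).congr
      fun x hx => (h x hx).2.2.2

/-- On hats, `η_φ` sends `g` to `φ/z_x` times `(g₁, -g₀, -Σ (U_i)_x g_i)`; the last entry vanishes
on the range of `ϑ⁻¹`. -/
theorem hat_eta_Theta (hD : IsOpen D) (hU : IsM U) (hY : IsM Y) (hx : x ∈ reg D U) :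
    hat U (eta φ U (Theta U Y)) 0 x = momentum φ U Y 1 x ∧
    hat U (eta φ U (Theta U Y)) 1 x = momentum φ U Y 2 x ∧
    hat U (eta φ U (Theta U Y)) 2 x = 0 := by
  have hz : deriv (U 3) x ≠ 0 := hx.1
  have hd := fun i => (hY.hasDerivAt i x).differentiableAt
  obtain ⟨h0, h1, -, -⟩ := Theta_eq hD hU hx hd
  have hs := sum_deriv_mul_Theta hD hU hx hd
  have e1 : hat U (eta φ U (Theta U Y)) 0 x = etaCoeff φ U x * Theta U Y 1 x := by
    simp only [hat, slope, eta, Matrix.cons_val, etaCoeff]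
    field_simp
    ring
  have e2 : hat U (eta φ U (Theta U Y)) 1 x = - (etaCoeff φ U x * Theta U Y 0 x) := by
    simp only [hat, slope, eta, Matrix.cons_val, etaCoeff]
    field_simp
    ring
  have e3 : hat U (eta φ U (Theta U Y)) 2 x
      = - (etaCoeff φ U x * ∑ i, deriv (U i) x * Theta U Y i x) := by
    simp only [hat, slope, eta, Matrix.cons_val, etaCoeff, Fin.sum_univ_four]
    field_simp
    ring
  refine ⟨by rw [e1, h1, momentum], by rw [e2, h0, momentum]; ring, ?_⟩
  rw [e3, hs, mul_zero, neg_zero]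

theorem Theta_eta_Theta_eq (hD : IsOpen D) (hφ : ContDiffOn ℝ ∞ φ D) (hU : IsM U) (hY : IsM Y)
    (hx : x ∈ reg D U) :
    Theta U (eta φ U (Theta U Y)) 0 x = 0 ∧
    Theta U (eta φ U (Theta U Y)) 1 x = deriv (momentum φ U Y 2) x ∧
    Theta U (eta φ U (Theta U Y)) 2 x = - deriv (momentum φ U Y 1) x ∧
    Theta U (eta φ U (Theta U Y)) 3 x = - (slope U 1 x * deriv (momentum φ U Y 2) x)
      + slope U 2 x * deriv (momentum φ U Y 1) x := by
  have hR := isOpen_reg hD hU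
  obtain ⟨h0, h1, h2, h3⟩ := Theta_eq hD hU hx (Y := eta φ U (Theta U Y)) fun i =>
    (hasDerivAt_of_contDiffOn hR
      (contDiffOn_eta hφ hU (fun i => contDiffOn_Theta hD hU hY i) i) hx).differentiableAt
  have d0 : deriv (hat U (eta φ U (Theta U Y)) 0) x = deriv (momentum φ U Y 1) x :=
    deriv_congr_of_isOpen hR (fun y hy => (hat_eta_Theta hD hU hY hy).1) hx
  have d1 : deriv (hat U (eta φ U (Theta U Y)) 1) x = deriv (momentum φ U Y 2) x :=
    deriv_congr_of_isOpen hR (fun y hy => (hat_eta_Theta hD hU hY hy).2.1) hx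
  have d2 : deriv (hat U (eta φ U (Theta U Y)) 2) x = 0 := by
    rw [deriv_congr_of_isOpen (g := fun _ => 0) hR
      (fun y hy => (hat_eta_Theta hD hU hY hy).2.2) hx, deriv_const]
  rw [d2] at h0 h3
  rw [d1] at h1 h3
  rw [d0] at h2 h3
  exact ⟨by rw [h0, neg_zero], h1, h2, by rw [h3]; ring⟩

/-- After one integration by parts the form is `-∫ (φ/z_x) (â₁' b̂₂' - â₂' b̂₁')`, visibly
antisymmetric. -/
theorem sum_mul_Theta_eta_Theta (hD : IsOpen D) (hφ : ContDiffOn ℝ ∞ φ D) (hU : IsM U)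
    (hb : IsM b) (hx : x ∈ reg D U) (a : Fld) :
    ∑ i, a i x * Theta U (eta φ U (Theta U b)) i x
      = hat U a 1 x * deriv (momentum φ U b 2) x - hat U a 2 x * deriv (momentum φ U b 1) x := by
  obtain ⟨h0, h1, h2, h3⟩ := Theta_eta_Theta_eq hD hφ hU hb hx
  rw [Fin.sum_univ_four, h0, h1, h2, h3]
  simp only [hat]
  ring

theorem contDiffOn_momentum (hD : IsOpen D) (hφ : ContDiffOn ℝ ∞ φ D) (hU : IsM U) (hY : IsM Y)
    (i : Fin 4) : ContDiffOn ℝ ∞ (momentum φ U Y i) (reg D U) :=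
  (contDiffOn_etaCoeff hφ hU).mul (contDiffOn_deriv (isOpen_reg hD hU)
    (contDiffOn_hat hU (fun i => (hY.smooth i).contDiffOn) i))

theorem contDiffOn_etaCoeffVar (hD : IsOpen D) (hφ : ContDiffOn ℝ ∞ φ D) (hU : IsM U)
    (hY : ContDiffOn ℝ ∞ (Y 3) (reg D U)) : ContDiffOn ℝ ∞ (etaCoeffVar φ U Y) (reg D U) := by
  have s1 := (hU.contDiff_deriv 3).contDiffOn (s := reg D U)
  have h1 : ContDiffOn ℝ ∞ (fun x => deriv φ (U 3 x)) (reg D U) :=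
    (contDiffOn_deriv hD hφ).comp (hU.smooth 3).contDiffOn fun _ hx => hx.2
  have h2 : ContDiffOn ℝ ∞ (fun x => φ (U 3 x)) (reg D U) :=
    hφ.comp (hU.smooth 3).contDiffOn fun _ hx => hx.2
  exact ((h1.mul hY).div s1 fun _ hx => hx.1).sub
    ((h2.mul (contDiffOn_deriv (isOpen_reg hD hU) hY)).div (s1.pow 2)
      fun _ hx => pow_ne_zero 2 hx.1)

theorem contDiffOn_momentumVar (hD : IsOpen D) (hφ : ContDiffOn ℝ ∞ φ D) (hU : IsM U) (hc : IsM c)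
    (hb : IsM b) (i : Fin 4) : ContDiffOn ℝ ∞ (momentumVar φ U c b i) (reg D U) :=
  ((contDiffOn_etaCoeffVar hD hφ hU (hc.smooth 3).contDiffOn).mul
    (contDiffOn_deriv (isOpen_reg hD hU)
      (contDiffOn_hat hU (fun i => (hb.smooth i).contDiffOn) i))).add
  ((contDiffOn_etaCoeff hφ hU).mul
    (contDiffOn_deriv (isOpen_reg hD hU) (contDiffOn_hatVar hU hc hb i)))

theorem smoothOn_etaCoeff_family (hφ : ContDiffOn ℝ ∞ φ D) (hU : IsM U) (hc : IsM c) :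
    SmoothOn (regFamily D U c) fun ε => etaCoeff φ (U + ε • c) := by
  have s0 := hU.smooth 3
  have c0 := hc.smooth 3
  have s1 := hU.contDiff_deriv 3
  have c1 := hc.contDiff_deriv 3
  have h1 : ContDiffOn ℝ ∞ (fun p : ℝ × ℝ => deriv ((U + p.1 • c) 3) p.2) (regFamily D U c) := by
    simp only [deriv_variation hU.smooth hc.smooth]
    exact ContDiff.contDiffOn (by fun_prop)
  have h0 : ContDiffOn ℝ ∞ (fun p : ℝ × ℝ => (U + p.1 • c) 3 p.2) (regFamily D U c) := by
    simp only [variation_apply]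
    exact ContDiff.contDiffOn (by fun_prop)
  exact (hφ.comp h0 fun _ hp => hp.2).div h1 fun _ hp => hp.1

theorem hasDerivAt_momentum_family (hD : IsOpen D) (hφ : ContDiffOn ℝ ∞ φ D) (hU : IsM U)
    (hc : IsM c) (hb : IsM b) (hx : x ∈ reg D U) (i : Fin 4) :
    HasDerivAt (fun ε : ℝ => momentum φ (U + ε • c) b i x) (momentumVar φ U c b i x) 0 := by
  have h := (hasDerivAt_etaCoeff_family hD hφ hU hx (hc.hasDerivAt 3 x).differentiableAt).fun_mul
    (hasDerivAt_deriv_hat_family hD hU hc hb hx i)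
  simp only [zero_smul, add_zero] at h
  exact h

theorem hasDerivAt_deriv_momentum_family (hD : IsOpen D) (hφ : ContDiffOn ℝ ∞ φ D) (hU : IsM U)
    (hc : IsM c) (hb : IsM b) (hx : x ∈ reg D U) (i : Fin 4) :
    HasDerivAt (fun ε : ℝ => deriv (momentum φ (U + ε • c) b i) x)
      (deriv (momentumVar φ U c b i) x) 0 := by
  have hW := isOpen_regFamily hD hU hc
  have hs : SmoothOn (regFamily D U c) fun ε => momentum φ (U + ε • c) b i :=
    ContDiffOn.mul (smoothOn_etaCoeff_family hφ hU hc)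
      ((smoothOn_hat_family hU hc hb i).smooth_dX hW)
  exact hs.hasDerivAt_deriv_family hW (isOpen_reg hD hU) (fun _ hy => mem_regFamily hy)
    (fun _ hy => hasDerivAt_momentum_family hD hφ hU hc hb hy i) hx

theorem sum_mul_opDeriv_Theta_eta_Theta (hD : IsOpen D) (hφ : ContDiffOn ℝ ∞ φ D) (hU : IsM U)
    (hc : IsM c) (hb : IsM b) (hx : x ∈ reg D U) (a : Fld) :
    ∑ i, a i x * opDeriv (fun U Y => Theta U (eta φ U (Theta U Y))) U c b i x
      = hat U a 1 x * deriv (momentumVar φ U c b 2) x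
        - hat U a 2 x * deriv (momentumVar φ U c b 1) x
        + hatVar U c a 1 x * deriv (momentum φ U b 2) x
        - hatVar U c a 2 x * deriv (momentum φ U b 1) x := by
  have hev := eventually_slice_t (isOpen_regFamily hD hU hc) (mem_regFamily hx)
  have hT : ∀ᶠ ε in nhds (0 : ℝ), _ := hev.mono fun ε hε =>
    Theta_eta_Theta_eq hD hφ (isM_variation hU hc ε) hb hε
  have hm := hasDerivAt_deriv_momentum_family hD hφ hU hc hb hx
  have hs := hasDerivAt_slope_family hU hc hx
  have e0 : opDeriv (fun U Y => Theta U (eta φ U (Theta U Y))) U c b 0 x = 0 :=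
    ((hasDerivAt_const (0 : ℝ) (0 : ℝ)).congr_of_eventuallyEq (hT.mono fun ε h => h.1)).deriv
  have e1 : opDeriv (fun U Y => Theta U (eta φ U (Theta U Y))) U c b 1 x = _ :=
    ((hm 2).congr_of_eventuallyEq (hT.mono fun ε h => h.2.1)).deriv
  have e2 : opDeriv (fun U Y => Theta U (eta φ U (Theta U Y))) U c b 2 x = _ :=
    ((hm 1).fun_neg.congr_of_eventuallyEq (hT.mono fun ε h => h.2.2.1)).deriv
  have e3 : opDeriv (fun U Y => Theta U (eta φ U (Theta U Y))) U c b 3 x = _ :=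
    ((((hs 1).fun_mul (hm 2)).fun_neg.fun_add ((hs 2).fun_mul (hm 1))).congr_of_eventuallyEq
      (hT.mono fun ε h => h.2.2.2)).deriv
  rw [Fin.sum_univ_four, e0, e1, e2, e3]
  simp only [zero_smul, add_zero, hat, hatVar]
  ring

theorem hasDerivAt_momentum (hD : IsOpen D) (hφ : ContDiffOn ℝ ∞ φ D) (hU : IsM U) (hb : IsM b)
    (hx : x ∈ reg D U) (i : Fin 4) :
    HasDerivAt (momentum φ U b i) (deriv (momentum φ U b i) x) x :=
  hasDerivAt_of_contDiffOn (isOpen_reg hD hU) (contDiffOn_momentum hD hφ hU hb i) hx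

theorem hasDerivAt_momentumVar (hD : IsOpen D) (hφ : ContDiffOn ℝ ∞ φ D) (hU : IsM U) (hc : IsM c)
    (hb : IsM b) (hx : x ∈ reg D U) (i : Fin 4) :
    HasDerivAt (momentumVar φ U c b i) (deriv (momentumVar φ U c b i) x) x :=
  hasDerivAt_of_contDiffOn (isOpen_reg hD hU) (contDiffOn_momentumVar hD hφ hU hc hb i) hx

theorem isSkew_Theta_eta_Theta (hD : IsOpen D) (hφ : ContDiffOn ℝ ∞ φ D) :
    IsSkew (fun U Y => Theta U (eta φ U (Theta U Y))) (reg D) := by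
  intro U hU a b ha hb
  have hR := isOpen_reg hD hU
  have hh : ∀ {a : Fld}, IsM a → ∀ i, ContDiffOn ℝ ∞ (hat U a i) (reg D U) :=
    fun ha i => contDiffOn_hat hU (fun i => (ha.smooth i).contDiffOn) i
  have hm : ∀ {a : Fld}, IsM a → ∀ i, ContDiffOn ℝ ∞ (momentum φ U a i) (reg D U) :=
    fun ha i => contDiffOn_momentum hD hφ hU ha i
  have hcont : ∀ {a b : Fld}, IsM a → IsM b →
      ContinuousOn (fun x => ∑ i, a i x * Theta U (eta φ U (Theta U b)) i x) (reg D U) := by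
    intro a b ha hb
    have m := fun i => contDiffOn_deriv hR (hm hb i)
    refine ContinuousOn.congr (ContDiffOn.continuousOn (𝕜 := ℝ) (n := ∞) ?_)
      fun x hx => sum_mul_Theta_eta_Theta hD hφ hU hb hx a
    exact ((hh ha 1).mul (m 2)).sub ((hh ha 2).mul (m 1))
  have h := integral_add_add_eq_zero
    (F := fun x => hat U a 1 x * momentum φ U b 2 x - hat U a 2 x * momentum φ U b 1 x
      + (hat U b 1 x * momentum φ U a 2 x - hat U b 2 x * momentum φ U a 1 x))
    (f₃ := fun _ => 0) hR (isClosed_jointSupport a b b) (jointSupport_subset ha hb hb)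
    ((((hh ha.1 1).mul (hm hb.1 2)).sub ((hh ha.1 2).mul (hm hb.1 1))).add
      (((hh hb.1 1).mul (hm ha.1 2)).sub ((hh hb.1 2).mul (hm ha.1 1))))
    (hcont ha.1 hb.1) (hcont hb.1 ha.1) continuousOn_const ?_ ?_ ?_ ?_ (fun _ _ => rfl) ?_
  · simpa [pair] using h
  · intro x hx
    have da := fun i => hasDerivAt_hat hD hU ha.1 hx i
    have db := fun i => hasDerivAt_hat hD hU hb.1 hx i
    have ma := fun i => hasDerivAt_momentum hD hφ hU ha.1 hx i
    have mb := fun i => hasDerivAt_momentum hD hφ hU hb.1 hx i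
    refine ((((da 1).fun_mul (mb 2)).fun_sub ((da 2).fun_mul (mb 1))).fun_add
      (((db 1).fun_mul (ma 2)).fun_sub ((db 2).fun_mul (ma 1)))).congr_deriv ?_
    rw [sum_mul_Theta_eta_Theta hD hφ hU hb.1 hx, sum_mul_Theta_eta_Theta hD hφ hU ha.1 hx]
    simp only [momentum]
    ring
  · intro x hx
    have h0 := eq_zero_of_notMem_jointSupport hx
    simp only [hat, (h0 _).1, (h0 _).2.1]
    ring
  · intro x hx
    simp only [(eq_zero_of_notMem_jointSupport hx _).1, zero_mul, Finset.sum_const_zero]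
  · intro x hx
    simp only [(eq_zero_of_notMem_jointSupport hx _).2.1, zero_mul, Finset.sum_const_zero]
  · intro x
    simp only [momentum, etaCoeff, periodic_hat hU ha.1 _ x, periodic_hat hU hb.1 _ x,
      periodic_deriv (periodic_hat hU ha.1 _) x, periodic_deriv (periodic_hat hU hb.1 _) x,
      hU.periodic _ x, periodic_deriv (hU.periodic _) x]

end

theorem isCoImplectic_Theta_eta_Theta {φ : ℝ → ℝ} {D : Set ℝ} (hD : IsOpen D)
    (hφ : ContDiffOn ℝ ∞ φ D) :
    IsCoImplectic (fun U Y => Theta U (eta φ U (Theta U Y))) (reg D) := by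
  refine ⟨isSkew_Theta_eta_Theta hD hφ, fun U hU a b c ha hb hc => ?_⟩
  have hR := isOpen_reg hD hU
  have hh : ∀ {a : Fld}, IsM a → ∀ i, ContDiffOn ℝ ∞ (hat U a i) (reg D U) :=
    fun ha i => contDiffOn_hat hU (fun i => (ha.smooth i).contDiffOn) i
  have hv : ∀ {c a : Fld}, IsM c → IsM a → ∀ i, ContDiffOn ℝ ∞ (hatVar U c a i) (reg D U) :=
    fun hc ha i => contDiffOn_hatVar hU hc ha i
  have hm : ∀ {a : Fld}, IsM a → ∀ i, ContDiffOn ℝ ∞ (momentum φ U a i) (reg D U) :=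
    fun ha i => contDiffOn_momentum hD hφ hU ha i
  have hmv : ∀ {c a : Fld}, IsM c → IsM a → ∀ i,
      ContDiffOn ℝ ∞ (momentumVar φ U c a i) (reg D U) :=
    fun hc ha i => contDiffOn_momentumVar hD hφ hU hc ha i
  have hcont : ∀ {a b c : Fld}, IsM a → IsM b → IsM c → ContinuousOn (fun x => ∑ i, a i x *
      opDeriv (fun U Y => Theta U (eta φ U (Theta U Y))) U c b i x) (reg D U) := by
    intro a b c ha hb hc
    have m := fun i => contDiffOn_deriv hR (hm hb i)
    have mv := fun i => contDiffOn_deriv hR (hmv hc hb i)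
    refine ContinuousOn.congr (ContDiffOn.continuousOn (𝕜 := ℝ) (n := ∞) ?_)
      fun x hx => sum_mul_opDeriv_Theta_eta_Theta hD hφ hU hc hb hx a
    exact ((((hh ha 1).mul (mv 2)).sub ((hh ha 2).mul (mv 1))).add
      ((hv hc ha 1).mul (m 2))).sub ((hv hc ha 2).mul (m 1))
  -- The first four terms integrate by parts, leaving the variation along `c` of `etaCoeff * W`,
  -- where `W = â₁' b̂₂' - â₂' b̂₁'`. The last term is the transport of this density by the
  -- reparametrisation field `c₃ / z_x`, which absorbs the remainder in the cyclic sum.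
  set T : Fld → Fld → Fld → ℝ → ℝ := fun a b c x => hat U a 1 x * momentumVar φ U c b 2 x
    - hat U a 2 x * momentumVar φ U c b 1 x + hatVar U c a 1 x * momentum φ U b 2 x
    - hatVar U c a 2 x * momentum φ U b 1 x - etaCoeff φ U x / deriv (U 3) x * (c 3 x *
      (deriv (hat U a 1) x * deriv (hat U b 2) x - deriv (hat U a 2) x * deriv (hat U b 1) x))
    with hT
  have hTs : ∀ {a b c : Fld}, IsM a → IsM b → IsM c → ContDiffOn ℝ ∞ (T a b c) (reg D U) := by
    intro a b c ha hb hc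
    have da := fun i => contDiffOn_deriv hR (hh ha i)
    have db := fun i => contDiffOn_deriv hR (hh hb i)
    exact (((((hh ha 1).mul (hmv hc hb 2)).sub ((hh ha 2).mul (hmv hc hb 1))).add
      ((hv hc ha 1).mul (hm hb 2))).sub ((hv hc ha 2).mul (hm hb 1))).sub
      (((contDiffOn_etaCoeff hφ hU).div (hU.contDiff_deriv 3).contDiffOn fun _ hx => hx.1).mul
        ((hc.smooth 3).contDiffOn.mul (((da 1).mul (db 2)).sub ((da 2).mul (db 1)))))
  have hh' := fun {a : Fld} (ha : IsM a) (i : Fin 4) {x : ℝ} (hx : x ∈ reg D U) =>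
    hasDerivAt_of_contDiffOn hR (contDiffOn_deriv hR (hh ha i)) hx
  have hTd := fun {a b c : Fld} (ha : IsM a) (hb : IsM b) (hc : IsM c) (x : ℝ)
      (hx : x ∈ reg D U) => (show HasDerivAt (T a b c) _ x from
    ((((((hasDerivAt_hat hD hU ha hx 1).fun_mul (hasDerivAt_momentumVar hD hφ hU hc hb hx 2)).fun_sub
      ((hasDerivAt_hat hD hU ha hx 2).fun_mul (hasDerivAt_momentumVar hD hφ hU hc hb hx 1))).fun_add
      ((hasDerivAt_hatVar hD hU hc ha hx 1).fun_mul (hasDerivAt_momentum hD hφ hU hb hx 2))).fun_sub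
      ((hasDerivAt_hatVar hD hU hc ha hx 2).fun_mul (hasDerivAt_momentum hD hφ hU hb hx 1))).fun_sub
      (((hasDerivAt_etaCoeff hD hφ hU hx).fun_div (hU.hasDerivAt_deriv 3 x) hx.1).fun_mul
        ((hc.hasDerivAt 3 x).fun_mul (((hh' ha 1 hx).fun_mul (hh' hb 2 hx)).fun_sub
          ((hh' ha 2 hx).fun_mul (hh' hb 1 hx)))))))
  have hper : ∀ {a b c : Fld}, IsM a → IsM b → IsM c → ∀ x, T a b c (x + 2 * Real.pi) = T a b c x := by
    intro a b c ha hb hc x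
    simp only [hT, momentum, momentumVar, etaCoeff, etaCoeffVar, periodic_hat hU ha _ x,
      periodic_deriv (periodic_hat hU ha _) x, periodic_deriv (periodic_hat hU hb _) x,
      periodic_hatVar hU hc ha _ x, periodic_deriv (periodic_hatVar hU hc hb _) x,
      hU.periodic _ x, periodic_deriv (hU.periodic _) x, hc.periodic _ x,
      periodic_deriv (hc.periodic _) x]
  refine integral_add_add_eq_zero (F := fun x => T a b c x + T b c a x + T c a b x) hR
    (isClosed_jointSupport a b c) (jointSupport_subset ha hb hc)
    (((hTs ha.1 hb.1 hc.1).add (hTs hb.1 hc.1 ha.1)).add (hTs hc.1 ha.1 hb.1))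
    (hcont ha.1 hb.1 hc.1) (hcont hb.1 hc.1 ha.1) (hcont hc.1 ha.1 hb.1) ?_ ?_ ?_ ?_ ?_ ?_
  · intro x hx
    refine (((hTd ha.1 hb.1 hc.1 x hx).fun_add (hTd hb.1 hc.1 ha.1 x hx)).fun_add
      (hTd hc.1 ha.1 hb.1 x hx)).congr_deriv ?_
    rw [sum_mul_opDeriv_Theta_eta_Theta hD hφ hU hc.1 hb.1 hx,
      sum_mul_opDeriv_Theta_eta_Theta hD hφ hU ha.1 hc.1 hx,
      sum_mul_opDeriv_Theta_eta_Theta hD hφ hU hb.1 ha.1 hx]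
    have hz : deriv (U 3) x ≠ 0 := hx.1
    have hp := fun i => hasDerivAt_of_contDiffOn hR (contDiffOn_deriv hR
      (contDiffOn_slope (D := D) hU i)) hx
    -- `slopeVar_eq` holds near `x`, so `hatVar` may be differentiated in that form, giving second
    -- derivatives of hats and slopes.
    have hv' := fun {c a : Fld} (hc : IsM c) (ha : IsM a) (i : Fin 4) =>
      ((((((hh' hc i hx).fun_add ((hp i).fun_mul (hc.hasDerivAt 3 x))).fun_div
        (hU.hasDerivAt_deriv 3 x) hz).fun_mul (ha.hasDerivAt 3 x)).fun_neg).congr_of_eventuallyEq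
        (Filter.eventually_of_mem (hR.mem_nhds hx) fun y hy => by
          rw [hatVar, slopeVar_eq hD hU hc hy] : hatVar U c a i =ᶠ[nhds x] _))
    simp only [momentum, momentumVar, (hv' ha.1 hb.1 _).deriv, (hv' ha.1 hc.1 _).deriv,
      (hv' hb.1 ha.1 _).deriv, (hv' hb.1 hc.1 _).deriv, (hv' hc.1 ha.1 _).deriv,
      (hv' hc.1 hb.1 _).deriv]
    simp only [hatVar, slopeVar_eq hD hU ha.1 hx, slopeVar_eq hD hU hb.1 hx,
      slopeVar_eq hD hU hc.1 hx, etaCoeffVar, etaCoeff]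
    field_simp
    ring
  · intro x hx
    have h0 := eq_zero_of_notMem_jointSupport hx
    simp only [hT, hat, hatVar, (h0 _).1, (h0 _).2.1, (h0 _).2.2]
    ring
  · intro x hx
    simp only [(eq_zero_of_notMem_jointSupport hx _).1, zero_mul, Finset.sum_const_zero]
  · intro x hx
    simp only [(eq_zero_of_notMem_jointSupport hx _).2.1, zero_mul, Finset.sum_const_zero]
  · intro x hx
    simp only [(eq_zero_of_notMem_jointSupport hx _).2.2, zero_mul, Finset.sum_const_zero]
  · intro x
    simp only [hper ha.1 hb.1 hc.1, hper hb.1 hc.1 ha.1, hper hc.1 ha.1 hb.1]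

/-! ### Lax representation -/

/-- The matrix with the dependence of `ell` on the fields made explicit; the constant entries are
multiplied by `k`. -/
def laxMatrix (l : ℂ) (a b c d r s k : ℂ) : Matrix (Fin 4) (Fin 4) ℂ :=
  !![- l ^ 3 * a, l ^ 2 * b, - l * c, d;
     - 4 * l ^ 4 * k, 3 * l ^ 3 * a, - 2 * l ^ 2 * b, l * c;
     - 10 * l ^ 5 * r, 6 * l ^ 4 * k, - 3 * l ^ 3 * a, l ^ 2 * b;
     - 20 * l ^ 6 * s, 10 * l ^ 5 * r, - 4 * l ^ 4 * k, l ^ 3 * a]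

theorem ell_eq (l : ℂ) (U : Fld) (r₁ r₂ : ℝ → ℝ) (x : ℝ) :
    ell l U r₁ r₂ x = laxMatrix l (deriv (U 0) x : ℝ) (deriv (U 1) x : ℝ) (deriv (U 2) x : ℝ)
      (deriv (U 3) x : ℝ) (r₁ x) (r₂ x) 1 := by
  simp only [ell, laxMatrix, mul_one]

theorem hasDerivAt_laxMatrix (l : ℂ) {a b c d r s : ℝ → ℝ} {a' b' c' d' r' s' t : ℝ}
    (ha : HasDerivAt a a' t) (hb : HasDerivAt b b' t) (hc : HasDerivAt c c' t)
    (hd : HasDerivAt d d' t) (hr : HasDerivAt r r' t) (hs : HasDerivAt s s' t) (i j : Fin 4) :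
    HasDerivAt (fun y => laxMatrix l (a y) (b y) (c y) (d y) (r y) (s y) 1 i j)
      (laxMatrix l a' b' c' d' r' s' 0 i j) t := by
  have A := ha.ofReal_comp
  have B := hb.ofReal_comp
  have C := hc.ofReal_comp
  have E := hd.ofReal_comp
  have R := hr.ofReal_comp
  have S := hs.ofReal_comp
  -- Written as `e * 1` and `e * 0` so that the derivative of a constant entry is again an entry of
  -- `laxMatrix`, with last argument `0`.
  have k : ∀ e : ℂ, HasDerivAt (fun _ : ℝ => e * 1) (e * 0) t := fun e => by
    simpa using hasDerivAt_const t e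
  fin_cases i <;> fin_cases j
  · exact A.const_mul _
  · exact B.const_mul _
  · exact C.const_mul _
  · exact E
  · exact k _
  · exact A.const_mul _
  · exact B.const_mul _
  · exact C.const_mul _
  · exact R.const_mul _
  · exact k _
  · exact A.const_mul _
  · exact B.const_mul _
  · exact S.const_mul _
  · exact R.const_mul _
  · exact k _
  · exact A.const_mul _

/-- The matrix to which the zero curvature condition reduces, in terms of the residuals of the
equations. -/
def curvature (l : ℂ) (a b c d r s : ℂ) : Matrix (Fin 4) (Fin 4) ℂ :=
  !![- l ^ 3 * a, l ^ 2 * b, - l * c, d;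
     0, 3 * l ^ 3 * a, - 2 * l ^ 2 * b, l * c;
     - 10 * l ^ 5 * r, 0, - 3 * l ^ 3 * a, l ^ 2 * b;
     - 20 * l ^ 6 * s, 10 * l ^ 5 * r, 0, l ^ 3 * a]

section

variable {W : Set (ℝ × ℝ)} {U : ℝ → Fld} {r₁ r₂ : ℝ → ℝ → ℝ} {t x : ℝ}

/-- The derivative in `x` of the residual of an equation of the system. -/
theorem deriv_residual (hW : IsOpen W) (hU : ∀ i, SmoothOn W fun t => U t i) (h : (t, x) ∈ W)
    (i : Fin 4) :
    deriv (fun x => deriv (fun s => U s i x) t - K (U t) i x) x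
      = Dt (fun s => U s 0) (dX fun s => U s i) t x + dX (fun s => U s i) t x * deriv (U t 0) x
        - deriv (shift (U t) i) x := by
  have hK : ∀ y, K (U t) i y = shift (U t) i y - U t 0 y * deriv (U t i) y := fun y => by
    fin_cases i <;> simp [K, shift]
  have h1 := ((((hU i).smooth_dT hW).hasDerivAt_x hW h).fun_sub
    (((smoothOn_shift hU i).hasDerivAt_x hW h).fun_sub (((hU 0).hasDerivAt_x hW h).fun_mul
      (((hU i).smooth_dX hW).hasDerivAt_x hW h)))).deriv
  simp only [hK]
  refine Eq.trans h1 ?_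
  rw [Dt_eq, (hU i).dT_dX hW h]
  simp only [dX_apply]
  ring

theorem deriv_residual_eq_zero (hW : IsOpen W) (hs : SolvesOn W U) (h : (t, x) ∈ W) (i : Fin 4) :
    deriv (fun x => deriv (fun s => U s i x) t - K (U t) i x) x = 0 := by
  have h1 : (fun x => deriv (fun s => U s i x) t - K (U t) i x) =ᶠ[nhds x] fun _ => 0 :=
    (eventually_slice_x hW h).mono fun y hy => sub_eq_zero.2 (hs (t, y) hy i)
  rw [h1.deriv_eq, deriv_const]

/-- Since `uℓ` commutes with `ℓ`, the curvature is `D_t ℓ + u_x ℓ + [ℓ, q]`. The commutator supplies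
the shift terms, so the entries become `D_t (U_i)_x + u_x (U_i)_x - (shift U)_i,x`, the
`x`-derivative of a residual; the system itself is not visible to `ℓ`. -/
theorem zeroCurvature_iff (hW : IsOpen W) (hU : ∀ i, SmoothOn W fun t => U t i)
    (h1 : SmoothOn W r₁) (h2 : SmoothOn W r₂) (h : (t, x) ∈ W) (l : ℂ) :
    ZeroCurvature l U r₁ r₂ t x ↔ curvature l
      (deriv (fun x => deriv (fun s => U s 0 x) t - K (U t) 0 x) x : ℝ)
      (deriv (fun x => deriv (fun s => U s 1 x) t - K (U t) 1 x) x : ℝ)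
      (deriv (fun x => deriv (fun s => U s 2 x) t - K (U t) 2 x) x : ℝ)
      (deriv (fun x => deriv (fun s => U s 3 x) t - K (U t) 3 x) x : ℝ)
      ((Dt (fun t => U t 0) r₁ t x + r₁ t x * deriv (U t 0) x - 1 : ℝ))
      ((Dt (fun t => U t 0) r₂ t x + r₂ t x * deriv (U t 0) x - r₁ t x : ℝ)) = 0 := by
  have ht : ∀ i j, deriv (fun s => ell l (U s) (r₁ s) (r₂ s) x i j) t = _ := fun i j => by
    simp only [ell_eq]
    exact (hasDerivAt_laxMatrix l (((hU 0).smooth_dX hW).hasDerivAt_t hW h)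
      (((hU 1).smooth_dX hW).hasDerivAt_t hW h) (((hU 2).smooth_dX hW).hasDerivAt_t hW h)
      (((hU 3).smooth_dX hW).hasDerivAt_t hW h) (h1.hasDerivAt_t hW h)
      (h2.hasDerivAt_t hW h) i j).deriv
  have hx : ∀ i j, deriv (fun y => pMat l (U t) (r₁ t) (r₂ t) y i j) x = _ := fun i j => by
    simp only [pMat, ell_eq, Matrix.add_apply, Matrix.smul_apply, smul_eq_mul]
    exact ((((hU 0).hasDerivAt_x hW h).ofReal_comp.fun_neg.fun_mul
      (hasDerivAt_laxMatrix l (((hU 0).smooth_dX hW).hasDerivAt_x hW h)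
      (((hU 1).smooth_dX hW).hasDerivAt_x hW h) (((hU 2).smooth_dX hW).hasDerivAt_x hW h)
      (((hU 3).smooth_dX hW).hasDerivAt_x hW h) (h1.hasDerivAt_x hW h)
      (h2.hasDerivAt_x hW h) i j)).add_const (qMat l i j)).deriv
  rw [ZeroCurvature]
  refine Eq.congr ?_ rfl
  ext i j
  simp only [deriv_residual hW hU h, Matrix.sub_apply, Matrix.add_apply, Matrix.of_apply, ht, hx]
  simp only [pMat, Matrix.add_apply,
    ell_eq, Matrix.mul_apply, Fin.sum_univ_four, Matrix.smul_apply, smul_eq_mul, Dt_eq, dX_apply,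
    Complex.ofReal_sub, Complex.ofReal_add, Complex.ofReal_mul, Complex.ofReal_one]
  have e0 : shift (U t) 0 = U t 1 := rfl
  have e1 : shift (U t) 1 = U t 2 := rfl
  have e2 : shift (U t) 2 = U t 3 := rfl
  have e3 : deriv (shift (U t) 3) x = 0 := by simp [shift]
  rw [e0, e1, e2, e3]
  fin_cases i <;> fin_cases j <;>
    simp only [laxMatrix, curvature, qMat, Fin.zero_eta, Fin.mk_one, Fin.reduceFinMk, Matrix.of_apply,
      Matrix.cons_val, Complex.ofReal_zero] <;> ring

theorem zeroCurvature_of_solves (hW : IsOpen W) (hU : ∀ i, SmoothOn W fun t => U t i)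
    (h1 : SmoothOn W r₁) (h2 : SmoothOn W r₂) (hs : SolvesOn W U) (hr : SolvesR W U r₁ r₂) (l : ℂ)
    (p : ℝ × ℝ) (hp : p ∈ W) : ZeroCurvature l U r₁ r₂ p.1 p.2 := by
  rw [zeroCurvature_iff hW hU h1 h2 hp]
  simp only [deriv_residual_eq_zero hW hs hp, (hr p hp).1, (hr p hp).2, sub_self, Complex.ofReal_zero]
  ext i j
  fin_cases i <;> fin_cases j <;> simp [curvature]

theorem solves_of_zeroCurvature (hW : IsOpen W) (hU : ∀ i, SmoothOn W fun t => U t i)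
    (h1 : SmoothOn W r₁) (h2 : SmoothOn W r₂)
    (hz : ∀ l : ℂ, ∀ p ∈ W, ZeroCurvature l U r₁ r₂ p.1 p.2) :
    (∀ p ∈ W, ∀ i, deriv (fun x => deriv (fun s => U s i x) p.1 - K (U p.1) i x) p.2 = 0) ∧
      SolvesR W U r₁ r₂ := by
  -- The single value `l = 1` suffices: every residual occurs in some entry with a nonzero
  -- coefficient.
  have key : ∀ p ∈ W, _ := fun p hp => (zeroCurvature_iff hW hU h1 h2 hp 1).1 (hz 1 p hp)
  refine ⟨fun p hp i => ?_, fun p hp => ⟨?_, ?_⟩⟩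
  · have c0 := congrFun (congrFun (key p hp) 0) 0
    have c1 := congrFun (congrFun (key p hp) 0) 1
    have c2 := congrFun (congrFun (key p hp) 0) 2
    have c3 := congrFun (congrFun (key p hp) 0) 3
    simp only [curvature, Matrix.of_apply, Matrix.cons_val, Matrix.zero_apply, one_pow, one_mul,
      neg_mul, neg_eq_zero, Complex.ofReal_eq_zero] at c0 c1 c2 c3
    fin_cases i <;> assumption
  · have c := congrFun (congrFun (key p hp) 2) 0
    simp only [curvature, Matrix.of_apply, Matrix.cons_val, Matrix.zero_apply, one_pow, mul_one,
      mul_eq_zero, Complex.ofReal_eq_zero] at c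
    exact sub_eq_zero.1 (c.resolve_left (by norm_num))
  · have c := congrFun (congrFun (key p hp) 3) 0
    simp only [curvature, Matrix.of_apply, Matrix.cons_val, Matrix.zero_apply, one_pow, mul_one,
      mul_eq_zero, Complex.ofReal_eq_zero] at c
    exact sub_eq_zero.1 (c.resolve_left (by norm_num))

theorem smoothOn_rho (hW : IsOpen W) (hU : ∀ i, SmoothOn W fun t => U t i)
    (hz : ∀ p ∈ W, deriv (U p.1 3) p.2 ≠ 0) :
    SmoothOn W (fun t => rho₁ (U t)) ∧ SmoothOn W (fun t => rho₂ (U t)) := by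
  have d : ∀ i, ContDiffOn ℝ ∞ (fun p : ℝ × ℝ => deriv (U p.1 i) p.2) W := fun i =>
    (hU i).smooth_dX hW
  have n : ∀ (c : ℝ) (k : ℕ), c ≠ 0 → ∀ p ∈ W, c * deriv (U p.1 3) p.2 ^ k ≠ 0 :=
    fun c k hc p hp => mul_ne_zero hc (pow_ne_zero k (hz p hp))
  have m : ∀ (c : ℝ) (k : ℕ), ContDiffOn ℝ ∞ (fun p : ℝ × ℝ => c * deriv (U p.1 3) p.2 ^ k) W :=
    fun c k => contDiffOn_const.mul ((d 3).pow k)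
  constructor
  · exact ((((d 2).div (d 3) hz).sub (((d 0).mul ((d 2).pow 2)).div (m 2 2)
      (n 2 2 (by norm_num)))).add (((d 1).mul ((d 2).pow 3)).div (m 6 3) (n 6 3 (by norm_num)))).sub
      (((d 2).pow 5).div (m 30 4) (n 30 4 (by norm_num)))
  · exact (((((d 2).pow 2).div (m 2 2) (n 2 2 (by norm_num))).sub
      (((d 0).mul ((d 2).pow 3)).div (m 3 3) (n 3 3 (by norm_num)))).add
      (((d 1).mul ((d 2).pow 4)).div (m 8 4) (n 8 4 (by norm_num)))).sub
      ((contDiffOn_const.mul ((d 2).pow 6)).div (m 720 5) (n 720 5 (by norm_num)))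

/-- Both expressions are rational in the first jet, so differentiating along the characteristic and
clearing powers of `z_x` leaves polynomial identities. -/
theorem solvesR_rho (hW : IsOpen W) (hU : ∀ i, SmoothOn W fun t => U t i) (hs : SolvesOn W U)
    (hz : ∀ p ∈ W, deriv (U p.1 3) p.2 ≠ 0) :
    SolvesR W U (fun t => rho₁ (U t)) (fun t => rho₂ (U t)) := by
  rintro ⟨t, x⟩ hp
  have hz0 : deriv (U t 3) x ≠ 0 := hz _ hp
  have hz' : deriv (U t 3) (x + U t 0 x * (t - t)) ≠ 0 := by simpa using hz0
  have n : ∀ (c : ℝ) (k : ℕ), c ≠ 0 → c * deriv (U t 3) (x + U t 0 x * (t - t)) ^ k ≠ 0 :=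
    fun c k hc => mul_ne_zero hc (pow_ne_zero k hz')
  have d := fun i => hasDerivAt_line_deriv hW hU hs hp i
  have e0 : shift (U t) 0 = U t 1 := rfl
  have e1 : shift (U t) 1 = U t 2 := rfl
  have e2 : shift (U t) 2 = U t 3 := rfl
  have e3 : deriv (shift (U t) 3) x = 0 := by simp [shift]
  have q := fun (c : ℝ) (k : ℕ) => ((d 3).fun_pow k).const_mul c
  have h1 := (((d 2).fun_div (d 3) hz').fun_sub (((d 0).fun_mul ((d 2).fun_pow 2)).fun_div (q 2 2)
      (n 2 2 (by norm_num)))).fun_add (((d 1).fun_mul ((d 2).fun_pow 3)).fun_div (q 6 3)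
      (n 6 3 (by norm_num))) |>.fun_sub
      (((d 2).fun_pow 5).fun_div (q 30 4) (n 30 4 (by norm_num)))
  have h2 := ((((d 2).fun_pow 2).fun_div (q 2 2) (n 2 2 (by norm_num))).fun_sub
      (((d 0).fun_mul ((d 2).fun_pow 3)).fun_div (q 3 3) (n 3 3 (by norm_num)))).fun_add
      (((d 1).fun_mul ((d 2).fun_pow 4)).fun_div (q 8 4) (n 8 4 (by norm_num))) |>.fun_sub
      ((((d 2).fun_pow 6).const_mul 19).fun_div (q 720 5) (n 720 5 (by norm_num)))
  obtain ⟨s1, s2⟩ := smoothOn_rho hW hU hz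
  simp only [Dt_eq_of_hasDerivAt_line (u := fun s => U s 0) hW s1 hp h1,
    Dt_eq_of_hasDerivAt_line (u := fun s => U s 0) hW s2 hp h2]
  rw [e0, e1, e2, e3]
  simp only [sub_self, mul_zero, add_zero, rho₁, rho₂, Nat.cast_ofNat, Nat.add_one_sub_one, pow_one]
  constructor
  · field_simp
    ring
  · field_simp
    ring

end

/-! ### Linear independence of the conserved functionals -/

/-- A polynomial vanishing at all natural numbers is zero in characteristic zero; the shift `k`
absorbs the different powers occurring below. -/
theorem eq_zero_of_sum_mul_pow_eq_zero {F : Type*} [Field F] [CharZero F] {s : Finset ℕ} {g : ℕ → F}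
    (k : ℕ) (h : ∀ c : ℕ, ∑ n ∈ s, g n * (c : F) ^ (n + k) = 0) : ∀ n ∈ s, g n = 0 := by
  intro n hn
  set p : Polynomial F := ∑ n ∈ s, Polynomial.C (g n) * Polynomial.X ^ (n + k) with hp
  have hroot : ∀ c : ℕ, p.IsRoot (c : F) := fun c => by
    simp only [Polynomial.IsRoot, hp, Polynomial.eval_finsetSum, Polynomial.eval_mul,
      Polynomial.eval_C, Polynomial.eval_pow, Polynomial.eval_X, h c]
  have hp0 : p = 0 := Polynomial.eq_zero_of_infinite_isRoot p
    ((Set.infinite_range_of_injective Nat.cast_injective).mono (by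
      rintro _ ⟨c, rfl⟩
      exact hroot c))
  have hc : p.coeff (n + k) = g n := by
    simp only [hp, Polynomial.finsetSum_coeff, Polynomial.coeff_C_mul_X_pow, add_left_inj]
    simp [hn]
  rw [← hc, hp0, Polynomial.coeff_zero]

theorem eq_zero_of_integral_sq_eq_zero {f : ℝ → ℝ} (hf : Continuous f)
    (h : ∫ x in (0 : ℝ)..(2 * Real.pi), f x ^ 2 = 0) : f 0 = 0 := by
  by_contra h0
  refine absurd h (ne_of_gt ?_)
  exact intervalIntegral.integral_pos Real.two_pi_pos (hf.pow 2).continuousOn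
    (fun x _ => sq_nonneg _) ⟨0, ⟨le_rfl, Real.two_pi_pos.le⟩, by positivity⟩

/-- The constant field `(0, 0, 0, c)`. -/
theorem isM_const (c : ℝ) : IsM ![0, 0, 0, fun _ => c] :=
  isM_vec contDiff_const contDiff_const contDiff_const contDiff_const
    (fun _ => rfl) (fun _ => rfl) (fun _ => rfl) (fun _ => rfl)

theorem HA_const (n : ℕ) (c : ℝ) :
    HA n ![0, 0, 0, fun _ => c] = 2 * Real.pi * (c ^ (n + 2) / ((n : ℝ) + 2)) := by
  simp [HA, functional, mul_div_assoc]

theorem HB_const (n : ℕ) (c : ℝ) : HB n ![0, 0, 0, fun _ => c] = 0 := by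
  simp [HB, functional]

/-- On constant `z` with `u = v = w = 0` every `B_n` vanishes and `A_n` is a multiple of `c^(n+2)`,
so the `A`-coefficients separate first. -/
theorem HA_coeff_eq_zero {s t : Finset ℕ} {a b : ℕ → ℝ}
    (h : ∀ U, IsM U → ∑ n ∈ s, a n * HA n U + ∑ n ∈ t, b n * HB n U = 0) : ∀ n ∈ s, a n = 0 := by
  have h1 := eq_zero_of_sum_mul_pow_eq_zero (s := s) (g := fun n => a n / ((n : ℝ) + 2)) 2 fun c => by
    have h2 := h _ (isM_const c)
    simp only [HA_const, HB_const, mul_zero, Finset.sum_const_zero, add_zero] at h2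
    have h3 : 2 * Real.pi * ∑ n ∈ s, a n / ((n : ℝ) + 2) * (c : ℝ) ^ (n + 2) = 0 := by
      rw [← h2, Finset.mul_sum]
      exact Finset.sum_congr rfl fun n _ => by ring
    exact (mul_eq_zero.1 h3).resolve_left Real.two_pi_pos.ne'
  intro n hn
  have h2 : (n : ℝ) + 2 ≠ 0 := by positivity
  exact (div_eq_zero_iff.1 (h1 n hn)).resolve_right h2

/-- With `u = w = 0`, a relation reads `-2 ∫ v z_x Σ b_n z^(n+1) = 0`. Choosing `v = z_x Σ b_n
z^(n+1)` makes this `-2 ∫ v² = 0`, so `v` vanishes at `0`. -/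
theorem HB_coeff_eq_zero {t : Finset ℕ} {b : ℕ → ℝ}
    (h : ∀ U, IsM U → ∑ n ∈ t, b n * HB n U = 0) : ∀ n ∈ t, b n = 0 := by
  refine eq_zero_of_sum_mul_pow_eq_zero 1 fun c => ?_
  -- At `x = 0` one has `z = c` and `z_x = 1`, so `v 0` is the polynomial evaluated at `c`.
  set z : ℝ → ℝ := fun x => c + Real.sin x with hz
  have hz' : ∀ x, deriv z x = Real.cos x := fun x => ((Real.hasDerivAt_sin x).const_add _).deriv
  set v : ℝ → ℝ := fun x => (∑ n ∈ t, b n * z x ^ (n + 1)) * Real.cos x with hv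
  have sz : ContDiff ℝ ∞ z := contDiff_const.add Real.contDiff_sin
  have sv : ContDiff ℝ ∞ v :=
    (ContDiff.sum fun n _ => contDiff_const.mul (sz.pow _)).mul Real.contDiff_cos
  have hU : IsM ![0, v, 0, z] := isM_vec contDiff_const sv contDiff_const sz (fun _ => rfl)
    (fun x => by simp only [hv, hz, Real.sin_add_two_pi, Real.cos_add_two_pi]) (fun _ => rfl)
    (fun x => by simp only [hz, Real.sin_add_two_pi])
  have h1 := h _ hU
  simp only [HB, functional, Matrix.cons_val, hz', Pi.zero_apply] at h1
  simp only [← intervalIntegral.integral_const_mul] at h1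
  have sc := Real.continuous_cos
  have sz' := sz.continuous
  have sv' := sv.continuous
  rw [← intervalIntegral.integral_finsetSum fun n _ =>
    (Continuous.intervalIntegrable (by fun_prop) _ _)] at h1
  have h2 : (fun x => ∑ n ∈ t, b n * (z x ^ n * Real.cos x * ((0 : ℝ) ^ 2 - 2 * v x * z x)))
      = fun x => -2 * v x ^ 2 := by
    funext x
    have h3 : ∀ n, b n * (z x ^ n * Real.cos x * ((0 : ℝ) ^ 2 - 2 * v x * z x))
        = -2 * v x * (b n * z x ^ (n + 1) * Real.cos x) := fun n => by ring
    simp only [h3, ← Finset.mul_sum, ← Finset.sum_mul]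
    change -2 * v x * v x = _
    ring
  rw [h2, intervalIntegral.integral_const_mul] at h1
  have h4 := eq_zero_of_integral_sq_eq_zero sv' ((mul_eq_zero.1 h1).resolve_left (by norm_num))
  simpa [hv, hz] using h4

theorem linearIndependent_HA_HB :
    LinearIndependent ℝ (fun (n : ℕ ⊕ ℕ) (U : {U : Fld // IsM U}) => Sum.elim HA HB n U.1) := by
  rw [linearIndependent_iff']
  intro s g hs
  rw [← Finset.toLeft_disjSum_toRight (u := s), Finset.sum_disjSum] at hs
  have h : ∀ U, IsM U → ∑ n ∈ s.toLeft, g (.inl n) * HA n U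
      + ∑ n ∈ s.toRight, g (.inr n) * HB n U = 0 := fun U hU => by
    have := congrFun hs ⟨U, hU⟩
    simpa [Finset.sum_apply] using this
  have hA := HA_coeff_eq_zero h
  have hB := HB_coeff_eq_zero (t := s.toRight) (b := fun n => g (.inr n)) fun U hU => by
    have h1 := h U hU
    rwa [Finset.sum_eq_zero fun n hn => by rw [hA n hn, zero_mul], zero_add] at h1
  rintro (n | n) hn
  · exact hA n (Finset.mem_toLeft.2 hn)
  · exact hB n (Finset.mem_toRight.2 hn)

/-! ### Independence of the root functionals -/

/-- The field `(0, 0, ε sin x, a + ε cos x)`. -/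
def circle (a ε : ℝ) : Fld := ![0, 0, fun x => ε * Real.sin x, fun x => a + ε * Real.cos x]

theorem isM_circle (a ε : ℝ) : IsM (circle a ε) :=
  isM_vec contDiff_const contDiff_const (contDiff_const.mul Real.contDiff_sin)
    (contDiff_const.add (contDiff_const.mul Real.contDiff_cos)) (fun _ => rfl) (fun _ => rfl)
    (fun x => by simp only [Real.sin_add_two_pi]) (fun x => by simp only [Real.cos_add_two_pi])

theorem radicand_circle (a ε x : ℝ) : radicand 0 5 (circle a ε) x = ε ^ 2 := by
  have w1 : deriv (circle a ε 2) = fun x => ε * Real.cos x :=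
    funext fun x => ((Real.hasDerivAt_sin x).const_mul ε).deriv
  have z1 : deriv (circle a ε 3) = fun x => ε * -Real.sin x :=
    funext fun x => (((Real.hasDerivAt_cos x).const_mul ε).const_add a).deriv
  have w2 : deriv (fun x => ε * Real.cos x) x = ε * -Real.sin x :=
    ((Real.hasDerivAt_cos x).const_mul ε).deriv
  have z2 : deriv (fun x => ε * -Real.sin x) x = ε * -Real.cos x :=
    ((Real.hasDerivAt_sin x).fun_neg.const_mul ε).deriv
  simp only [radicand, Matrix.cons_val, iteratedDeriv_two', w1, z1, w2, z2]
  linear_combination ε ^ 2 * Real.sin_sq_add_cos_sq x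

theorem HN_circle (n : ℕ) (a ε : ℝ) : HN 0 n (Pi.single 5 1) (circle a ε)
    = (∫ x in (0 : ℝ)..(2 * Real.pi), (((a + ε * Real.cos x) ^ n : ℝ) : ℂ)) *
      ((ε ^ 2 : ℝ) : ℂ) ^ (1 / ((∑ j, (Pi.single 5 1 : Fin 10 → ℕ) j * rootOrder j : ℕ) : ℂ)) := by
  have h : ∀ x, ∏ j, radicand 0 j (circle a ε) x ^ (Pi.single 5 1 : Fin 10 → ℕ) j = ε ^ 2 := by
    intro x
    rw [Finset.prod_eq_single 5 (fun j _ hj => by rw [Pi.single_eq_of_ne hj, pow_zero]) (by simp),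
      Pi.single_eq_same, pow_one, radicand_circle]
  simp only [HN, h]
  rw [intervalIntegral.integral_mul_const]
  rfl

/-- On circles in the `(z, w)`-plane the radicand is the constant `ε²`, so all functionals share one
nonzero root factor. Cancelling it and letting `ε → 0` turns a relation into `Σ g_n c^n = 0`. -/
theorem linearIndependent_HN :
    LinearIndependent ℂ (fun (n : ℕ) (U : {U : Fld // IsM U}) => HN 0 n (Pi.single 5 1) U.1) := by
  rw [linearIndependent_iff']
  intro s g hs
  refine eq_zero_of_sum_mul_pow_eq_zero 0 fun c => ?_
  set Q : ℝ → ℂ := fun ε => ∑ n ∈ s, g n *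
    ∫ x in (0 : ℝ)..(2 * Real.pi), ((((c : ℝ) + ε * Real.cos x) ^ n : ℝ) : ℂ) with hQ
  have hcont : Continuous Q := by
    refine continuous_finsetSum _ fun n _ => continuous_const.mul ?_
    exact intervalIntegral.continuous_parametric_intervalIntegral_of_continuous' (by fun_prop) _ _
  have h0 : ∀ ε : ℝ, ε ≠ 0 → Q ε = 0 := by
    intro ε hε
    have h1 := congrFun hs ⟨_, isM_circle c ε⟩
    simp only [Finset.sum_apply, Pi.smul_apply, smul_eq_mul, HN_circle, ← mul_assoc,
      ← Finset.sum_mul, Pi.zero_apply, mul_eq_zero] at h1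
    refine h1.resolve_right fun h => ?_
    rw [Complex.cpow_eq_zero_iff, Complex.ofReal_eq_zero] at h
    exact pow_ne_zero 2 hε h.1
  -- At `ε = 0` the root factor vanishes and the relation says nothing; continuity of `Q` extends
  -- the vanishing from `ε ≠ 0`.
  have h1 : Q = fun _ => 0 := hcont.ext_on (dense_compl_singleton (0 : ℝ)) continuous_const
    fun ε hε => h0 ε hε
  have h2 : Q 0 = 2 * Real.pi * ∑ n ∈ s, g n * (c : ℂ) ^ (n + 0) := by
    simp only [hQ, zero_mul, add_zero, intervalIntegral.integral_const, Finset.mul_sum]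
    refine Finset.sum_congr rfl fun n _ => ?_
    simp only [sub_zero, Complex.real_smul]
    push_cast
    ring
  rw [h1] at h2
  have hpi : (2 * Real.pi : ℂ) ≠ 0 := by exact_mod_cast Real.two_pi_pos.ne'
  exact (mul_eq_zero.1 h2.symm).resolve_left hpi

end Riemann4

end

/-! ### The full statement -/

theorem proposition5 :
    -- equivalence of `D_t⁴ u = 0` with the system
    ((∀ (I : Set ℝ) (u : ℝ → ℝ → ℝ), IsOpen I →
        Riemann4.SmoothOn (I ×ˢ Set.univ) u →
        (∀ t ∈ I, Function.Periodic (u t) (2 * Real.pi)) →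
        (∀ t ∈ I, ∀ x, (Riemann4.Dt u)^[4] u t x = 0) →
        Riemann4.IsSol I (Riemann4.tower u)) ∧
      (∀ (I : Set ℝ) (U : ℝ → Riemann4.Fld), IsOpen I → Riemann4.IsSol I U →
        ∀ t ∈ I, ∀ x,
          (∀ i, U t i x = Riemann4.tower (fun s => U s 0) t i x) ∧
          (Riemann4.Dt (fun s => U s 0))^[4] (fun s => U s 0) t x = 0)) ∧
    -- `K = -ϑ grad H`
    (∀ U, Riemann4.IsM U → ∃ g, Riemann4.IsGrad Riemann4.H U g ∧
      (∀ x ∈ Riemann4.reg Set.univ U, ∀ i,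
        Riemann4.Theta U (Riemann4.K U) i x = - g i x) ∧
      Riemann4.ThetaInv U g (- Riemann4.K U)) ∧
    -- `ϑ⁻¹` is co-implectic and degenerate
    Riemann4.IsCoImplectic Riemann4.Theta (Riemann4.reg Set.univ) ∧
    (∀ U, Riemann4.IsM U → ∀ f : ℝ → ℝ, ContDiff ℝ ∞ f →
      ∀ x ∈ Riemann4.reg Set.univ U, ∀ i,
        Riemann4.Theta U (fun j y => f y * deriv (U j) y) i x = 0) ∧
    -- `ϑ` is skew and inverts `ϑ⁻¹` on the covectors annihilated by the kernel of `ϑ⁻¹`,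
    -- up to the constants of the inverse derivatives
    (∀ U, Riemann4.IsM U → ∀ g h Y Z, Riemann4.ThetaInv U g Y → Riemann4.ThetaInv U h Z →
      Riemann4.pair g Z + Riemann4.pair h Y = 0) ∧
    (∀ U, Riemann4.IsM U →
      (∀ Y, Riemann4.IsM Y → ∀ x ∈ Riemann4.reg Set.univ U,
        ∑ i, deriv (U i) x * Riemann4.Theta U Y i x = 0) ∧
      ∀ g Y, Riemann4.ThetaInv U g Y → (∀ x, ∑ i, deriv (U i) x * g i x = 0) →
        ∃ c : ℝ, ∀ x ∈ Riemann4.reg Set.univ U, ∀ i,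
          Riemann4.Theta U (Y + fun j _ => if j = 3 then c else 0) i x = g i x) ∧
    -- bi-Hamiltonian structures
    (∀ (φ : ℝ → ℝ) (D : Set ℝ), IsOpen D → ContDiffOn ℝ ∞ φ D →
      Riemann4.IsImplectic (Riemann4.eta φ) (Riemann4.reg D) ∧
      Riemann4.IsCoImplectic
        (fun U Y => Riemann4.Theta U (Riemann4.eta φ U (Riemann4.Theta U Y)))
        (Riemann4.reg D)) ∧
    (∀ U, Riemann4.IsM U → ∀ x ∈ Riemann4.reg Set.univ U, ∀ g : Riemann4.Fld,
      (∀ i, Riemann4.eta (fun _ => 1) U g i x = 0) → ∀ i, g i x = 0) ∧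
    (∀ n : ℕ, ∀ U, Riemann4.IsM U → ∃ g, Riemann4.IsGrad (Riemann4.HA n) U g ∧
      ∀ x ∈ Riemann4.reg {s | s ^ n ≠ 0} U, ∀ i,
        Riemann4.K U i x = - Riemann4.eta (fun s => (s ^ n)⁻¹) U g i x) ∧
    -- Lax representation
    (∀ (W : Set (ℝ × ℝ)) (U : ℝ → Riemann4.Fld) (r₁ r₂ : ℝ → ℝ → ℝ), IsOpen W →
      (∀ i, Riemann4.SmoothOn W (fun t => U t i)) →
      Riemann4.SmoothOn W r₁ → Riemann4.SmoothOn W r₂ →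
      ((Riemann4.SolvesOn W U ∧ Riemann4.SolvesR W U r₁ r₂ →
          ∀ l : ℂ, ∀ p ∈ W, Riemann4.ZeroCurvature l U r₁ r₂ p.1 p.2) ∧
        ((∀ l : ℂ, ∀ p ∈ W, Riemann4.ZeroCurvature l U r₁ r₂ p.1 p.2) →
          (∀ p ∈ W, ∀ i,
            deriv (fun x => deriv (fun s => U s i x) p.1 - Riemann4.K (U p.1) i x) p.2 = 0) ∧
          Riemann4.SolvesR W U r₁ r₂))) ∧
    (∀ (W : Set (ℝ × ℝ)) (U : ℝ → Riemann4.Fld), IsOpen W →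
      (∀ i, Riemann4.SmoothOn W (fun t => U t i)) → Riemann4.SolvesOn W U →
      (∀ p ∈ W, deriv (U p.1 3) p.2 ≠ 0) →
      Riemann4.SmoothOn W (fun t => Riemann4.rho₁ (U t)) ∧
      Riemann4.SmoothOn W (fun t => Riemann4.rho₂ (U t)) ∧
      Riemann4.SolvesR W U (fun t => Riemann4.rho₁ (U t)) (fun t => Riemann4.rho₂ (U t))) ∧
    -- polynomial conservation laws
    (∀ (k : Fin 5 → ℝ) (j : Fin 6),
      Riemann4.Conserved (Riemann4.functional (Riemann4.polyDensity k j))) ∧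
    (∀ n, Riemann4.Conserved (Riemann4.HA n)) ∧
    (∀ n, Riemann4.Conserved (Riemann4.HB n)) ∧
    LinearIndependent ℝ (fun (n : ℕ ⊕ ℕ) (U : {U : Riemann4.Fld // Riemann4.IsM U}) =>
      Sum.elim Riemann4.HA Riemann4.HB n U.1) ∧
    -- involution
    (∀ n : ℕ, ∀ U, Riemann4.IsM U → ∃ g, Riemann4.IsGrad (Riemann4.HB n) U g) ∧
    (∀ n m : ℕ ⊕ ℕ, ∀ U, Riemann4.IsM U → ∀ g h,
      Riemann4.IsGrad (Sum.elim Riemann4.HA Riemann4.HB n) U g →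
      Riemann4.IsGrad (Sum.elim Riemann4.HA Riemann4.HB m) U h →
      (∀ x ∈ Riemann4.reg Set.univ U,
        ∑ i, g i x * Riemann4.eta (fun _ => 1) U h i x = 0) ∧
      Riemann4.pair g (Riemann4.eta (fun _ => 1) U h) = 0) ∧
    -- non-polynomial conservation laws
    (∀ (k : Fin 5 → ℝ) (n : ℕ) (m : Fin 10 → ℕ), m ≠ 0 →
      Riemann4.Conserved (Riemann4.HN k n m)) ∧
    LinearIndependent ℂ (fun (n : ℕ) (U : {U : Riemann4.Fld // Riemann4.IsM U}) =>
      Riemann4.HN 0 n (Pi.single 5 1) U.1) := by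
  refine ⟨⟨fun I u hI hu hp h4 => Riemann4.isSol_tower hI hu hp h4,
      fun I U hI hU t ht x => hU.eq_tower hI ht x⟩,
    fun U hU => ⟨Riemann4.gradH U, Riemann4.isGrad_H hU, fun x hx i => Riemann4.Theta_K hU hx i,
      Riemann4.ThetaInv_gradH hU⟩,
    Riemann4.isCoImplectic_Theta,
    fun U hU f hf x hx i => Riemann4.Theta_smul_deriv hU hf hx i,
    fun U hU g h Y Z hY hZ => Riemann4.ThetaInv_skew hY hZ hU,
    fun U hU => ⟨fun Y hY x hx => Riemann4.sum_deriv_mul_Theta isOpen_univ hU hx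
        fun i => (hY.hasDerivAt i x).differentiableAt,
      fun g Y hY hg => Riemann4.Theta_ThetaInv hU hY hg⟩,
    fun φ D hD hφ => ⟨Riemann4.isImplectic_eta hD hφ,
      Riemann4.isCoImplectic_Theta_eta_Theta hD hφ⟩,
    fun U _ x hx g h i => Riemann4.eta_one_nondegenerate hx.1 h i,
    fun n U hU => ⟨Riemann4.gradHA n U, Riemann4.isGrad_HA n hU,
      fun x hx i => Riemann4.K_eq_eta_gradHA n hx i⟩,
    fun W U r₁ r₂ hW hU h1 h2 =>
      ⟨fun h l p hp => Riemann4.zeroCurvature_of_solves hW hU h1 h2 h.1 h.2 l p hp,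
        fun h => Riemann4.solves_of_zeroCurvature hW hU h1 h2 h⟩,
    fun W U hW hU hs hz => ⟨(Riemann4.smoothOn_rho hW hU hz).1, (Riemann4.smoothOn_rho hW hU hz).2,
      Riemann4.solvesR_rho hW hU hs hz⟩,
    Riemann4.conserved_polyDensity, Riemann4.conserved_HA, Riemann4.conserved_HB,
    Riemann4.linearIndependent_HA_HB,
    fun n U hU => ⟨Riemann4.gradHB n U, Riemann4.isGrad_HB n hU⟩,
    fun n m U hU g h hg hh => Riemann4.involution n m hU hg hh,
    Riemann4.conserved_HN, Riemann4.linearIndependent_HN⟩
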